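/- **Setting (censored semi-bandits with a common threshold).** There are $K$ arms with mean losses $\mu_1\le\mu_2\le\dots\le\mu_K$ in $[0,1]$, a threshold $\theta_c\in(0,1]$ and an amount of resource $Q\ge\theta_c$. The losses $X_{t,i}$ ($t\ge 1$, $i\in[K]$) are independent over rounds and arms, and $X_{t,i}$ is Bernoulli with mean $\mu_i$. In round $t$ the learner chooses $a_t\in\mathcal A_Q=\{a\in[0,1]^K:\sum_i a_i\le Q\}$ and observes $Y_{t,i}=X_{t,i}\mathbf 1\{a_{t,i}<\theta_c\}$ for $i\in[K]$. Let $$\Delta_a=\sum_{i=1}^K\mu_i\mathbf 1\{a_i<\theta_c\}-\min_{a'\in\mathcal A_Q}\sum_{i=1}^K\mu_i\mathbf 1\{a'_i<\theta_c\},\qquad \Delta_m=\max_{a\in\mathcal A_Q}\Delta_a,\qquad \mathcal R_T=\sum_{t=1}^T\Delta_{a_t}.$$ Let $M=\min\{\lfloor Q/\theta_c\rfloor,K\}$, and let $\Theta$ consist of the numbers $Q/m$ ($m\in[K]$) that do not exceed $\min\{1,Q\}$ together with $\min\{1,Q\}$, listed increasingly as $\Theta[1]<\dots<\Theta[|\Theta|]$.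 Let $d(p,q)=p\log\frac pq+(1-p)\log\frac{1-p}{1-q}$. **Algorithm CSB-ST** with inputs $K,Q,\delta,\epsilon$. The learner does not know $\mu$ or $\theta_c$, and lists the arms in an arbitrary fixed order. Put $W=\dfrac{\log(\log_2|\Theta|/\delta)}{Q\log(1/(1-\epsilon))}$. *Threshold phase.* Start with $l=0$, $u=|\Theta|$, $i=\lceil u/2\rceil$, $C=0$. While $i\ne u$, in each round allocate $\hat\theta=\Theta[i]$ to each of the first $\lfloor Q/\hat\theta\rfloor$ arms of the list and $0$ to the others. If a loss is observed at one of these first arms, set $l\leftarrow i$, then $i\leftarrow l+\lceil(u-l)/2\rceil$ and $C\leftarrow0$. Otherwise set $C\leftarrow C+1$, and if now $C\ge W$, set $u\leftarrow i$, then $i\leftarrow u-\lfloor(u-l)/2\rfloor$ and $C\leftarrow0$. *Regret minimization phase (MP-TS).* Once $i=u$, let $\hat\theta=\Theta[i]$, $\hat M=\lfloor Q/\hat\theta\rfloor$, and $S_j=F_j=1$ for all arms $j$. In each remaining round draw independent samples $\hat\mu_j\sim\mathrm{Beta}(S_j,F_j)$ (independent of everything else given $S,F$), let $L_t$ be the $K-\hat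 M$ arms with smallest samples, allocate $\hat\theta$ to each arm outside $L_t$ and $0$ to the arms in $L_t$, and for $j\in L_t$ add $Y_{t,j}$ to $S_j$ and $1-Y_{t,j}$ to $F_j$. **Theorem.** Assume $\mu_1\ge\epsilon>0$, $1\le M<K$ and $\mu_{K-M}<\mu_{K-M+1}$. Run CSB-ST for $T$ rounds with $\delta=1/T$, so that $W=\dfrac{\log(T\log_2|\Theta|)}{Q\log(1/(1-\epsilon))}$. Then there is a constant $c$, which does not depend on $T$ (it may depend on the instance, on $\epsilon$ and on the learner's order of the arms), such that for all $T\ge2$ $$\mathbb E[\mathcal R_T]\le W\log_2(|\Theta|)\,\Delta_m+c\,(\log T)^{2/3}+\sum_{i\in[K]\setminus[K-M]}\frac{(\mu_i-\mu_{K-M})\log T}{d(\mu_i,\mu_{K-M})}.$$ -/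

import Mathlib

open MeasureTheory ProbabilityTheory

noncomputable section

namespace CSB

/-! ### The censored semi-bandit problem with a common threshold

Arms are indexed by `Fin K`, `μ i` is the mean loss of arm `i`, `θ` is the common threshold and
`Q` is the amount of resource. -/

/-- The set of feasible allocations. -/
def feasible (K : ℕ) (Q : ℝ) : Set (Fin K → ℝ) :=
  {a | (∀ i, a i ∈ Set.Icc (0 : ℝ) 1) ∧ ∑ i, a i ≤ Q}

/-- Mean loss of one round under the allocation `a`: the sum of `μ i` over the arms `i` with
`a i < θ`. -/
def meanLoss {K : ℕ} (μ : Fin K → ℝ) (θ : ℝ) (a : Fin K → ℝ) : ℝ :=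
  ∑ i, μ i * (if a i < θ then 1 else 0)

/-- Mean loss of an optimal feasible allocation (only finitely many values are taken, so the
infimum is a minimum). -/
def optLoss {K : ℕ} (μ : Fin K → ℝ) (θ Q : ℝ) : ℝ :=
  sInf (meanLoss μ θ '' feasible K Q)

/-- The gap `Δ_a`: one-round regret of the allocation `a`. -/
def gap {K : ℕ} (μ : Fin K → ℝ) (θ Q : ℝ) (a : Fin K → ℝ) : ℝ :=
  meanLoss μ θ a - optLoss μ θ Q

/-- `Δ_m`, the largest gap of a feasible allocation (again a maximum over finitely many values). -/
def maxGap {K : ℕ} (μ : Fin K → ℝ) (θ Q : ℝ) : ℝ :=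
  sSup (gap μ θ Q '' feasible K Q)

/-- `M = min {⌊Q / θ⌋, K}`, the number of arms that can be covered. -/
def numCovered (K : ℕ) (θ Q : ℝ) : ℕ := min ⌊Q / θ⌋₊ K

/-- The candidate set `Θ = {Q / K, Q / (K - 1), …, min {1, Q}}`: all values `Q / m`, `1 ≤ m ≤ K`,
not above `min {1, Q}`, together with the last element `min {1, Q}`. -/
def candidates (K : ℕ) (Q : ℝ) : Finset ℝ :=
  insert (min 1 Q) (((Finset.Icc 1 K).image fun m : ℕ => Q / (m : ℝ)).filter (· ≤ min 1 Q))

/-- `Θ[i]`, the `i`-th candidate in increasing order, `i = 1, …, |Θ|`. -/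
def candidate (K : ℕ) (Q : ℝ) (i : ℕ) : ℝ :=
  ((candidates K Q).sort (· ≤ ·)).getD (i - 1) 0

/-- `W = log (log₂ |Θ| / δ) / (Q log (1 / (1 - ε)))`. -/
def window (K : ℕ) (Q ε δ : ℝ) : ℝ :=
  Real.log (Real.logb 2 ((candidates K Q).card : ℝ) / δ) / (Q * Real.log (1 / (1 - ε)))

/-- Kullback–Leibler divergence `d(p, q)` of the Bernoulli law with parameter `p` from the
Bernoulli law with parameter `q`. -/
def klBer (p q : ℝ) : ℝ :=
  p * Real.log (p / q) + (1 - p) * Real.log ((1 - p) / (1 - q))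

/-! ### The algorithm CSB-ST

The learner lists the arms in an order of its own, which is unrelated to the order of the means:
arm `i` stands at position `order i` (counted from `0`). -/

/-- Internal state of the learner: the variables `l`, `u`, `i`, `C` of the binary search, and the
numbers `S`, `F` of the Beta posteriors. -/
structure State (K : ℕ) where
  l : ℕ
  u : ℕ
  i : ℕ
  C : ℕ
  S : Fin K → ℕ
  F : Fin K → ℕ

/-- The initial state: `C = 0`, `l = 0`, `u = |Θ|`, `i = ⌈u / 2⌉` and `S = F = 1`. -/
def State.init (K : ℕ) (Q : ℝ) : State K where
  l := 0
  u := (candidates K Q).card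
  i := ((candidates K Q).card + 1) / 2
  C := 0
  S := fun _ => 1
  F := fun _ => 1

/-- The current threshold estimate `Θ[i]`. -/
def State.threshold {K : ℕ} (Q : ℝ) (s : State K) : ℝ := candidate K Q s.i

/-- The number of arms served with the current threshold estimate, `Q / Θ[i]` rounded down. -/
def State.numServed {K : ℕ} (Q : ℝ) (s : State K) : ℕ := ⌊Q / s.threshold Q⌋₊

/-- The `n` arms with the smallest samples `z`; ties are broken by the position in the list. -/
def smallest {K : ℕ} (order : Equiv.Perm (Fin K)) (n : ℕ) (z : Fin K → ℝ) : Finset (Fin K) :=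
  Finset.univ.filter fun i =>
    (Finset.univ.filter fun j => z j < z i ∨ (z j = z i ∧ order j < order i)).card < n

/-- The arms which receive resource in state `s`, when the posterior samples are `z`. While the
binary search runs (`i ≠ u`) these are the first arms of the list; afterwards they are all arms
but the `K - numServed` ones with the smallest samples. -/
def State.served {K : ℕ} (Q : ℝ) (order : Equiv.Perm (Fin K)) (s : State K) (z : Fin K → ℝ) :
    Finset (Fin K) :=
  if s.i ≠ s.u then Finset.univ.filter fun j => ((order j : Fin K) : ℕ) < s.numServed Q
  else (smallest order (K - s.numServed Q) z)ᶜ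

/-- The allocation chosen in state `s`, when the posterior samples are `z`. -/
def State.alloc {K : ℕ} (Q : ℝ) (order : Equiv.Perm (Fin K)) (s : State K) (z : Fin K → ℝ) :
    Fin K → ℝ :=
  fun j => if j ∈ s.served Q order z then s.threshold Q else 0

/-- The state after the feedback `Y` of the round (`Y j` is true if a loss was observed at `j`).
In the binary search phase a loss at a served arm moves the lower end `l` to `i`, and `W`
consecutive rounds without loss move the upper end `u` to `i`; afterwards the counts of the arms
without resource are updated. -/
def State.update {K : ℕ} (Q : ℝ) (W : ℝ) (order : Equiv.Perm (Fin K)) (s : State K)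
    (z : Fin K → ℝ) (Y : Fin K → Bool) : State K :=
  open Classical in
  if s.i ≠ s.u then
    if ∃ j ∈ s.served Q order z, Y j = true then
      { s with l := s.i, i := s.i + (s.u - s.i + 1) / 2, C := 0 }
    else if W ≤ ((s.C + 1 : ℕ) : ℝ) then
      { s with u := s.i, i := s.i - (s.i - s.l) / 2, C := 0 }
    else
      { s with C := s.C + 1 }
  else
    { s with
      S := fun j => if j ∉ s.served Q order z ∧ Y j = true then s.S j + 1 else s.S j
      F := fun j => if j ∉ s.served Q order z ∧ Y j = false then s.F j + 1 else s.F j }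

/-! ### The interaction -/

/-- The randomness of a run. `X t i` tells whether arm `i` produces a loss in round `t`; these are
independent over rounds and arms, with probability `μ i`. `Z t i a b` is the draw from the Beta
distribution with parameters `a`, `b` available to the learner for arm `i` in round `t` (only the
one for the current counts is used); the draws are independent of each other and of the losses. -/
structure IsNoise {K : ℕ} (μ : Fin K → ℝ) {Ω : Type*} [MeasurableSpace Ω] (P : Measure Ω)
    (X : ℕ → Fin K → Ω → Bool) (Z : ℕ → Fin K → ℕ → ℕ → Ω → ℝ) : Prop where
  measurable_loss : ∀ t i, Measurable (X t i)
  measurable_draw : ∀ t i a b, Measurable (Z t i a b)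
  prob_loss : ∀ t i, P {ω | X t i ω = true} = ENNReal.ofReal (μ i)
  law_draw : ∀ t i a b, 1 ≤ a → 1 ≤ b → P.map (Z t i a b) = betaMeasure (a : ℝ) (b : ℝ)
  indep_loss : iIndepFun (fun p : ℕ × Fin K => X p.1 p.2) P
  indep_draw : iIndepFun (fun p : (ℕ × Fin K) × (ℕ × ℕ) => Z p.1.1 p.1.2 p.2.1 p.2.2) P
  indep_loss_draw :
    IndepFun (fun ω (p : ℕ × Fin K) => X p.1 p.2 ω)
      (fun ω (p : (ℕ × Fin K) × (ℕ × ℕ)) => Z p.1.1 p.1.2 p.2.1 p.2.2 ω) P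

/-- The posterior samples of all arms in round `t`, drawn from the Beta distributions with the
current parameters `S`, `F`. -/
def samples {K : ℕ} {Ω : Type*} (Z : ℕ → Fin K → ℕ → ℕ → Ω → ℝ) (t : ℕ) (s : State K) (ω : Ω) :
    Fin K → ℝ :=
  fun i => Z t i (s.S i) (s.F i) ω

/-- The feedback under the allocation `a` if the losses are `x`: a loss is observed (and incurred)
exactly at the arms with a loss whose allocation is below the threshold. -/
def feedback {K : ℕ} (θ : ℝ) (a : Fin K → ℝ) (x : Fin K → Bool) : Fin K → Bool :=
  fun i => x i && decide (a i < θ)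

/-- The state of CSB-ST with window `W` at the beginning of round `t = 0, 1, 2, …`. -/
def state {K : ℕ} (θ Q W : ℝ) (order : Equiv.Perm (Fin K)) {Ω : Type*}
    (X : ℕ → Fin K → Ω → Bool) (Z : ℕ → Fin K → ℕ → ℕ → Ω → ℝ) (ω : Ω) : ℕ → State K
  | 0 => State.init K Q
  | t + 1 =>
    let s := state θ Q W order X Z ω t
    let z := samples Z t s ω
    s.update Q W order z (feedback θ (s.alloc Q order z) fun i => X t i ω)

/-- The allocation chosen by CSB-ST with window `W` in round `t`. -/
def allocation {K : ℕ} (θ Q W : ℝ) (order : Equiv.Perm (Fin K)) {Ω : Type*}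
    (X : ℕ → Fin K → Ω → Bool) (Z : ℕ → Fin K → ℕ → ℕ → Ω → ℝ) (t : ℕ) (ω : Ω) : Fin K → ℝ :=
  let s := state θ Q W order X Z ω t
  s.alloc Q order (samples Z t s ω)

/-- The pseudo-regret of CSB-ST with window `W` over `T` rounds. -/
def regret {K : ℕ} (μ : Fin K → ℝ) (θ Q W : ℝ) (order : Equiv.Perm (Fin K)) {Ω : Type*}
    (X : ℕ → Fin K → Ω → Bool) (Z : ℕ → Fin K → ℕ → ℕ → Ω → ℝ) (T : ℕ) (ω : Ω) : ℝ :=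
  ∑ t ∈ Finset.range T, gap μ θ Q (allocation θ Q W order X Z t ω)

end CSB

end

open scoped ENNReal

noncomputable section

namespace CSB

/-! ### Binomial weights and Beta measures -/

/-! Every round is of at least one of four kinds: a search round with an estimate at or above the
threshold (`Above`), a search round with an estimate below it (`Below`), a round in which the upper
end of the search lies below the threshold (`Failed`), or a second-phase round with a usable
estimate that serves the right number of arms (`Good`, see `good_of_state`). Rounds of the first
three kinds are charged `maxGap`.

`Above` rounds never show a loss, so their number is bounded deterministically by the potential
`remaining`; this gives the first term of the theorem. In a `Below` round the lower end moves with
probability at least `ε`, so the expected number of these rounds is bounded (`occ_below_le`).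
`Failed` is controlled by the supermartingale `risk`: a test below the threshold stays silent for a
whole window with probability at most `((1 - ε) ^ Q) ^ W ≤ 1 / T`, so these rounds also cost a
constant (`measure_failed_le`).

In `Good` rounds the algorithm is Thompson sampling that plays (leaves unserved) `K - M` arms at a
time. The analysis rests on two devices. First, for integer parameters the Beta density at `u` is,
up to the factor `k + f + 1`, the binomial weight `binom u k f` (`betaMeasure_apply`), so posterior
tails follow from binomial bounds. Second, a pair of counts of an arm is left by a play at most
once, and the new loss is independent of the decision to play. Hence the expected number of plays of
arm `i` at counts `(k, f)` is at most `binom (μ i) k f` (`sum_measure_playEvent_le`), and any sum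
over the plays of one arm is at most the deterministic series `binomSum` (`occ_played_le`). No
stopping times are needed. Inequalities between conditional probabilities given the state are
transferred to expected sums over rounds by `occ_le_occ`.

Fix a level `y` between the optimal and the suboptimal means. An optimal arm has a sample above `y`
only a bounded expected number of times (`occ_lt_sample_le`): given the state, such a round is
traded at the rate `odds` for a round in which that arm is played, or it is charged to plays of
misled suboptimal arms; the series of odds converges (`binomSum_odds_lt_top`).

Put `x = (log T)^(1/3)` and accuracy `1 / x`. Outside `exceptional` rounds the gap is nonpositive or
is due to a single suboptimal arm `i` whose sample is at most `μ p + 2 / x`, and then it is at most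
`μ i - μ p + 4 / x` (`excess_le`). The number of such plays is about `x ^ 3` divided by a divergence
perturbed by `O(1 / x)` (`occ_played_small_le`, `leadingBound_le`). Both perturbations cost `O(x ^
2) = O((log T)^(2/3))`, as do the concentration sums at accuracy `1 / x`. Exceptional rounds also
cost `O(x ^ 2)` (`growthLE_exceptionalBound`): after about `x ^ 2` observations a further
coincidence carries a factor `exp (-c x ^ 2)`, which beats every polynomial waiting time. -/

/-- The probability of `k` losses and `f` non-losses in `k + f` Bernoulli trials. -/
def binom (μ : ℝ) (k f : ℕ) : ℝ := ((k + f).choose k : ℝ) * μ ^ k * (1 - μ) ^ f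

lemma binom_nonneg {μ : ℝ} (h0 : 0 ≤ μ) (h1 : μ ≤ 1) (k f : ℕ) : 0 ≤ binom μ k f := by
  have : 0 ≤ 1 - μ := by linarith
  unfold binom; positivity

lemma sum_binom_mul (μ a b : ℝ) (n : ℕ) :
    ∑ p ∈ Finset.HasAntidiagonal.antidiagonal n, binom μ p.1 p.2 * (a ^ p.1 * b ^ p.2) =
      (μ * a + (1 - μ) * b) ^ n := by
  rw [(Commute.all _ _).add_pow']
  refine Finset.sum_congr rfl fun p hp => ?_
  rw [Finset.HasAntidiagonal.mem_antidiagonal] at hp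
  simp only [binom, hp, nsmul_eq_mul, mul_pow]
  ring

lemma sum_binom (μ : ℝ) (n : ℕ) :
    ∑ p ∈ Finset.HasAntidiagonal.antidiagonal n, binom μ p.1 p.2 = 1 := by
  simpa using sum_binom_mul μ 1 1 n

lemma binom_le_one {μ : ℝ} (h0 : 0 ≤ μ) (h1 : μ ≤ 1) (k f : ℕ) : binom μ k f ≤ 1 := by
  rw [← sum_binom μ (k + f)]
  exact Finset.single_le_sum (f := fun p : ℕ × ℕ => binom μ p.1 p.2)
    (fun p _ => binom_nonneg h0 h1 p.1 p.2) (a := (k, f)) (by simp)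

lemma binom_succ_succ (μ : ℝ) (k f : ℕ) :
    binom μ (k + 1) (f + 1) = binom μ k (f + 1) * μ + binom μ (k + 1) f * (1 - μ) := by
  have h : (k + 1 + (f + 1)).choose (k + 1) = (k + (f + 1)).choose k + (k + 1 + f).choose (k + 1) := by
    rw [show k + 1 + (f + 1) = (k + f + 1) + 1 by ring, Nat.choose_succ_succ,
      show k + (f + 1) = k + f + 1 by ring, show k + 1 + f = k + f + 1 by ring]
  simp only [binom, h]
  push_cast
  ring

lemma binom_zero_succ (μ : ℝ) (f : ℕ) : binom μ 0 (f + 1) = binom μ 0 f * (1 - μ) := by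
  simp [binom, pow_succ]

lemma binom_succ_zero (μ : ℝ) (k : ℕ) : binom μ (k + 1) 0 = binom μ k 0 * μ := by
  simp [binom, pow_succ]

lemma binom_zero_zero (μ : ℝ) : binom μ 0 0 = 1 := by simp [binom]

/-! ### Chernoff bounds for the binomial law. -/

lemma mgf_bernoulli_le {μ t : ℝ} (h0 : 0 ≤ μ) (h1 : μ ≤ 1) (ht : |t| ≤ 1) :
    μ * Real.exp (t * (1 - μ)) + (1 - μ) * Real.exp (-(t * μ)) ≤ Real.exp (t ^ 2) := by
  -- The quadratic bound on `exp` is available for exponents of modulus at most one, which is why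
  -- the tilting parameter is restricted to `|t| ≤ 1`.
  have key : ∀ x : ℝ, |x| ≤ 1 → Real.exp x ≤ 1 + x + x ^ 2 := fun x hx => by
    have := (abs_le.1 (Real.abs_exp_sub_one_sub_id_le hx)).2
    linarith
  have a1 : |t * (1 - μ)| ≤ 1 := by
    rw [abs_mul, abs_of_nonneg (by linarith : (0 : ℝ) ≤ 1 - μ)]
    exact mul_le_one₀ ht (by linarith) (by linarith)
  have a2 : |-(t * μ)| ≤ 1 := by
    rw [abs_neg, abs_mul, abs_of_nonneg h0]
    exact mul_le_one₀ ht h0 h1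
  have e1 := mul_le_mul_of_nonneg_left (key _ a1) h0
  have e2 := mul_le_mul_of_nonneg_left (key _ a2) (by linarith : (0 : ℝ) ≤ 1 - μ)
  have e3 := Real.add_one_le_exp (t ^ 2)
  have e4 : t ^ 2 * (μ * (1 - μ)) ≤ t ^ 2 * 1 :=
    mul_le_mul_of_nonneg_left (by nlinarith) (sq_nonneg t)
  nlinarith

/-- Exponential tilting. Since `t` may have either sign, one statement serves both tails. -/
lemma sum_binom_chernoff {μ t c : ℝ} (h0 : 0 ≤ μ) (h1 : μ ≤ 1) (ht : |t| ≤ 1) (n : ℕ)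
    (S : Finset (ℕ × ℕ)) (hS : ∀ p ∈ S, p ∈ Finset.HasAntidiagonal.antidiagonal n ∧ c ≤ t * (p.1 - n * μ)) :
    ∑ p ∈ S, binom μ p.1 p.2 ≤ Real.exp (n * t ^ 2 - c) := by
  have h2 : ∀ p ∈ S, binom μ p.1 p.2 ≤ Real.exp (-c) *
      (binom μ p.1 p.2 * (Real.exp (t * (1 - μ)) ^ p.1 * Real.exp (-(t * μ)) ^ p.2)) := by
    intro p hp
    obtain ⟨hp1, hp2⟩ := hS p hp
    rw [Finset.HasAntidiagonal.mem_antidiagonal] at hp1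
    have hn : (n : ℝ) = p.1 + p.2 := by rw [← hp1]; push_cast; ring
    rw [← Real.exp_nat_mul, ← Real.exp_nat_mul, ← Real.exp_add, mul_left_comm, ← Real.exp_add]
    refine le_mul_of_one_le_right (binom_nonneg h0 h1 _ _) (Real.one_le_exp ?_)
    rw [hn] at hp2
    linarith
  calc ∑ p ∈ S, binom μ p.1 p.2
      ≤ ∑ p ∈ S, Real.exp (-c) *
        (binom μ p.1 p.2 * (Real.exp (t * (1 - μ)) ^ p.1 * Real.exp (-(t * μ)) ^ p.2)) :=
        Finset.sum_le_sum h2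
    _ ≤ ∑ p ∈ Finset.HasAntidiagonal.antidiagonal n, Real.exp (-c) *
        (binom μ p.1 p.2 * (Real.exp (t * (1 - μ)) ^ p.1 * Real.exp (-(t * μ)) ^ p.2)) := by
        refine Finset.sum_le_sum_of_subset_of_nonneg (fun p hp => (hS p hp).1) fun p _ _ => ?_
        have := binom_nonneg h0 h1 p.1 p.2
        positivity
    _ = Real.exp (-c) *
        (μ * Real.exp (t * (1 - μ)) + (1 - μ) * Real.exp (-(t * μ))) ^ n := by
        rw [← Finset.mul_sum, sum_binom_mul]
    _ ≤ Real.exp (-c) * Real.exp (t ^ 2) ^ n := by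
        have : 0 ≤ 1 - μ := by linarith
        gcongr
        exact mgf_bernoulli_le h0 h1 ht
    _ = Real.exp (n * t ^ 2 - c) := by
        rw [← Real.exp_nat_mul, ← Real.exp_add]; ring_nf

/-- Both tails of the binomial law. -/
lemma sum_binom_tail {μ η : ℝ} (h0 : 0 ≤ μ) (h1 : μ ≤ 1) (hη : 0 ≤ η) (hη1 : η ≤ 1) (n : ℕ)
    (S : Finset (ℕ × ℕ)) (hS : ∀ p ∈ S, p ∈ Finset.HasAntidiagonal.antidiagonal n ∧ n * η ≤ |p.1 - n * μ|) :
    ∑ p ∈ S, binom μ p.1 p.2 ≤ 2 * Real.exp (-(n * η ^ 2 / 4)) := by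
  -- The tilts `± η / 2` minimise `n t² - n |t| η`.
  have hη2 : |η / 2| ≤ 1 := by rw [abs_of_nonneg (by positivity)]; linarith
  have hη3 : |-(η / 2)| ≤ 1 := by rwa [abs_neg]
  have e1 := sum_binom_chernoff (c := n * η ^ 2 / 2) h0 h1 hη2 n
    (S.filter fun p => (0 : ℝ) ≤ p.1 - n * μ) (by
      intro p hp
      obtain ⟨hp, hp0⟩ := Finset.mem_filter.1 hp
      refine ⟨(hS p hp).1, ?_⟩
      have := (hS p hp).2
      rw [abs_of_nonneg hp0] at this
      nlinarith)
  have e2 := sum_binom_chernoff (c := n * η ^ 2 / 2) h0 h1 hη3 n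
    (S.filter fun p => ¬ (0 : ℝ) ≤ p.1 - n * μ) (by
      intro p hp
      obtain ⟨hp, hp0⟩ := Finset.mem_filter.1 hp
      refine ⟨(hS p hp).1, ?_⟩
      have := (hS p hp).2
      rw [abs_of_neg (not_le.1 hp0)] at this
      nlinarith)
  rw [← Finset.sum_filter_add_sum_filter_not S fun p : ℕ × ℕ => (0 : ℝ) ≤ p.1 - n * μ]
  have e3 : (n : ℝ) * (η / 2) ^ 2 - n * η ^ 2 / 2 = -(n * η ^ 2 / 4) := by ring
  have e4 : (n : ℝ) * (-(η / 2)) ^ 2 - n * η ^ 2 / 2 = -(n * η ^ 2 / 4) := by ring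
  rw [e3] at e1
  rw [e4] at e2
  linarith

/-- The tail bound for a single pair of counts. It is applied with `u` a possible value of the
posterior sample, not the true mean: counts far from what `u` predicts have small likelihood under
`u`. -/
lemma binom_le_exp {u η : ℝ} (h0 : 0 ≤ u) (h1 : u ≤ 1) (hη : 0 ≤ η) (hη1 : η ≤ 1) {k f : ℕ}
    (h : (k + f : ℕ) * η ≤ |k - (k + f : ℕ) * u|) :
    binom u k f ≤ 2 * Real.exp (-((k + f : ℕ) * η ^ 2 / 4)) := by
  simpa using sum_binom_tail h0 h1 hη hη1 (k + f) {(k, f)} (by simpa using h)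

/-- For integer parameters `1 / B(k + 1, f + 1) = (k + f + 1) * (k + f choose k)`, so the posterior
density at `u` is `k + f + 1` times the probability that parameter `u` produces the observed counts.
Posterior tails thereby reduce to pointwise bounds on binomial weights. -/
lemma betaMeasure_apply (k f : ℕ) {A : Set ℝ} (hA : MeasurableSet A) :
    betaMeasure ((k + 1 : ℕ) : ℝ) ((f + 1 : ℕ) : ℝ) A =
      ∫⁻ u in A ∩ Set.Ioo 0 1, ENNReal.ofReal ((k + f + 1 : ℕ) * binom u k f) := by
  rw [betaMeasure, withDensity_apply _ hA, Set.inter_comm, ← Measure.restrict_restrict measurableSet_Ioo,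
    ← lintegral_indicator measurableSet_Ioo]
  refine lintegral_congr fun u => ?_
  by_cases hu : u ∈ Set.Ioo (0 : ℝ) 1
  · rw [Set.indicator_of_mem hu, betaPDF_of_pos_lt_one hu.1 hu.2]
    congr 1
    have hb : 1 / beta ((k + 1 : ℕ) : ℝ) ((f + 1 : ℕ) : ℝ) =
        (k + f + 1 : ℕ) * ((k + f).choose k : ℝ) := by
      have : ((k + 1 : ℕ) : ℝ) + ((f + 1 : ℕ) : ℝ) = ((k + f + 1 : ℕ) : ℝ) + 1 := by
        push_cast; ring
      rw [beta, this, Real.Gamma_nat_eq_factorial]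
      push_cast
      rw [Real.Gamma_nat_eq_factorial, Real.Gamma_nat_eq_factorial]
      have hc := Nat.add_choose_mul_factorial_mul_factorial k f
      have hc' : ((k + f).choose k : ℝ) * k.factorial * f.factorial = (k + f).factorial := by
        exact_mod_cast (by rw [Nat.choose_symm_add]; exact hc)
      rw [Nat.factorial_succ]
      push_cast
      rw [← hc']
      have := Nat.factorial_ne_zero k
      have := Nat.factorial_ne_zero f
      field_simp
    rw [hb, show ((k + 1 : ℕ) : ℝ) - 1 = (k : ℕ) by push_cast; ring,
      show ((f + 1 : ℕ) : ℝ) - 1 = (f : ℕ) by push_cast; ring, Real.rpow_natCast,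
      Real.rpow_natCast, binom]
    ring
  · rw [Set.indicator_of_notMem hu]
    rw [Set.mem_Ioo, not_and_or, not_lt, not_lt] at hu
    rcases hu with hu | hu
    · exact betaPDF_eq_zero_of_nonpos hu
    · exact betaPDF_eq_zero_of_one_le hu

lemma isProbabilityMeasure_betaMeasure_nat {a b : ℕ} (ha : 1 ≤ a) (hb : 1 ≤ b) :
    IsProbabilityMeasure (betaMeasure (a : ℝ) (b : ℝ)) :=
  isProbabilityMeasureBeta (by exact_mod_cast ha) (by exact_mod_cast hb)

lemma betaMeasure_le_of_binom_le {k f : ℕ} {A : Set ℝ} (hA : MeasurableSet A) {B : ℝ}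
    (h : ∀ u ∈ A, 0 < u → u < 1 → binom u k f ≤ B) :
    betaMeasure ((k + 1 : ℕ) : ℝ) ((f + 1 : ℕ) : ℝ) A ≤ ENNReal.ofReal ((k + f + 1 : ℕ) * B) := by
  rw [betaMeasure_apply k f hA]
  calc ∫⁻ u in A ∩ Set.Ioo 0 1, ENNReal.ofReal ((k + f + 1 : ℕ) * binom u k f)
      ≤ ∫⁻ _ in A ∩ Set.Ioo 0 1, ENNReal.ofReal ((k + f + 1 : ℕ) * B) := by
        refine setLIntegral_mono measurable_const fun u hu => ENNReal.ofReal_le_ofReal ?_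
        exact mul_le_mul_of_nonneg_left (h u hu.1 hu.2.1 hu.2.2) (Nat.cast_nonneg _)
    _ = ENNReal.ofReal ((k + f + 1 : ℕ) * B) * volume (A ∩ Set.Ioo 0 1) := by
        rw [setLIntegral_const]
    _ ≤ ENNReal.ofReal ((k + f + 1 : ℕ) * B) * 1 := by
        gcongr
        exact (measure_mono Set.inter_subset_right).trans (by simp)
    _ = _ := mul_one _

/-- Concentration of the posterior around the empirical mean. -/
lemma betaMeasure_le_exp {k f : ℕ} {A : Set ℝ} (hA : MeasurableSet A) {η : ℝ} (hη : 0 ≤ η)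
    (hη1 : η ≤ 1) (h : ∀ u ∈ A, (k + f : ℕ) * η ≤ |k - (k + f : ℕ) * u|) :
    betaMeasure ((k + 1 : ℕ) : ℝ) ((f + 1 : ℕ) : ℝ) A ≤
      ENNReal.ofReal ((k + f + 1 : ℕ) * (2 * Real.exp (-((k + f : ℕ) * η ^ 2 / 4)))) :=
  betaMeasure_le_of_binom_le hA fun u hu h0 h1 => binom_le_exp h0.le h1.le hη hη1 (h u hu)

/-! ### Bernoulli divergence and large deviations of the posterior. -/

lemma klBer_pos {p q : ℝ} (hp : 0 < p) (hp1 : p ≤ 1) (hq0 : 0 < q) (hq1 : q < 1) (h : q ≠ p) :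
    0 < klBer p q := by
  -- Strictness is drawn from the first summand alone, so that `p = 1`, where the second summand
  -- vanishes, is allowed.
  have e1 : p - q < p * Real.log (p / q) := by
    have hne : q / p ≠ 1 := fun e => h (by rwa [div_eq_one_iff_eq hp.ne'] at e)
    have h2 : Real.log (q / p) = - Real.log (p / q) := by rw [← Real.log_inv, inv_div]
    have h3 := Real.log_lt_sub_one_of_pos (by positivity : 0 < q / p) hne
    rw [h2] at h3
    have h4 := mul_lt_mul_of_pos_left h3 hp
    have h5 : p * (q / p - 1) = q - p := by field_simp
    linarith
  have e2 : (1 - p) - (1 - q) ≤ (1 - p) * Real.log ((1 - p) / (1 - q)) := by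
    rcases hp1.eq_or_lt with rfl | hp1
    · simp; linarith
    have a1 : 0 < 1 - p := by linarith
    have a2 : 0 < 1 - q := by linarith
    have h2 : Real.log ((1 - q) / (1 - p)) = - Real.log ((1 - p) / (1 - q)) := by
      rw [← Real.log_inv, inv_div]
    have h3 := Real.log_le_sub_one_of_pos (by positivity : 0 < (1 - q) / (1 - p))
    rw [h2] at h3
    have h4 := mul_le_mul_of_nonneg_left h3 a1.le
    have h5 : (1 - p) * ((1 - q) / (1 - p) - 1) = p - q := by field_simp; ring
    linarith
  unfold klBer
  linarith

/-- Comparison of likelihoods: more losses favour the larger parameter. -/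
lemma likelihood_ratio {u v m : ℝ} (hu : 0 < u) (huv : u ≤ v) (hv : v < 1) {k f : ℕ}
    (hm : (k + f : ℕ) * m ≤ k) :
    Real.exp ((k + f : ℕ) * (m * Real.log (v / u) + (1 - m) * Real.log ((1 - v) / (1 - u)))) *
      (u ^ k * (1 - u) ^ f) ≤ v ^ k * (1 - v) ^ f := by
  have hv0 : 0 < v := hu.trans_le huv
  have a1 : 0 < 1 - u := by linarith
  have a2 : 0 < 1 - v := by linarith
  have e1 : 0 ≤ Real.log (v / u) := Real.log_nonneg (by rwa [le_div_iff₀ hu, one_mul])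
  have e2 : Real.log ((1 - v) / (1 - u)) ≤ 0 :=
    Real.log_nonpos (by positivity) (by rw [div_le_one a1]; linarith)
  have e3 : (v / u) ^ k * ((1 - v) / (1 - u)) ^ f =
      Real.exp (k * Real.log (v / u) + f * Real.log ((1 - v) / (1 - u))) := by
    rw [Real.exp_add, Real.exp_nat_mul, Real.exp_nat_mul, Real.exp_log (by positivity),
      Real.exp_log (by positivity)]
  have e4 : v ^ k * (1 - v) ^ f =
      (v / u) ^ k * ((1 - v) / (1 - u)) ^ f * (u ^ k * (1 - u) ^ f) := by
    rw [div_pow, div_pow]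
    field_simp
  rw [e4, e3]
  gcongr
  push_cast at hm ⊢
  -- The two exponents differ by `(k - (k + f) m) * (log (v / u) - log ((1 - v) / (1 - u)))`, a
  -- product of nonnegative factors.
  nlinarith [mul_nonneg (sub_nonneg.2 hm) (sub_nonneg.2 (e2.trans e1))]

/-- When the empirical mean is at least `x > y`, the likelihood increases in the parameter up to
`y`, so `u = y` is the worst case. Moving from `y` to `x` gains the factor `exp (n d(x, y))`, and
the weight at `x` is at most one. At `x = 1` there are no non-losses and the weight is `y ^ k`
exactly. -/
lemma binom_le_exp_klBer {u x y : ℝ} (hu : 0 < u) (huy : u ≤ y) (hyx : y < x) (hx1 : x ≤ 1)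
    {k f : ℕ} (hk : (k + f : ℕ) * x ≤ k) :
    binom u k f ≤ Real.exp (-((k + f : ℕ) * klBer x y)) := by
  have hy0 : 0 < y := hu.trans_le huy
  have hy1 : y < 1 := by linarith
  -- the likelihood increases up to `y`
  have hky : (k + f : ℕ) * y ≤ k := le_trans (by gcongr) hk
  have s1 : u ^ k * (1 - u) ^ f ≤ y ^ k * (1 - y) ^ f := by
    have := likelihood_ratio hu huy hy1 hky
    refine le_trans (le_mul_of_one_le_left ?_ (Real.one_le_exp ?_)) this
    · have : 0 ≤ 1 - u := by linarith
      positivity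
    · rcases huy.eq_or_lt with rfl | huy
      · rw [div_self hu.ne', div_self (by linarith : (1 - u) ≠ 0)]; simp
      · exact mul_nonneg (Nat.cast_nonneg _)
          (klBer_pos hy0 hy1.le hu (by linarith) huy.ne).le
  have s2 : binom u k f ≤ binom y k f := by
    unfold binom
    rw [mul_assoc, mul_assoc]
    gcongr
  refine s2.trans ?_
  rcases hx1.eq_or_lt with rfl | hx1
  · have hf : f = 0 := by
      push_cast at hk
      have : (f : ℝ) ≤ 0 := by linarith
      exact_mod_cast le_antisymm this (Nat.cast_nonneg f)
    subst hf
    have : klBer 1 y = - Real.log y := by simp [klBer, Real.log_inv]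
    rw [this]
    simp only [binom, Nat.add_zero, Nat.choose_self, Nat.cast_one, one_mul, pow_zero, mul_one]
    rw [mul_neg, neg_neg, Real.exp_nat_mul, Real.exp_log hy0]
  · have := likelihood_ratio hy0 hyx.le hx1 hk
    have hb := binom_le_one (μ := x) (by linarith) hx1.le k f
    rw [Real.exp_neg, ← one_div, le_div_iff₀ (Real.exp_pos _)]
    refine le_trans ?_ hb
    unfold binom klBer
    calc _ = ((k + f).choose k : ℝ) * (Real.exp ((k + f : ℕ) * (x * Real.log (x / y) +
          (1 - x) * Real.log ((1 - x) / (1 - y)))) * (y ^ k * (1 - y) ^ f)) := by ring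
      _ ≤ ((k + f).choose k : ℝ) * (x ^ k * (1 - x) ^ f) := by gcongr
      _ = _ := by ring

/-- Large deviations of the posterior. -/
lemma betaMeasure_Iic_le_klBer {x y : ℝ} (hyx : y < x) (hx1 : x ≤ 1)
    {k f : ℕ} (hk : (k + f : ℕ) * x ≤ k) :
    betaMeasure ((k + 1 : ℕ) : ℝ) ((f + 1 : ℕ) : ℝ) (Set.Iic y) ≤
      ENNReal.ofReal ((k + f + 1 : ℕ) * Real.exp (-((k + f : ℕ) * klBer x y))) :=
  betaMeasure_le_of_binom_le measurableSet_Iic fun _ hu h0 _ =>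
    binom_le_exp_klBer h0 hu hyx hx1 hk

/-! ### Sums over all binomial weights -/

/-- The sum of `g k f` over all `k`, `f`, weighted with the binomial probabilities. -/
def binomSum (μ : ℝ) (g : ℕ → ℕ → ℝ≥0∞) : ℝ≥0∞ :=
  ∑' p : ℕ × ℕ, ENNReal.ofReal (binom μ p.1 p.2) * g p.1 p.2

/-- Grouping by the number `n` of trials turns each inner sum into a binomial expectation, to which
the tail bounds apply. -/
lemma binomSum_eq_tsum_antidiagonal (μ : ℝ) (g : ℕ → ℕ → ℝ≥0∞) :
    binomSum μ g = ∑' n, ∑ p ∈ Finset.HasAntidiagonal.antidiagonal n,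
      ENNReal.ofReal (binom μ p.1 p.2) * g p.1 p.2 := by
  rw [binomSum, ← Finset.HasAntidiagonal.sigmaAntidiagonalEquivProd.tsum_eq, ENNReal.tsum_sigma']
  refine tsum_congr fun n => ?_
  rw [tsum_fintype]
  exact Finset.sum_coe_sort (Finset.HasAntidiagonal.antidiagonal n)
    fun p => ENNReal.ofReal (binom μ p.1 p.2) * g p.1 p.2

lemma binomSum_mono {μ : ℝ} {g h : ℕ → ℕ → ℝ≥0∞} (hgh : ∀ k f, g k f ≤ h k f) :
    binomSum μ g ≤ binomSum μ h :=
  ENNReal.tsum_le_tsum fun p => mul_le_mul_right (hgh p.1 p.2) _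

lemma binomSum_add (μ : ℝ) (g h : ℕ → ℕ → ℝ≥0∞) :
    binomSum μ (fun k f => g k f + h k f) = binomSum μ g + binomSum μ h := by
  simp only [binomSum, mul_add, ENNReal.tsum_add]

lemma sum_antidiagonal_indicator {μ : ℝ} (h0 : 0 ≤ μ) (h1 : μ ≤ 1) (n : ℕ)
    (P : ℕ → ℕ → Prop) [∀ k f, Decidable (P k f)] :
    ∑ p ∈ Finset.HasAntidiagonal.antidiagonal n,
        ENNReal.ofReal (binom μ p.1 p.2) * (if P p.1 p.2 then 1 else 0) =
      ENNReal.ofReal (∑ p ∈ (Finset.HasAntidiagonal.antidiagonal n).filter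
        (fun p => P p.1 p.2), binom μ p.1 p.2) := by
  rw [ENNReal.ofReal_sum_of_nonneg fun p _ => binom_nonneg h0 h1 _ _, Finset.sum_filter]
  refine Finset.sum_congr rfl fun p _ => ?_
  split_ifs <;> simp

lemma tsum_exp_neg_le {a : ℝ} (ha : 0 < a) :
    ∑' n : ℕ, ENNReal.ofReal (2 * Real.exp (-(n * a))) ≤ ENNReal.ofReal (2 * (1 + 1 / a)) := by
  have hr : Real.exp (-a) < 1 := Real.exp_lt_one_iff.2 (by linarith)
  have hs := (hasSum_geometric_of_lt_one (Real.exp_pos (-a)).le hr).mul_left 2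
  have he : ∀ n : ℕ, 2 * Real.exp (-(n * a)) = 2 * Real.exp (-a) ^ n := fun n => by
    rw [← Real.exp_nat_mul]; ring_nf
  simp_rw [he]
  rw [← ENNReal.ofReal_tsum_of_nonneg (fun n => by positivity) hs.summable, hs.tsum_eq]
  refine ENNReal.ofReal_le_ofReal (mul_le_mul_of_nonneg_left ?_ (by norm_num))
  have h1 : Real.exp (-a) ≤ 1 / (1 + a) := by
    rw [Real.exp_neg, ← one_div]
    exact one_div_le_one_div_of_le (by linarith) (by linarith [Real.add_one_le_exp a])
  have h2 : a / (1 + a) ≤ 1 - Real.exp (-a) := by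
    have : a / (1 + a) = 1 - 1 / (1 + a) := by field_simp; ring
    linarith
  calc (1 - Real.exp (-a))⁻¹ ≤ (a / (1 + a))⁻¹ := inv_anti₀ (by positivity) h2
    _ = 1 + 1 / a := by field_simp; ring

/-- Each number of trials carries total weight one, and only `⌈a⌉` of them are below `a`. -/
lemma binomSum_lt_le {μ : ℝ} (h0 : 0 ≤ μ) (h1 : μ ≤ 1) {a : ℝ} (ha : 0 ≤ a) :
    binomSum μ (fun k f => if ((k + f : ℕ) : ℝ) < a then 1 else 0) ≤ ENNReal.ofReal (a + 1) := by
  rw [binomSum_eq_tsum_antidiagonal]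
  have hle : ∀ n : ℕ, ∑ p ∈ Finset.HasAntidiagonal.antidiagonal n,
      ENNReal.ofReal (binom μ p.1 p.2) * (if ((p.1 + p.2 : ℕ) : ℝ) < a then 1 else 0) ≤
      if n < ⌈a⌉₊ then 1 else 0 := by
    intro n
    rw [sum_antidiagonal_indicator h0 h1 n (fun k f => ((k + f : ℕ) : ℝ) < a)]
    split_ifs with hn
    · rw [← ENNReal.ofReal_one, ← sum_binom μ n]
      refine ENNReal.ofReal_le_ofReal (Finset.sum_le_sum_of_subset_of_nonneg
        (Finset.filter_subset _ _) fun p _ _ => binom_nonneg h0 h1 _ _)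
    · rw [Finset.filter_false_of_mem]
      · simp
      · intro p hp
        rw [Finset.HasAntidiagonal.mem_antidiagonal] at hp
        rw [hp, ← Nat.lt_ceil]
        exact hn
  refine (ENNReal.tsum_le_tsum hle).trans ?_
  rw [tsum_eq_sum (s := Finset.range ⌈a⌉₊) (fun n hn => by simpa using hn)]
  rw [Finset.sum_congr rfl (g := fun _ => (1 : ℝ≥0∞))
    (fun n hn => if_pos (Finset.mem_range.1 hn))]
  simp only [Finset.sum_const, Finset.card_range, nsmul_eq_mul, mul_one]
  rw [← ENNReal.ofReal_natCast]
  exact ENNReal.ofReal_le_ofReal (Nat.ceil_lt_add_one ha).le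

lemma binomSum_tail_le {μ η : ℝ} (h0 : 0 ≤ μ) (h1 : μ ≤ 1) (hη : 0 < η) (hη1 : η ≤ 1) :
    binomSum μ (fun k f => if (k + f : ℕ) * η ≤ |k - (k + f : ℕ) * μ| then 1 else 0) ≤
      ENNReal.ofReal (2 * (1 + 4 / η ^ 2)) := by
  rw [binomSum_eq_tsum_antidiagonal]
  have hle : ∀ n : ℕ, ∑ p ∈ Finset.HasAntidiagonal.antidiagonal n,
      ENNReal.ofReal (binom μ p.1 p.2) *
        (if (p.1 + p.2 : ℕ) * η ≤ |p.1 - (p.1 + p.2 : ℕ) * μ| then 1 else 0) ≤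
      ENNReal.ofReal (2 * Real.exp (-(n * (η ^ 2 / 4)))) := by
    intro n
    rw [sum_antidiagonal_indicator h0 h1 n
      (fun k f => (k + f : ℕ) * η ≤ |k - (k + f : ℕ) * μ|)]
    refine ENNReal.ofReal_le_ofReal ?_
    rw [← mul_div_assoc]
    refine sum_binom_tail h0 h1 hη.le hη1 n _ fun p hp => ?_
    obtain ⟨hp, hp'⟩ := Finset.mem_filter.1 hp
    refine ⟨hp, ?_⟩
    rwa [Finset.HasAntidiagonal.mem_antidiagonal.1 hp] at hp'
  refine (ENNReal.tsum_le_tsum hle).trans ((tsum_exp_neg_le (by positivity)).trans_eq ?_)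
  rw [one_div_div]

lemma binomSum_late_tail_le {μ η s : ℝ} (h0 : 0 ≤ μ) (h1 : μ ≤ 1) (hη : 0 < η) (hη1 : η ≤ 1) :
    binomSum μ (fun k f =>
        if s ≤ (k + f : ℕ) ∧ (k + f : ℕ) * η ≤ |k - (k + f : ℕ) * μ| then 1 else 0) ≤
      ENNReal.ofReal (Real.exp (-(s * η ^ 2 / 8)) * (2 * (1 + 8 / η ^ 2))) := by
  rw [binomSum_eq_tsum_antidiagonal]
  have hle : ∀ n : ℕ, ∑ p ∈ Finset.HasAntidiagonal.antidiagonal n,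
      ENNReal.ofReal (binom μ p.1 p.2) *
        (if s ≤ (p.1 + p.2 : ℕ) ∧
          (p.1 + p.2 : ℕ) * η ≤ |p.1 - (p.1 + p.2 : ℕ) * μ| then 1 else 0) ≤
      ENNReal.ofReal (Real.exp (-(s * η ^ 2 / 8))) *
        ENNReal.ofReal (2 * Real.exp (-(n * (η ^ 2 / 8)))) := by
    intro n
    rw [sum_antidiagonal_indicator h0 h1 n
      (fun k f => s ≤ (k + f : ℕ) ∧ (k + f : ℕ) * η ≤ |k - (k + f : ℕ) * μ|),
      ← ENNReal.ofReal_mul (Real.exp_pos _).le]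
    refine ENNReal.ofReal_le_ofReal ?_
    by_cases hs : s ≤ n
    · refine (sum_binom_tail h0 h1 hη.le hη1 n _ fun p hp => ?_).trans ?_
      · obtain ⟨hp, hp'⟩ := Finset.mem_filter.1 hp
        refine ⟨hp, ?_⟩
        rw [Finset.HasAntidiagonal.mem_antidiagonal.1 hp] at hp'
        exact hp'.2
      -- Half of the exponent `n η² / 4` yields the decay in `s`; the other half is kept for the
      -- geometric series.
      · rw [mul_left_comm, ← Real.exp_add]
        have := mul_le_mul_of_nonneg_right hs (sq_nonneg η)
        gcongr
        linarith
    · rw [Finset.filter_false_of_mem]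
      · simp; positivity
      · intro p hp
        rw [Finset.HasAntidiagonal.mem_antidiagonal] at hp
        rw [hp]
        exact fun h => hs h.1
  refine (ENNReal.tsum_le_tsum hle).trans ?_
  rw [ENNReal.tsum_mul_left, ENNReal.ofReal_mul (Real.exp_pos _).le]
  refine mul_le_mul_right ((tsum_exp_neg_le (by positivity)).trans_eq ?_) _
  rw [one_div_div]

/-- The odds that a posterior sample exceeds `y`. -/
def odds (y : ℝ) (a b : ℕ) : ℝ≥0∞ :=
  betaMeasure (a : ℝ) (b : ℝ) (Set.Ioi y) / betaMeasure (a : ℝ) (b : ℝ) (Set.Iic y)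

lemma binom_pos {μ : ℝ} (h0 : 0 < μ) (h1 : μ < 1) (k f : ℕ) : 0 < binom μ k f := by
  have h2 : 0 < 1 - μ := by linarith
  have : 0 < (k + f).choose k := Nat.choose_pos (Nat.le_add_right _ _)
  unfold binom; positivity

/-- A lower bound for the denominator of the odds, from a short interval `[m, m + h]` below `y` on
which the density is controlled. -/
lemma le_betaMeasure_Iic {k f : ℕ} {m h y B : ℝ} (hm : 0 < m) (hh : 0 < h) (hy : m + h ≤ y)
    (hy1 : y < 1) (hB : ∀ u, m ≤ u → u ≤ m + h → B ≤ binom u k f) :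
    ENNReal.ofReal ((k + f + 1 : ℕ) * B * h) ≤
      betaMeasure ((k + 1 : ℕ) : ℝ) ((f + 1 : ℕ) : ℝ) (Set.Iic y) := by
  rcases le_or_gt B 0 with hB0 | hB0
  · rw [ENNReal.ofReal_of_nonpos]
    · exact zero_le
    · have : 0 ≤ ((k + f + 1 : ℕ) : ℝ) := Nat.cast_nonneg _
      exact mul_nonpos_of_nonpos_of_nonneg (mul_nonpos_of_nonneg_of_nonpos this hB0) hh.le
  rw [betaMeasure_apply k f measurableSet_Iic]
  calc ENNReal.ofReal ((k + f + 1 : ℕ) * B * h)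
      = ∫⁻ _ in Set.Icc m (m + h), ENNReal.ofReal ((k + f + 1 : ℕ) * B) := by
        rw [setLIntegral_const, Real.volume_Icc, ← ENNReal.ofReal_mul (by positivity)]
        simp
    _ ≤ ∫⁻ u in Set.Icc m (m + h), ENNReal.ofReal ((k + f + 1 : ℕ) * binom u k f) := by
        refine setLIntegral_mono (by unfold binom; fun_prop) fun u hu => ?_
        exact ENNReal.ofReal_le_ofReal
          (mul_le_mul_of_nonneg_left (hB u hu.1 hu.2) (Nat.cast_nonneg _))
    _ ≤ _ := by
        refine lintegral_mono_set fun u hu => ?_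
        exact ⟨hu.2.trans hy, hm.trans_le hu.1, (hu.2.trans hy).trans_lt hy1⟩

lemma betaMeasure_Iic_pos {y : ℝ} (hy0 : 0 < y) (hy1 : y < 1) (k f : ℕ) :
    0 < betaMeasure ((k + 1 : ℕ) : ℝ) ((f + 1 : ℕ) : ℝ) (Set.Iic y) := by
  have hB : ∀ u, y / 2 ≤ u → u ≤ y / 2 + y / 2 →
      (y / 2) ^ k * (1 - y) ^ f ≤ binom u k f := by
    intro u h1 h2
    have h3 : (1 : ℝ) ≤ (k + f).choose k := by
      exact_mod_cast Nat.choose_pos (Nat.le_add_right k f)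
    have h4 : 0 ≤ 1 - y := by linarith
    have h5 : 0 ≤ u := by linarith
    unfold binom
    calc (y / 2) ^ k * (1 - y) ^ f ≤ u ^ k * (1 - u) ^ f := by
          gcongr; linarith
      _ ≤ (k + f).choose k * (u ^ k * (1 - u) ^ f) := by
          refine le_mul_of_one_le_left ?_ h3
          have : 0 ≤ 1 - u := by linarith
          have : 0 ≤ u := by linarith
          positivity
      _ = _ := by ring
  refine lt_of_lt_of_le ?_ (le_betaMeasure_Iic (by linarith : 0 < y / 2) (by linarith)
    (by linarith) hy1 hB)
  have h4 : 0 < 1 - y := by linarith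
  rw [ENNReal.ofReal_pos]
  positivity

lemma odds_lt_top {y : ℝ} (hy0 : 0 < y) (hy1 : y < 1) (k f : ℕ) :
    odds y (k + 1) (f + 1) < ∞ := by
  have := isProbabilityMeasure_betaMeasure_nat (a := k + 1) (b := f + 1) (by simp) (by simp)
  exact ENNReal.div_lt_top (measure_ne_top _ _) (betaMeasure_Iic_pos hy0 hy1 k f).ne'

/-- Typical counts: with empirical mean at most `m < y` the posterior mass above `y` is
exponentially small, and once it is at most `1 / 2` the denominator costs only a factor two. -/
lemma odds_le_of_le {k f : ℕ} {m y : ℝ} (hmy : m < y) (hm0 : 0 < m) (hy1 : y < 1)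
    (hk : k ≤ (k + f : ℕ) * m)
    (hsmall : (k + f + 1 : ℕ) * (2 * Real.exp (-((k + f : ℕ) * (y - m) ^ 2 / 4))) ≤ 1 / 2) :
    odds y (k + 1) (f + 1) ≤ ENNReal.ofReal
      (2 * ((k + f + 1 : ℕ) * (2 * Real.exp (-((k + f : ℕ) * (y - m) ^ 2 / 4))))) := by
  have hP := isProbabilityMeasure_betaMeasure_nat (a := k + 1) (b := f + 1) (by simp) (by simp)
  set P := betaMeasure ((k + 1 : ℕ) : ℝ) ((f + 1 : ℕ) : ℝ) with hPdef
  have h1 : P (Set.Ioi y) ≤ ENNReal.ofReal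
      ((k + f + 1 : ℕ) * (2 * Real.exp (-((k + f : ℕ) * (y - m) ^ 2 / 4)))) := by
    refine betaMeasure_le_exp measurableSet_Ioi (by linarith) (by linarith) fun u hu => ?_
    rw [abs_sub_comm]
    refine le_trans ?_ (le_abs_self _)
    have : ((k + f : ℕ) : ℝ) * y ≤ (k + f : ℕ) * u :=
      mul_le_mul_of_nonneg_left (le_of_lt hu) (Nat.cast_nonneg _)
    linarith
  have h2 : (1 / 2 : ℝ≥0∞) ≤ P (Set.Iic y) := by
    have h3 : P (Set.Ioi y) ≤ 1 / 2 := by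
      refine h1.trans ?_
      rw [show (1 / 2 : ℝ≥0∞) = ENNReal.ofReal (1 / 2) by
        rw [ENNReal.ofReal_div_of_pos (by norm_num)]; simp]
      exact ENNReal.ofReal_le_ofReal hsmall
    have h4 : P (Set.Iic y) = 1 - P (Set.Ioi y) := by
      rw [← Set.compl_Ioi, prob_compl_eq_one_sub measurableSet_Ioi]
    rw [h4]
    refine ENNReal.le_sub_of_add_le_left (ne_top_of_le_ne_top (by simp) h3) ?_
    calc P (Set.Ioi y) + 1 / 2 ≤ 1 / 2 + 1 / 2 := by gcongr
      _ = 1 := ENNReal.add_halves 1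
  unfold odds
  rw [← hPdef]
  calc P (Set.Ioi y) / P (Set.Iic y) ≤ P (Set.Ioi y) / (1 / 2) := by gcongr
    _ = 2 * P (Set.Ioi y) := by
        rw [ENNReal.div_eq_inv_mul]; simp
    _ ≤ _ := by
        rw [ENNReal.ofReal_mul (by norm_num)]
        simp only [ENNReal.ofReal_ofNat]
        gcongr

/-- Atypical counts: the odds may be exponentially large, but the weight under `μ` compensates. On
`[m, m + h]` the likelihood exceeds that under `μ` by `exp (n c)`, so `binom μ k f` cancels and
exponential decay remains. -/
lemma binom_mul_odds_le {k f : ℕ} {μ m h y c : ℝ} (hμ : 0 < μ) (hμm : μ < m) (hh : 0 < h)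
    (hy : m + h ≤ y) (hy1 : y < 1) (hk : (k + f : ℕ) * m ≤ k)
    (hc : ∀ u, m ≤ u → u ≤ m + h →
      c ≤ m * Real.log (u / μ) + (1 - m) * Real.log ((1 - u) / (1 - μ))) :
    ENNReal.ofReal (binom μ k f) * odds y (k + 1) (f + 1) ≤
      ENNReal.ofReal (Real.exp (-((k + f : ℕ) * c)) / h) := by
  have hP := isProbabilityMeasure_betaMeasure_nat (a := k + 1) (b := f + 1) (by simp) (by simp)
  have hb := binom_pos hμ (by linarith : μ < 1) k f
  have h1 := le_betaMeasure_Iic (k := k) (f := f) (B := Real.exp ((k + f : ℕ) * c) * binom μ k f)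
    (hμ.trans hμm) hh hy hy1 (by
      intro u hu1 hu2
      have h2 := likelihood_ratio hμ (hμm.le.trans hu1) (by linarith : u < 1) hk
      have h3 : Real.exp ((k + f : ℕ) * c) ≤ Real.exp ((k + f : ℕ) *
          (m * Real.log (u / μ) + (1 - m) * Real.log ((1 - u) / (1 - μ)))) := by
        have := hc u hu1 hu2
        gcongr
      have h4 : 0 ≤ μ ^ k * (1 - μ) ^ f := by
        have : 0 ≤ 1 - μ := by linarith
        positivity
      have h5 := (mul_le_mul_of_nonneg_right h3 h4).trans h2
      unfold binom
      calc _ = ((k + f).choose k : ℝ) * (Real.exp ((k + f : ℕ) * c) * (μ ^ k * (1 - μ) ^ f)) := by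
            ring
        _ ≤ ((k + f).choose k : ℝ) * (u ^ k * (1 - u) ^ f) := by gcongr
        _ = _ := by ring)
  have h6 : ENNReal.ofReal (Real.exp ((k + f : ℕ) * c) * binom μ k f * h) ≤
      betaMeasure ((k + 1 : ℕ) : ℝ) ((f + 1 : ℕ) : ℝ) (Set.Iic y) := by
    refine le_trans (ENNReal.ofReal_le_ofReal ?_) h1
    refine mul_le_mul_of_nonneg_right (le_mul_of_one_le_left (by positivity) ?_) hh.le
    exact_mod_cast Nat.succ_le_succ (Nat.zero_le _)
  unfold odds
  calc _ ≤ ENNReal.ofReal (binom μ k f) *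
        (1 / ENNReal.ofReal (Real.exp ((k + f : ℕ) * c) * binom μ k f * h)) := by
        gcongr
        exact prob_le_one
    _ = _ := by
        rw [one_div, ← ENNReal.ofReal_inv_of_pos (by positivity), ← ENNReal.ofReal_mul hb.le]
        congr 1
        rw [Real.exp_neg]
        field_simp

/-- The expected waiting times for a sample below `y > μ` are summable. -/
lemma binomSum_odds_lt_top {μ y : ℝ} (hμ : 0 < μ) (hμy : μ < y) (hy1 : y < 1) :
    binomSum μ (fun k f => odds y (k + 1) (f + 1)) < ∞ := by
  -- The intermediate level `m` separates typical counts, handled by `odds_le_of_le`, from atypical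
  -- ones, handled by `binom_mul_odds_le`.
  obtain ⟨m, hμm, hmy⟩ := exists_between hμy
  have hm0 : 0 < m := hμ.trans hμm
  have hy0 : 0 < y := hm0.trans hmy
  have hkl := klBer_pos hm0 (by linarith : m ≤ 1) hμ (by linarith) hμm.ne
  -- At `u = m` the exponent equals `klBer m μ > 0`; by continuity at least half of it survives on a
  -- short interval to the right.
  obtain ⟨h, hh, hhy, hc⟩ : ∃ h, 0 < h ∧ m + h ≤ y ∧ ∀ u, m ≤ u → u ≤ m + h →
      klBer m μ / 2 ≤ m * Real.log (u / μ) + (1 - m) * Real.log ((1 - u) / (1 - μ)) := by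
    have hcont : ContinuousAt (fun u => m * Real.log (u / μ) +
        (1 - m) * Real.log ((1 - u) / (1 - μ))) m := by
      have a1 : m / μ ≠ 0 := by positivity
      have a2 : (1 - m) / (1 - μ) ≠ 0 :=
        div_ne_zero (by linarith) (by linarith)
      fun_prop (disch := assumption)
    have hev := hcont.eventually (lt_mem_nhds (show klBer m μ / 2 < _ from half_lt_self hkl))
    obtain ⟨δ, hδ, hδ'⟩ := Metric.eventually_nhds_iff.1 hev
    refine ⟨min (δ / 2) (y - m), lt_min (by linarith) (by linarith), ?_, ?_⟩
    · linarith [min_le_right (δ / 2) (y - m)]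
    · intro u h1 h2
      refine (hδ' ?_).le
      rw [Real.dist_eq, abs_of_nonneg (by linarith)]
      linarith [min_le_left (δ / 2) (y - m)]
  set c := klBer m μ / 2 with hcdef
  have hc0 : 0 < c := half_pos hkl
  set a := (y - m) ^ 2 / 4 with hadef
  have ha0 : 0 < a := by have : 0 < y - m := by linarith
                         positivity
  have hsum : ∀ r : ℝ, 0 < r → Summable fun n : ℕ => ((n + 1 : ℕ) : ℝ) * Real.exp (-(n * r)) := by
    intro r hr
    have e1 := Real.summable_pow_mul_exp_neg_nat_mul 1 hr
    have e2 := Real.summable_pow_mul_exp_neg_nat_mul 0 hr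
    refine (e1.add e2).congr fun n => ?_
    push_cast
    rw [show -(n * r) = -r * n by ring]; ring
  obtain ⟨n0, hn0⟩ : ∃ n0 : ℕ, ∀ n ≥ n0, ((n + 1 : ℕ) : ℝ) * (2 * Real.exp (-(n * a))) ≤ 1 / 2 := by
    have := ((hsum a ha0).tendsto_atTop_zero.eventually
      (gt_mem_nhds (show (0 : ℝ) < 1 / 4 by norm_num)))
    obtain ⟨n0, hn0⟩ := Filter.eventually_atTop.1 this
    exact ⟨n0, fun n hn => by have := hn0 n hn; linarith⟩
  -- For fewer than `n0` trials the posterior mass above `y` need not be below `1 / 2`; these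
  -- finitely many terms are merely finite.
  rw [binomSum_eq_tsum_antidiagonal, ← ENNReal.summable.sum_add_tsum_nat_add' (k := n0)]
  refine ENNReal.add_lt_top.2 ⟨?_, ?_⟩
  · exact ENNReal.sum_lt_top.2 fun n _ => ENNReal.sum_lt_top.2 fun p _ =>
      ENNReal.mul_lt_top ENNReal.ofReal_lt_top (odds_lt_top hy0 hy1 _ _)
  have hle : ∀ n ≥ n0, ∑ p ∈ Finset.HasAntidiagonal.antidiagonal n,
      ENNReal.ofReal (binom μ p.1 p.2) * odds y (p.1 + 1) (p.2 + 1) ≤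
      ENNReal.ofReal (4 * ((n + 1 : ℕ) * Real.exp (-(n * a))) +
        1 / h * ((n + 1 : ℕ) * Real.exp (-(n * c)))) := by
    intro n hn
    have hterm : ∀ p ∈ Finset.HasAntidiagonal.antidiagonal n,
        ENNReal.ofReal (binom μ p.1 p.2) * odds y (p.1 + 1) (p.2 + 1) ≤
        ENNReal.ofReal (binom μ p.1 p.2 * (4 * ((n + 1 : ℕ) * Real.exp (-(n * a)))) +
          1 / h * Real.exp (-(n * c))) := by
      intro p hp
      rw [Finset.HasAntidiagonal.mem_antidiagonal] at hp
      have hb := binom_nonneg hμ.le (by linarith : μ ≤ 1) p.1 p.2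
      rcases le_total (p.1 : ℝ) ((p.1 + p.2 : ℕ) * m) with hk | hk
      · have h1 := odds_le_of_le hmy hm0 hy1 hk (by
          rw [hp, mul_div_assoc]; exact hn0 n hn)
        rw [hp, mul_div_assoc] at h1
        calc _ ≤ ENNReal.ofReal (binom μ p.1 p.2) * _ := mul_le_mul_right h1 _
          _ = ENNReal.ofReal (binom μ p.1 p.2 *
              (2 * ((n + 1 : ℕ) * (2 * Real.exp (-(n * a)))))) := by
              rw [ENNReal.ofReal_mul hb]
          _ ≤ _ := by
              refine ENNReal.ofReal_le_ofReal ?_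
              have : 0 ≤ 1 / h * Real.exp (-(n * c)) := by positivity
              linarith
      · have h1 := binom_mul_odds_le hμ hμm hh hhy hy1 hk hc
        rw [hp] at h1
        refine h1.trans (ENNReal.ofReal_le_ofReal ?_)
        have : 0 ≤ binom μ p.1 p.2 * (4 * ((n + 1 : ℕ) * Real.exp (-(n * a)))) := by positivity
        rw [div_eq_mul_one_div]
        linarith
    refine (Finset.sum_le_sum hterm).trans ?_
    rw [← ENNReal.ofReal_sum_of_nonneg]
    · refine ENNReal.ofReal_le_ofReal ?_
      rw [Finset.sum_add_distrib, ← Finset.sum_mul, sum_binom, Finset.sum_const,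
        Finset.Nat.card_antidiagonal, nsmul_eq_mul]
      linarith
    · intro p _
      have hb := binom_nonneg hμ.le (by linarith : μ ≤ 1) p.1 p.2
      positivity
  have hS := ((hsum a ha0).mul_left 4).add ((hsum c hc0).mul_left (1 / h))
  refine lt_of_le_of_lt (ENNReal.tsum_le_tsum fun n => hle (n + n0) (Nat.le_add_left _ _)) ?_
  have hS' := (summable_nat_add_iff n0).2 hS
  rw [← ENNReal.ofReal_tsum_of_nonneg (fun n => by positivity) hS']
  exact ENNReal.ofReal_lt_top

/-! ### The arms with the smallest samples -/

section Smallest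

variable {K : ℕ} (order : Equiv.Perm (Fin K))

/-- The strict order of the arms by their samples, ties being broken by the position. -/
def Before (z : Fin K → ℝ) (j i : Fin K) : Prop := z j < z i ∨ (z j = z i ∧ order j < order i)

/-- The number of arms before arm `i`. -/
def rank (z : Fin K → ℝ) (i : Fin K) : ℕ :=
  (Finset.univ.filter fun j => z j < z i ∨ (z j = z i ∧ order j < order i)).card

lemma mem_smallest {n : ℕ} {z : Fin K → ℝ} {i : Fin K} :
    i ∈ smallest order n z ↔ rank order z i < n := by
  simp [smallest, rank]

variable {order}

lemma Before.le {z : Fin K → ℝ} {i j : Fin K} (h : Before order z j i) : z j ≤ z i := by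
  rcases h with h | h
  exacts [h.le, h.1.le]

lemma Before.trans {z : Fin K → ℝ} {i j k : Fin K} (h : Before order z i j)
    (h' : Before order z j k) : Before order z i k := by
  unfold Before at *
  rcases h with h | ⟨h, h1⟩ <;> rcases h' with h' | ⟨h', h1'⟩
  · exact Or.inl (h.trans h')
  · exact Or.inl (h'.symm ▸ h)
  · exact Or.inl (h ▸ h')
  · exact Or.inr ⟨h.trans h', h1.trans h1'⟩

lemma not_before_self (z : Fin K → ℝ) (i : Fin K) : ¬ Before order z i i := by
  simp [Before]

lemma before_or_before (z : Fin K → ℝ) {i j : Fin K} (h : i ≠ j) :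
    Before order z i j ∨ Before order z j i := by
  unfold Before
  rcases lt_trichotomy (z i) (z j) with h1 | h1 | h1
  · exact Or.inl (Or.inl h1)
  · rcases lt_trichotomy (order i) (order j) with h2 | h2 | h2
    · exact Or.inl (Or.inr ⟨h1, h2⟩)
    · exact absurd (order.injective h2) h
    · exact Or.inr (Or.inr ⟨h1.symm, h2⟩)
  · exact Or.inr (Or.inl h1)

lemma rank_lt_rank {z : Fin K → ℝ} {i j : Fin K} (h : Before order z j i) :
    rank order z j < rank order z i := by
  refine Finset.card_lt_card (Finset.ssubset_iff_of_subset ?_ |>.2 ⟨j, ?_, ?_⟩)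
  · intro k hk
    simp only [Finset.mem_filter, Finset.mem_univ, true_and] at hk ⊢
    exact Before.trans hk h
  · simpa [Before] using h
  · simp

lemma before_iff_rank_lt {z : Fin K → ℝ} {i j : Fin K} :
    Before order z j i ↔ rank order z j < rank order z i := by
  refine ⟨rank_lt_rank, fun h => ?_⟩
  have hne : j ≠ i := by rintro rfl; exact lt_irrefl _ h
  exact (before_or_before z hne).resolve_right fun h' => lt_asymm h (rank_lt_rank h')

variable (order)

lemma rank_injective (z : Fin K → ℝ) : Function.Injective (rank order z) := by
  intro i j h
  by_contra hne
  rcases before_or_before (order := order) z hne with h' | h'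
  · exact absurd (rank_lt_rank h') (by omega)
  · exact absurd (rank_lt_rank h') (by omega)

lemma rank_lt (z : Fin K → ℝ) (i : Fin K) : rank order z i < K := by
  refine lt_of_lt_of_eq (Finset.card_lt_card (Finset.ssubset_univ_iff.2 ?_)) (Finset.card_fin K)
  intro h
  have := Finset.mem_univ i
  rw [← h] at this
  simp at this

lemma card_smallest {n : ℕ} (hn : n ≤ K) (z : Fin K → ℝ) : (smallest order n z).card = n := by
  have hinj : Function.Injective fun i => (⟨rank order z i, rank_lt order z i⟩ : Fin K) :=
    fun i j h => rank_injective order z (by simpa using h)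
  let e := Equiv.ofBijective _ (Finite.injective_iff_bijective.1 hinj)
  have : (smallest order n z).map e.toEmbedding =
      Finset.univ.filter fun r : Fin K => (r : ℕ) < n := by
    ext r
    simp only [Finset.mem_map, Finset.mem_filter, Finset.mem_univ, true_and, mem_smallest]
    constructor
    · rintro ⟨i, hi, rfl⟩; exact hi
    · intro hr
      refine ⟨e.symm r, ?_, e.apply_symm_apply r⟩
      have : rank order z (e.symm r) = (e (e.symm r) : ℕ) := rfl
      rw [this, e.apply_symm_apply]
      exact hr
  rw [← Finset.card_map e.toEmbedding, this, Fin.card_filter_val_lt, min_eq_right hn]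

lemma le_of_mem_of_notMem_smallest {n : ℕ} {z : Fin K → ℝ} {i j : Fin K}
    (hi : i ∈ smallest order n z) (hj : j ∉ smallest order n z) : z i ≤ z j := by
  rw [mem_smallest] at hi hj
  exact (before_iff_rank_lt.2 (lt_of_lt_of_le hi (not_lt.1 hj))).le

lemma rank_lt_of_subset {O : Finset (Fin K)} {z : Fin K → ℝ} {i j : Fin K} (hj : j ∈ O)
    (h : ∀ k, Before order z k i → k ∈ O ∧ k ≠ j) : rank order z i < O.card := by
  refine Finset.card_lt_card (Finset.ssubset_iff_of_subset ?_ |>.2 ⟨j, hj, ?_⟩)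
  · intro k hk
    exact (h k (by simpa [Before] using hk)).1
  · intro hj'
    exact (h j (by simpa [Before] using hj')).2 rfl

variable {order}

lemma mem_smallest_of_le {O : Finset (Fin K)} {z : Fin K → ℝ} {j : Fin K} {y : ℝ} (hj : j ∈ O)
    (hjy : z j ≤ y) (h : ∀ i ∉ O, y < z i) : j ∈ smallest order O.card z := by
  rw [mem_smallest]
  refine rank_lt_of_subset order hj fun k hk => ⟨?_, ?_⟩
  · by_contra hkO
    exact absurd (hk.le.trans hjy) (not_le.2 (h k hkO))
  · rintro rfl; exact not_before_self z k hk

/-- Take the first arm outside `O` with a sample at most `y`. All arms before it lie in `O`, and `j`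
is not among them because its sample exceeds `y`, so fewer than `|O|` arms come before it. -/
lemma exists_mem_smallest_of_lt {O : Finset (Fin K)} {z : Fin K → ℝ} {i j : Fin K} {y : ℝ}
    (hj : j ∈ O) (hjy : y < z j) (hi : i ∉ O) (hiy : z i ≤ y) :
    ∃ k ∉ O, z k ≤ y ∧ k ∈ smallest order O.card z := by
  obtain ⟨k, hk, hmin⟩ := Finset.exists_min_image (Finset.univ.filter fun k => k ∉ O ∧ z k ≤ y)
    (rank order z) ⟨i, by simp [hi, hiy]⟩
  simp only [Finset.mem_filter, Finset.mem_univ, true_and] at hk hmin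
  refine ⟨k, hk.1, hk.2, ?_⟩
  rw [mem_smallest]
  refine rank_lt_of_subset order hj fun m hm => ⟨?_, ?_⟩
  · by_contra hmO
    exact absurd (rank_lt_rank hm) (not_lt.2 (hmin m ⟨hmO, hm.le.trans hk.2⟩))
  · rintro rfl
    exact absurd (hm.le.trans hk.2) (not_le.2 hjy)

lemma exists_mem_smallest_of_notMem {O : Finset (Fin K)} {z : Fin K → ℝ} {j : Fin K}
    (hj : j ∈ O) (hj' : j ∉ smallest order O.card z) :
    ∃ k ∉ O, z k ≤ z j ∧ k ∈ smallest order O.card z := by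
  by_contra hcon
  push Not at hcon
  have hsub : smallest order O.card z ⊆ O.erase j := by
    intro k hk
    refine Finset.mem_erase.2 ⟨fun h => hj' (h ▸ hk), ?_⟩
    by_contra hkO
    exact hcon k hkO (le_of_mem_of_notMem_smallest order hk hj') hk
  have := Finset.card_le_card hsub
  rw [card_smallest order (by simpa using Finset.card_le_univ O), Finset.card_erase_of_mem hj] at this
  have := Finset.card_pos.2 ⟨j, hj⟩
  omega

lemma exists_notMem_smallest {O : Finset (Fin K)} {z : Fin K → ℝ} {i : Fin K}
    (hi : i ∉ O) (hi' : i ∈ smallest order O.card z) :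
    ∃ j ∈ O, j ∉ smallest order O.card z := by
  by_contra hcon
  push Not at hcon
  have hsub : insert i O ⊆ smallest order O.card z := by
    intro k hk
    rcases Finset.mem_insert.1 hk with rfl | hk
    exacts [hi', hcon k hk]
  have := Finset.card_le_card hsub
  rw [card_smallest order (by simpa using Finset.card_le_univ O), Finset.card_insert_of_notMem hi] at this
  omega

/-- A sample of `j` above `y` puts `j` behind `i`, so overwriting it by such a value cannot raise
the rank of `i`. This decouples the selection of `i` from the sample of `j`. -/
lemma mem_smallest_update {n : ℕ} {z : Fin K → ℝ} {i j : Fin K} {y c : ℝ} (hij : i ≠ j)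
    (hi : z i ≤ y) (hc : y < c) (h : i ∈ smallest order n z) :
    i ∈ smallest order n (Function.update z j c) := by
  rw [mem_smallest] at h ⊢
  refine lt_of_le_of_lt (Finset.card_le_card fun k hk => ?_) h
  simp only [Finset.mem_filter, Finset.mem_univ, true_and, Function.update_of_ne hij] at hk ⊢
  rcases eq_or_ne k j with rfl | hkj
  · rw [Function.update_self] at hk
    rcases hk with hk | hk
    · linarith
    · linarith [hk.1]
  · rwa [Function.update_of_ne hkj] at hk

end Smallest

/-! ### Measurability of the selection. -/

section Measurability

variable {K : ℕ} (order : Equiv.Perm (Fin K)) {α : Type*} [MeasurableSpace α]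

lemma measurableSet_mem_smallest (n : ℕ) (i : Fin K) {g : α → Fin K → ℝ} (hg : Measurable g) :
    MeasurableSet {x | i ∈ smallest order n (g x)} := by
  have hg' : ∀ j, Measurable fun x => g x j := fun j => (measurable_pi_apply j).comp hg
  have : Measurable fun x => rank order (g x) i := by
    simp only [rank, Finset.card_filter]
    refine Finset.measurable_sum _ fun j _ => Measurable.ite ?_ measurable_const measurable_const
    exact (measurableSet_lt (hg' j) (hg' i)).union
      ((measurableSet_eq_fun (hg' j) (hg' i)).inter (MeasurableSet.const _))
  simp only [mem_smallest]
  exact measurableSet_lt this measurable_const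

end Measurability

/-! ### One round with independent samples -/

section OneRound

variable {K : ℕ} (order : Equiv.Perm (Fin K)) {Ω : Type*} [MeasurableSpace Ω] {P : Measure Ω}
  {z : Fin K → Ω → ℝ}

/-- Restricting to an independent event of probability at least `1 / 2` loses at most a factor two.
This is how well-observed suboptimal arms, whose samples are usually large, are removed from a
round. -/
lemma le_two_mul_measure_inter [IsProbabilityMeasure P] {A B : Set Ω} (hA : MeasurableSet A) (hAc : P Aᶜ ≤ 1 / 2)
    (h : P (A ∩ B) = P A * P B) : P B ≤ 2 * P (A ∩ B) := by
  have h2 : (1 / 2 : ℝ≥0∞) ≤ P A := by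
    have h4 : P A = 1 - P Aᶜ := by
      rw [← prob_compl_eq_one_sub hA.compl, compl_compl]
    rw [h4]
    refine ENNReal.le_sub_of_add_le_left (ne_top_of_le_ne_top (by simp) hAc) ?_
    calc P Aᶜ + 1 / 2 ≤ 1 / 2 + 1 / 2 := by gcongr
      _ = 1 := ENNReal.add_halves 1
  rw [h, ← mul_assoc]
  calc P B = (2 * (1 / 2)) * P B := by
        rw [one_div, ENNReal.mul_inv_cancel (by norm_num) (by norm_num), one_mul]
    _ ≤ _ := by gcongr

lemma measure_exists_le_le_half (H : Finset (Fin K)) {y : ℝ}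
    (hH : ∀ i ∈ H, P {ω | z i ω ≤ y} ≤ 1 / (2 * K)) :
    P {ω | ∀ i ∈ H, y < z i ω}ᶜ ≤ 1 / 2 := by
  have hsub : {ω | ∀ i ∈ H, y < z i ω}ᶜ ⊆ ⋃ i ∈ H, {ω | z i ω ≤ y} := by
    intro ω hω
    simp only [Set.mem_compl_iff, Set.mem_ofPred_eq, not_forall, not_lt] at hω
    obtain ⟨i, hi, h⟩ := hω
    exact Set.mem_biUnion hi h
  calc P {ω | ∀ i ∈ H, y < z i ω}ᶜ ≤ ∑ i ∈ H, P {ω | z i ω ≤ y} :=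
        (measure_mono hsub).trans (measure_biUnion_finset_le _ _)
    _ ≤ ∑ _i ∈ H, 1 / (2 * K : ℝ≥0∞) := Finset.sum_le_sum hH
    _ ≤ K * (1 / (2 * K : ℝ≥0∞)) := by
        rw [Finset.sum_const, nsmul_eq_mul]
        gcongr
        simpa using Finset.card_le_univ H
    _ ≤ 1 / 2 := by
        rcases Nat.eq_zero_or_pos K with rfl | hK
        · simp
        · rw [one_div, ENNReal.mul_inv (by simp) (by simp), mul_left_comm,
            ENNReal.mul_inv_cancel (by simpa using hK.ne') (by simp), mul_one, one_div]

lemma measurableSet_forall_lt (hz : ∀ i, Measurable (z i)) (H : Finset (Fin K)) (y : ℝ) :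
    MeasurableSet {ω | ∀ i ∈ H, y < z i ω} := by
  have : {ω | ∀ i ∈ H, y < z i ω} = ⋂ i ∈ H, {ω | y < z i ω} := by ext; simp
  rw [this]
  exact Finset.measurableSet_biInter _ fun i _ => measurableSet_lt measurable_const (hz i)

lemma measure_inter_of_disjoint (hind : iIndepFun z P) (hz : ∀ i, Measurable (z i))
    {S T : Finset (Fin K)} (hST : Disjoint S T) {A : Set (S → ℝ)} {B : Set (T → ℝ)}
    (hA : MeasurableSet A) (hB : MeasurableSet B) :
    P ((fun ω (i : S) => z i ω) ⁻¹' A ∩ (fun ω (i : T) => z i ω) ⁻¹' B) =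
      P ((fun ω (i : S) => z i ω) ⁻¹' A) * P ((fun ω (i : T) => z i ω) ⁻¹' B) :=
  (hind.indepFun_finset S T hST hz).measure_inter_preimage_eq_mul _ _ hA hB

/-- If a good arm has a large sample, then either a bad arm with few or misleading observations is
played, or the good arm was itself unlucky. -/
lemma measure_lt_le_add_odds [IsProbabilityMeasure P] (hind : iIndepFun z P) (hz : ∀ i, Measurable (z i))
    (O H : Finset (Fin K)) (hOH : Disjoint O H) {j : Fin K} (hj : j ∈ O) {y : ℝ}
    (hH : ∀ i ∈ H, P {ω | z i ω ≤ y} ≤ 1 / (2 * K)) (hjy : P {ω | z j ω ≤ y} ≠ 0) :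
    P {ω | y < z j ω} ≤
      2 * ∑ i ∈ Oᶜ \ H, P {ω | i ∈ smallest order O.card fun k => z k ω} +
      2 * (P {ω | y < z j ω} / P {ω | z j ω ≤ y} *
        P {ω | j ∈ smallest order O.card fun k => z k ω}) := by
  -- `D` says that the reliable arms of `H` behave. It involves only the samples in `H`, so it is
  -- independent of events about the other arms, and each of the two parts below is restricted to it
  -- at the price of a factor two.
  set D : Set Ω := {ω | ∀ i ∈ H, y < z i ω} with hD
  set N : Set Ω := {ω | ∀ i ∈ Oᶜ \ H, y < z i ω} with hN
  have hDm : MeasurableSet D := measurableSet_forall_lt hz H y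
  have hNm : MeasurableSet N := measurableSet_forall_lt hz _ y
  have hDc : P Dᶜ ≤ 1 / 2 := measure_exists_le_le_half H hH
  have hjH : j ∉ H := Finset.disjoint_left.1 hOH hj
  have hDpre : D = (fun ω (i : H) => z i ω) ⁻¹' {v | ∀ i, y < v i} := by
    ext ω; simp [hD]
  have hDpre_m : MeasurableSet {v : H → ℝ | ∀ i, y < v i} := by
    rw [Set.ofPred_forall]
    exact MeasurableSet.iInter fun i => measurableSet_lt measurable_const (measurable_pi_apply i)
  -- a bad arm has a small sample
  have part1 : P ({ω | y < z j ω} ∩ Nᶜ) ≤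
      2 * ∑ i ∈ Oᶜ \ H, P {ω | i ∈ smallest order O.card fun k => z k ω} := by
    have hpre : {ω | y < z j ω} ∩ Nᶜ = (fun ω (i : (Hᶜ : Finset (Fin K))) => z i ω) ⁻¹'
        ({v | y < v ⟨j, by simpa using hjH⟩} ∩ {v | ∀ i : (Hᶜ : Finset (Fin K)), (i : Fin K) ∉ O → y < v i}ᶜ) := by
      ext ω
      simp only [hN, Set.mem_inter_iff, Set.mem_ofPred_eq, Set.mem_compl_iff, Set.mem_preimage,
        Finset.mem_sdiff, Finset.mem_compl, Subtype.forall, and_imp]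
      refine and_congr_right fun _ => not_congr ⟨fun h i h1 h2 => h i h2 h1, fun h i h1 h2 => h i h2 h1⟩
    have hmeas : MeasurableSet ({v : (Hᶜ : Finset (Fin K)) → ℝ | y < v ⟨j, by simpa using hjH⟩} ∩
        {v | ∀ i : (Hᶜ : Finset (Fin K)), (i : Fin K) ∉ O → y < v i}ᶜ) := by
      refine (measurableSet_lt measurable_const (measurable_pi_apply _)).inter
        (MeasurableSet.compl ?_)
      rw [Set.ofPred_forall]
      refine MeasurableSet.iInter fun i => ?_
      by_cases hi : (i : Fin K) ∈ O
      · simp [hi]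
      · simpa [hi] using measurableSet_lt measurable_const (measurable_pi_apply i)
    refine (le_two_mul_measure_inter hDm hDc ?_).trans (mul_le_mul_right ?_ _)
    · rw [hpre, hDpre]
      exact measure_inter_of_disjoint hind hz disjoint_compl_right hDpre_m hmeas
    · refine (measure_mono (t := ⋃ i ∈ Oᶜ \ H,
        {ω | i ∈ smallest order O.card fun k => z k ω}) ?_).trans (measure_biUnion_finset_le _ _)
      rintro ω ⟨hωD, hω1, hω2⟩
      simp only [hN, Set.mem_compl_iff, Set.mem_ofPred_eq, not_forall, not_lt, Finset.mem_sdiff,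
        Finset.mem_compl] at hω2
      obtain ⟨i, ⟨hiO, _⟩, hi⟩ := hω2
      obtain ⟨k, hkO, hky, hk⟩ := exists_mem_smallest_of_lt (order := order)
        (z := fun k => z k ω) hj hω1 hiO hi
      refine Set.mem_biUnion (x := k) ?_ hk
      simp only [Finset.coe_sdiff, Finset.coe_compl, Set.mem_sdiff, Set.mem_compl_iff,
        Finset.mem_coe]
      exact ⟨hkO, fun hkH => absurd hky (not_le.2 (hωD k hkH))⟩
  -- no bad arm has a small sample
  have part2 : P ({ω | y < z j ω} ∩ N) ≤ 2 * (P {ω | y < z j ω} / P {ω | z j ω ≤ y} *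
        P {ω | j ∈ smallest order O.card fun k => z k ω}) := by
    have hNpre : N = (fun ω (i : (Oᶜ \ H : Finset (Fin K))) => z i ω) ⁻¹' {v | ∀ i, y < v i} := by
      ext ω; simp [hN]
    have hNpre_m : MeasurableSet {v : (Oᶜ \ H : Finset (Fin K)) → ℝ | ∀ i, y < v i} := by
      rw [Set.ofPred_forall]
      exact MeasurableSet.iInter fun i => measurableSet_lt measurable_const (measurable_pi_apply i)
    have hdisj : Disjoint ({j} : Finset (Fin K)) (Oᶜ \ H) := by
      rw [Finset.disjoint_singleton_left]; simp [hj]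
    -- `N` does not involve arm `j`. A large sample of `j` can therefore be exchanged for a small
    -- one at the rate of the odds, and with a small one (on `D ∩ N`) arm `j` is played.
    have h1 : P ({ω | y < z j ω} ∩ N) = P {ω | y < z j ω} * P N := by
      rw [hNpre]
      exact measure_inter_of_disjoint (S := {j}) hind hz hdisj
        (A := {v | y < v ⟨j, by simp⟩})
        (measurableSet_lt measurable_const (measurable_pi_apply _)) hNpre_m
    have h2 : P ({ω | z j ω ≤ y} ∩ N) = P {ω | z j ω ≤ y} * P N := by
      rw [hNpre]
      exact measure_inter_of_disjoint (S := {j}) hind hz hdisj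
        (A := {v | v ⟨j, by simp⟩ ≤ y})
        (measurableSet_le (measurable_pi_apply _) measurable_const) hNpre_m
    have h3 : P ({ω | z j ω ≤ y} ∩ N) ≤
        2 * P {ω | j ∈ smallest order O.card fun k => z k ω} := by
      have hpre : {ω | z j ω ≤ y} ∩ N = (fun ω (i : (Hᶜ : Finset (Fin K))) => z i ω) ⁻¹'
          ({v | v ⟨j, by simpa using hjH⟩ ≤ y} ∩ {v | ∀ i : (Hᶜ : Finset (Fin K)), (i : Fin K) ∉ O → y < v i}) := by
        ext ω
        simp only [hN, Set.mem_inter_iff, Set.mem_ofPred_eq, Set.mem_preimage,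
          Finset.mem_sdiff, Finset.mem_compl, Subtype.forall, and_imp]
        refine and_congr_right fun _ => ⟨fun h i h1 h2 => h i h2 h1, fun h i h1 h2 => h i h2 h1⟩
      have hmeas : MeasurableSet ({v : (Hᶜ : Finset (Fin K)) → ℝ | v ⟨j, by simpa using hjH⟩ ≤ y} ∩
          {v | ∀ i : (Hᶜ : Finset (Fin K)), (i : Fin K) ∉ O → y < v i}) := by
        refine (measurableSet_le (measurable_pi_apply _) measurable_const).inter ?_
        rw [Set.ofPred_forall]
        refine MeasurableSet.iInter fun i => ?_
        by_cases hi : (i : Fin K) ∈ O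
        · simp [hi]
        · simpa [hi] using measurableSet_lt measurable_const (measurable_pi_apply i)
      refine (le_two_mul_measure_inter hDm hDc ?_).trans (mul_le_mul_right ?_ _)
      · rw [hpre, hDpre]
        exact measure_inter_of_disjoint hind hz disjoint_compl_right hDpre_m hmeas
      · refine measure_mono ?_
        rintro ω ⟨hωD, hω1, hω2⟩
        refine mem_smallest_of_le (z := fun k => z k ω) hj hω1 fun i hi => ?_
        by_cases hiH : i ∈ H
        · exact hωD i hiH
        · exact hω2 i (by simp [hi, hiH])
    rw [h1]
    rw [h2] at h3
    set a := P {ω | y < z j ω}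
    set b := P {ω | z j ω ≤ y}
    have hb : b ≠ ∞ := measure_ne_top _ _
    calc a * P N = a / b * (b * P N) := by
          rw [← mul_assoc, ENNReal.div_mul_cancel hjy hb]
      _ ≤ a / b * (2 * P {ω | j ∈ smallest order O.card fun k => z k ω}) := by gcongr
      _ = _ := by ring
  calc P {ω | y < z j ω} ≤ P ({ω | y < z j ω} ∩ Nᶜ) + P ({ω | y < z j ω} ∩ N) := by
        rw [add_comm]
        exact (measure_inter_add_sdiff _ hNm).symm.le
    _ ≤ _ := add_le_add part1 part2

/-- A good arm with a small sample is played, or a bad arm with few or misleading observations is,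
at least half of the time. -/
lemma measure_le_le_add [IsProbabilityMeasure P] (hind : iIndepFun z P) (hz : ∀ i, Measurable (z i))
    (O H : Finset (Fin K)) (hOH : Disjoint O H) {j : Fin K} (hj : j ∈ O) {y : ℝ}
    (hH : ∀ i ∈ H, P {ω | z i ω ≤ y} ≤ 1 / (2 * K)) :
    P {ω | z j ω ≤ y} ≤
      2 * P {ω | j ∈ smallest order O.card fun k => z k ω} +
      2 * ∑ i ∈ Oᶜ \ H, P {ω | i ∈ smallest order O.card fun k => z k ω} := by
  set D : Set Ω := {ω | ∀ i ∈ H, y < z i ω} with hD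
  have hDm : MeasurableSet D := measurableSet_forall_lt hz H y
  have hDc : P Dᶜ ≤ 1 / 2 := measure_exists_le_le_half H hH
  have hjH : j ∉ H := Finset.disjoint_left.1 hOH hj
  have hDpre : D = (fun ω (i : H) => z i ω) ⁻¹' {v | ∀ i, y < v i} := by
    ext ω; simp [hD]
  have hDpre_m : MeasurableSet {v : H → ℝ | ∀ i, y < v i} := by
    rw [Set.ofPred_forall]
    exact MeasurableSet.iInter fun i => measurableSet_lt measurable_const (measurable_pi_apply i)
  rw [← mul_add]
  refine (le_two_mul_measure_inter (B := {ω | z j ω ≤ y}) hDm hDc ?_).trans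
    (mul_le_mul_right ?_ _)
  · rw [hDpre]
    exact measure_inter_of_disjoint (T := {j}) hind hz (by simpa using hjH)
      (B := {v | v ⟨j, by simp⟩ ≤ y}) hDpre_m
      (measurableSet_le (measurable_pi_apply _) measurable_const)
  · refine (measure_mono (t := {ω | j ∈ smallest order O.card fun k => z k ω} ∪ ⋃ i ∈ Oᶜ \ H,
        {ω | i ∈ smallest order O.card fun k => z k ω}) ?_).trans
        ((measure_union_le _ _).trans (add_le_add le_rfl (measure_biUnion_finset_le _ _)))
    rintro ω ⟨hωD, hω⟩
    by_cases hjS : j ∈ smallest order O.card fun k => z k ω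
    · exact Or.inl hjS
    · obtain ⟨k, hkO, hky, hk⟩ := exists_mem_smallest_of_notMem hj hjS
      refine Or.inr (Set.mem_biUnion (x := k) ?_ hk)
      simp only [Finset.coe_sdiff, Finset.coe_compl, Set.mem_sdiff, Set.mem_compl_iff,
        Finset.mem_coe]
      exact ⟨hkO, fun hkH => absurd (hky.trans hω) (not_le.2 (hωD k hkH))⟩

/-- Two small samples at once are rarer than one by the factor `P {z j ≤ y}`. -/
lemma measure_two_le [IsProbabilityMeasure P] (hind : iIndepFun z P) (hz : ∀ i, Measurable (z i)) {n : ℕ} {i j : Fin K}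
    (hij : i ≠ j) {y : ℝ} (hj : P {ω | z j ω ≤ y} ≤ 1 / 2) :
    P {ω | (i ∈ smallest order n fun k => z k ω) ∧ z i ω ≤ y ∧ z j ω ≤ y} ≤
      2 * (P {ω | z j ω ≤ y} * P {ω | i ∈ smallest order n fun k => z k ω}) := by
  -- Overwriting the sample of `j` by `y + 1` makes `B` a function of the other samples only, hence
  -- independent of arm `j`. It contains the event in question and, when `z j > y`, implies that `i`
  -- is selected.
  set B : Set Ω := {ω | (i ∈ smallest order n (Function.update (fun k => z k ω) j (y + 1))) ∧
    z i ω ≤ y} with hB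
  let ext' : ((({j}ᶜ : Finset (Fin K))) → ℝ) → Fin K → ℝ :=
    fun v k => if h : k ∈ ({j}ᶜ : Finset (Fin K)) then v ⟨k, h⟩ else y + 1
  have hext : Measurable ext' := by
    refine measurable_pi_lambda _ fun k => ?_
    by_cases h : k ∈ ({j}ᶜ : Finset (Fin K))
    · simp only [ext', h, dif_pos]; exact measurable_pi_apply _
    · simp only [ext', h, dif_neg, not_false_eq_true]; exact measurable_const
  have hpre : B = (fun ω (k : (({j}ᶜ : Finset (Fin K)))) => z k ω) ⁻¹'
      ({v | i ∈ smallest order n (ext' v)} ∩ {v | v ⟨i, by simpa using hij⟩ ≤ y}) := by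
    ext ω
    have : ext' (fun k : (({j}ᶜ : Finset (Fin K))) => z k ω) =
        Function.update (fun k => z k ω) j (y + 1) := by
      ext k
      by_cases h : k = j
      · subst h; simp [ext']
      · simp [ext', h]
    simp only [hB, Set.mem_ofPred_eq, Set.mem_preimage, Set.mem_inter_iff, this]
  have hmeas : MeasurableSet ({v | i ∈ smallest order n (ext' v)} ∩
      {v : (({j}ᶜ : Finset (Fin K))) → ℝ | v ⟨i, by simpa using hij⟩ ≤ y}) :=
    (measurableSet_mem_smallest order n i hext).inter
      (measurableSet_le (measurable_pi_apply _) measurable_const)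
  have e1 : P ({ω | z j ω ≤ y} ∩ B) = P {ω | z j ω ≤ y} * P B := by
    rw [hpre]
    exact measure_inter_of_disjoint (S := {j}) hind hz disjoint_compl_right
      (A := {v | v ⟨j, by simp⟩ ≤ y})
      (measurableSet_le (measurable_pi_apply _) measurable_const) hmeas
  have e2 : P ({ω | y < z j ω} ∩ B) = P {ω | y < z j ω} * P B := by
    rw [hpre]
    exact measure_inter_of_disjoint (S := {j}) hind hz disjoint_compl_right
      (A := {v | y < v ⟨j, by simp⟩})
      (measurableSet_lt measurable_const (measurable_pi_apply _)) hmeas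
  have hcompl : {ω | y < z j ω}ᶜ = {ω | z j ω ≤ y} := by ext; simp
  have e3 : P B ≤ 2 * P {ω | i ∈ smallest order n fun k => z k ω} := by
    refine (le_two_mul_measure_inter (measurableSet_lt measurable_const (hz j))
      (by rw [hcompl]; exact hj) e2).trans (mul_le_mul_right (measure_mono ?_) _)
    rintro ω ⟨hω, hω1, hω2⟩
    have := mem_smallest_update (order := order) (n := n) (c := z j ω) (j := j) (y := y)
      (z := Function.update (fun k => z k ω) j (y + 1)) hij
      (by rw [Function.update_of_ne hij]; exact hω2) hω hω1
    simpa using this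
  calc _ ≤ P ({ω | z j ω ≤ y} ∩ B) := by
        refine measure_mono ?_
        rintro ω ⟨h1, h2, h3⟩
        exact ⟨h3, mem_smallest_update hij h2 (by linarith) h1, h2⟩
    _ ≤ P {ω | z j ω ≤ y} * (2 * P {ω | i ∈ smallest order n fun k => z k ω}) := by
        rw [e1]; gcongr
    _ = _ := by ring

end OneRound

/-! ### Measurability of the run and independence of past and present -/

/-- States are countable and discrete: every function of the state is measurable, and expectations
split into sums over states. -/
instance {K : ℕ} : MeasurableSpace (State K) := ⊤

instance {K : ℕ} : DiscreteMeasurableSpace (State K) := ⟨fun _ => trivial⟩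

instance {K : ℕ} : MeasurableSpace (Finset (Fin K)) := ⊤

instance {K : ℕ} : DiscreteMeasurableSpace (Finset (Fin K)) := ⟨fun _ => trivial⟩

instance {K : ℕ} : Countable (State K) := by
  have : Function.Injective fun s : State K => (s.l, s.u, s.i, s.C, s.S, s.F) := by
    rintro ⟨⟩ ⟨⟩ h
    simpa using h
  exact this.countable

/-- The transition of the learner when the set `A` of arms is served and the losses are `x`. -/
def State.next {K : ℕ} (θ Q W : ℝ) (s : State K) (A : Finset (Fin K)) (x : Fin K → Bool) :
    State K :=
  open Classical in
  if s.i ≠ s.u then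
    if s.threshold Q < θ ∧ ∃ j ∈ A, x j = true then
      { s with l := s.i, i := s.i + (s.u - s.i + 1) / 2, C := 0 }
    else if W ≤ ((s.C + 1 : ℕ) : ℝ) then
      { s with u := s.i, i := s.i - (s.i - s.l) / 2, C := 0 }
    else
      { s with C := s.C + 1 }
  else
    { s with
      S := fun j => if j ∉ A ∧ x j = true then s.S j + 1 else s.S j
      F := fun j => if j ∉ A ∧ x j = false then s.F j + 1 else s.F j }

/-- Served arms all receive the same amount, so censoring depends only on whether the current
estimate is below `θ`; arms with allocation `0 < θ` are never censored. The samples then enter only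
through the served set, which takes finitely many values. -/
lemma update_eq_next {K : ℕ} {θ : ℝ} (hθ : 0 < θ) (Q W : ℝ) (order : Equiv.Perm (Fin K))
    (s : State K) (z : Fin K → ℝ) (x : Fin K → Bool) :
    s.update Q W order z (feedback θ (s.alloc Q order z) x) =
      s.next θ Q W (s.served Q order z) x := by
  have h1 : (∃ j ∈ s.served Q order z, feedback θ (s.alloc Q order z) x j = true) ↔
      (s.threshold Q < θ ∧ ∃ j ∈ s.served Q order z, x j = true) := by
    constructor
    · rintro ⟨j, hj, h⟩
      simp only [feedback, State.alloc, if_pos hj, Bool.and_eq_true, decide_eq_true_eq] at h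
      exact ⟨h.2, j, hj, h.1⟩
    · rintro ⟨hθ, j, hj, h⟩
      refine ⟨j, hj, ?_⟩
      simp only [feedback, State.alloc, if_pos hj, Bool.and_eq_true, decide_eq_true_eq]
      exact ⟨h, hθ⟩
  have h2 : ∀ j, j ∉ s.served Q order z → feedback θ (s.alloc Q order z) x j = x j := by
    intro j hj
    simp [feedback, State.alloc, hj, hθ]
  have h3 : ∀ j b, (j ∉ s.served Q order z ∧ feedback θ (s.alloc Q order z) x j = b) ↔
      (j ∉ s.served Q order z ∧ x j = b) := fun j b => by
    refine and_congr_right fun hj => ?_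
    rw [h2 j hj]
  simp only [State.update, State.next, h1, h3]

section Run

variable {K : ℕ} {θ Q W : ℝ} {order : Equiv.Perm (Fin K)} {Ω : Type*}
  {X : ℕ → Fin K → Ω → Bool} {Z : ℕ → Fin K → ℕ → ℕ → Ω → ℝ}

lemma state_succ (hθ : 0 < θ) (ω : Ω) (t : ℕ) :
    state θ Q W order X Z ω (t + 1) = (state θ Q W order X Z ω t).next θ Q W
      ((state θ Q W order X Z ω t).served Q order
        (samples Z t (state θ Q W order X Z ω t) ω)) (fun i => X t i ω) := by
  rw [← update_eq_next hθ]
  rfl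

lemma measurableSet_mem_served (s : State K) (j : Fin K) [MeasurableSpace Ω]
    {z : Ω → Fin K → ℝ} (hz : Measurable z) : MeasurableSet {ω | j ∈ s.served Q order (z ω)} := by
  unfold State.served
  split_ifs
  · exact MeasurableSet.const _
  · simp only [Finset.mem_compl]
    exact (measurableSet_mem_smallest order _ j hz).compl

lemma measurable_served (s : State K) [MeasurableSpace Ω] {z : Ω → Fin K → ℝ}
    (hz : Measurable z) : Measurable fun ω => s.served Q order (z ω) := by
  refine measurable_to_countable' fun A => ?_
  have : (fun ω => s.served Q order (z ω)) ⁻¹' {A} =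
      ⋂ j, {ω | j ∈ s.served Q order (z ω) ↔ j ∈ A} := by
    ext ω
    simp [Finset.ext_iff]
  rw [this]
  refine MeasurableSet.iInter fun j => ?_
  by_cases hj : j ∈ A
  · simpa [hj] using measurableSet_mem_served s j hz
  · simp only [hj, iff_false]
    exact (measurableSet_mem_served s j hz).compl

lemma measurable_next (s : State K) [MeasurableSpace Ω] {z : Ω → Fin K → ℝ} (hz : Measurable z)
    {x : Ω → Fin K → Bool} (hx : Measurable x) :
    Measurable fun ω => s.next θ Q W (s.served Q order (z ω)) (x ω) :=
  (Measurable.of_discrete (f := fun p : Finset (Fin K) × (Fin K → Bool) =>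
    s.next θ Q W p.1 p.2)).comp ((measurable_served s hz).prodMk hx)

lemma measurable_apply_countable {σ β : Type*} [MeasurableSpace σ] [DiscreteMeasurableSpace σ]
    [Countable σ] [MeasurableSpace β] [MeasurableSpace Ω] {f : Ω → σ} (hf : Measurable f)
    {g : σ → Ω → β} (hg : ∀ s, Measurable (g s)) : Measurable fun ω => g (f ω) ω := by
  have : Measurable fun p : σ × Ω => g p.1 p.2 := measurable_from_prod_countable_right hg
  exact this.comp (hf.prodMk measurable_id)

lemma measurable_samples [MeasurableSpace Ω] {t : ℕ} (hZ : ∀ i a b, Measurable (Z t i a b))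
    (s : State K) : Measurable (samples Z t s) :=
  measurable_pi_lambda _ fun _ => hZ _ _ _

/-- The sigma-algebra on `Ω` is left arbitrary and only noise before round `t` is used, so that it
can later be the one generated by the past. -/
lemma measurable_state (hθ : 0 < θ) [MeasurableSpace Ω] {t : ℕ}
    (hX : ∀ s < t, ∀ i, Measurable (X s i))
    (hZ : ∀ s < t, ∀ i a b, Measurable (Z s i a b)) :
    Measurable fun ω => state θ Q W order X Z ω t := by
  induction t with
  | zero => exact measurable_const
  | succ t ih =>
    simp only [state_succ hθ]
    refine measurable_apply_countable (ih (fun s hs => hX s (by omega))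
      (fun s hs => hZ s (by omega))) (g := fun s ω =>
        s.next θ Q W (s.served Q order (samples Z t s ω)) (fun i => X t i ω)) fun s => ?_
    exact measurable_next s (measurable_samples (hZ t (by omega)) s)
      (measurable_pi_lambda _ fun i => hX t (by omega) i)

/-- The sigma-algebras generated by the single losses and the single draws. -/
@[reducible]
def noiseSigma (X : ℕ → Fin K → Ω → Bool) (Z : ℕ → Fin K → ℕ → ℕ → Ω → ℝ) :
    (ℕ × Fin K) ⊕ ((ℕ × Fin K) × (ℕ × ℕ)) → MeasurableSpace Ω :=
  Sum.elim (fun p => MeasurableSpace.comap (X p.1 p.2) inferInstance)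
    (fun p => MeasurableSpace.comap (Z p.1.1 p.1.2 p.2.1 p.2.2) inferInstance)

lemma measurable_loss_of_mem {I : Set ((ℕ × Fin K) ⊕ ((ℕ × Fin K) × (ℕ × ℕ)))} {t : ℕ} {i : Fin K}
    (h : Sum.inl (t, i) ∈ I) : Measurable[⨆ q ∈ I, noiseSigma X Z q] (X t i) :=
  measurable_iff_comap_le.2 (le_iSup₂_of_le (Sum.inl (t, i)) h le_rfl)

lemma measurable_draw_of_mem {I : Set ((ℕ × Fin K) ⊕ ((ℕ × Fin K) × (ℕ × ℕ)))} {t : ℕ} {i : Fin K}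
    {a b : ℕ} (h : Sum.inr ((t, i), (a, b)) ∈ I) :
    Measurable[⨆ q ∈ I, noiseSigma X Z q] (Z t i a b) :=
  measurable_iff_comap_le.2 (le_iSup₂_of_le (Sum.inr ((t, i), (a, b))) h le_rfl)

variable [MeasurableSpace Ω] {P : Measure Ω} {μ : Fin K → ℝ}

lemma noiseSigma_le (hN : IsNoise μ P X Z) (q) :
    noiseSigma X Z q ≤ (inferInstance : MeasurableSpace Ω) := by
  rcases q with p | p
  · exact measurable_iff_comap_le.1 (hN.measurable_loss _ _)
  · exact measurable_iff_comap_le.1 (hN.measurable_draw _ _ _ _)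

/-- Independence among losses, among draws, and between the two families is merged into one
independent family; past and present are then disjoint blocks of indices. -/
lemma iIndep_noiseSigma (hN : IsNoise μ P X Z) : iIndep (noiseSigma X Z) P := by
  rw [iIndep_iff]
  intro S f hf
  have hS : S = S.toLeft.disjSum S.toRight := Finset.toLeft_disjSum_toRight.symm
  have hset : ⋂ i ∈ S, f i =
      (⋂ i ∈ S.toLeft, f (Sum.inl i)) ∩ ⋂ i ∈ S.toRight, f (Sum.inr i) := by
    ext ω
    simp only [Set.mem_iInter, Set.mem_inter_iff, Finset.mem_toLeft, Finset.mem_toRight]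
    constructor
    · exact fun h => ⟨fun i hi => h _ hi, fun i hi => h _ hi⟩
    · rintro ⟨h1, h2⟩ (i | i) hi
      exacts [h1 i hi, h2 i hi]
  rw [hset, hS, Finset.prod_disjSum, ← hS]
  have hX : P (⋂ i ∈ S.toLeft, f (Sum.inl i)) = ∏ i ∈ S.toLeft, P (f (Sum.inl i)) :=
    hN.indep_loss.meas_biInter fun i hi => hf _ (Finset.mem_toLeft.1 hi)
  have hZ : P (⋂ i ∈ S.toRight, f (Sum.inr i)) = ∏ i ∈ S.toRight, P (f (Sum.inr i)) :=
    hN.indep_draw.meas_biInter fun i hi => hf _ (Finset.mem_toRight.1 hi)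
  rw [← hX, ← hZ]
  have hind := (Indep_iff _ _ _).1 ((IndepFun_iff_Indep _ _ _).1 hN.indep_loss_draw)
  refine hind _ _ ?_ ?_
  · refine Finset.measurableSet_biInter _ fun i hi => ?_
    obtain ⟨A, hA, hA'⟩ := hf _ (Finset.mem_toLeft.1 hi)
    exact ⟨(fun g => g i) ⁻¹' A, measurable_pi_apply i hA, hA'⟩
  · refine Finset.measurableSet_biInter _ fun i hi => ?_
    obtain ⟨A, hA, hA'⟩ := hf _ (Finset.mem_toRight.1 hi)
    exact ⟨(fun g => g i) ⁻¹' A, measurable_pi_apply i hA, hA'⟩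

lemma indep_noise (hN : IsNoise μ P X Z)
    {I J : Set ((ℕ × Fin K) ⊕ ((ℕ × Fin K) × (ℕ × ℕ)))} (hIJ : Disjoint I J) :
    Indep (⨆ q ∈ I, noiseSigma X Z q) (⨆ q ∈ J, noiseSigma X Z q) P :=
  indep_iSup_of_disjoint (noiseSigma_le hN) (iIndep_noiseSigma hN) hIJ

end Run

/-! ### Expected numbers of rounds -/

/-- The indicator of a proposition. -/
def ind (p : Prop) : ℝ≥0∞ := open Classical in if p then 1 else 0

lemma ind_of {p : Prop} (h : p) : ind p = 1 := by simp [ind, h]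

lemma ind_of_not {p : Prop} (h : ¬ p) : ind p = 0 := by simp [ind, h]

lemma ind_mono {p q : Prop} (h : p → q) : ind p ≤ ind q := by
  by_cases hp : p
  · rw [ind_of hp, ind_of (h hp)]
  · rw [ind_of_not hp]; exact zero_le

lemma ind_le_add {p q r : Prop} (h : p → q ∨ r) : ind p ≤ ind q + ind r := by
  by_cases hp : p
  · rw [ind_of hp]
    rcases h hp with h | h
    · rw [ind_of h]; exact le_self_add
    · rw [ind_of h]; exact le_add_self
  · rw [ind_of_not hp]; exact zero_le

lemma ind_le_sum {ι : Type*} {p : Prop} {q : ι → Prop} {s : Finset ι} (h : p → ∃ i ∈ s, q i) :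
    ind p ≤ ∑ i ∈ s, ind (q i) := by
  by_cases hp : p
  · obtain ⟨i, hi, hq⟩ := h hp
    rw [ind_of hp, ← ind_of hq]
    exact Finset.single_le_sum (f := fun i => ind (q i)) (fun _ _ => zero_le) hi
  · rw [ind_of_not hp]; exact zero_le

lemma ind_and (p q : Prop) : ind (p ∧ q) = ind p * ind q := by
  by_cases hp : p <;> by_cases hq : q <;> simp [ind, hp, hq]

lemma measurable_ind {α : Type*} [MeasurableSpace α] {p : α → Prop} (h : MeasurableSet {x | p x}) :
    Measurable fun x => ind (p x) := by
  unfold ind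
  exact Measurable.ite h measurable_const measurable_const

lemma lintegral_ind {α : Type*} [MeasurableSpace α] {P : Measure α} {p : α → Prop}
    (h : MeasurableSet {x | p x}) : ∫⁻ x, ind (p x) ∂P = P {x | p x} := by
  rw [← lintegral_indicator_one h]
  refine lintegral_congr fun x => ?_
  by_cases hx : p x
  · rw [ind_of hx, Set.indicator_of_mem (by exact hx)]; rfl
  · rw [ind_of_not hx, Set.indicator_of_notMem (by exact hx)]

lemma lintegral_tsum_ind {α ι : Type*} [Countable ι] [MeasurableSpace α] {P : Measure α}
    {A : ι → Set α} {c : ι → ℝ≥0∞} (hA : ∀ p, MeasurableSet (A p)) :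
    ∫⁻ x, ∑' p, ind (x ∈ A p) * c p ∂P = ∑' p, P (A p) * c p := by
  have hm : ∀ p, Measurable fun x => ind (x ∈ A p) := fun p => measurable_ind (hA p)
  rw [lintegral_tsum fun p => ((hm p).mul_const _).aemeasurable]
  refine tsum_congr fun p => ?_
  rw [lintegral_mul_const _ (hm p), lintegral_ind (p := fun x => x ∈ A p) (hA p)]
  rfl

section Counts

variable {K : ℕ} {θ Q W : ℝ} {order : Equiv.Perm (Fin K)} {Ω : Type*}
  {X : ℕ → Fin K → Ω → Bool} {Z : ℕ → Fin K → ℕ → ℕ → Ω → ℝ}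

local notation "st" => state θ Q W order X Z

/-! ### The counts of a single arm -/

/-- Arm `i` is left without resource in the regret minimization phase. -/
def Played (Q : ℝ) (order : Equiv.Perm (Fin K)) (i : Fin K) (s : State K) (z : Fin K → ℝ) : Prop :=
  s.i = s.u ∧ i ∉ s.served Q order z

lemma measurableSet_played (s : State K) (i : Fin K) :
    MeasurableSet {z | Played Q order i s z} :=
  (MeasurableSet.const _).inter (measurableSet_mem_served s i measurable_id).compl

lemma next_S (s : State K) (A : Finset (Fin K)) (x : Fin K → Bool) (i : Fin K) :
    (s.next θ Q W A x).S i = if s.i = s.u ∧ i ∉ A ∧ x i = true then s.S i + 1 else s.S i := by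
  unfold State.next
  by_cases h : s.i = s.u
  · simp [h]
  · simp only [ne_eq, h, not_false_eq_true, if_true, false_and, if_false]
    split_ifs <;> rfl

lemma next_F (s : State K) (A : Finset (Fin K)) (x : Fin K → Bool) (i : Fin K) :
    (s.next θ Q W A x).F i = if s.i = s.u ∧ i ∉ A ∧ x i = false then s.F i + 1 else s.F i := by
  unfold State.next
  by_cases h : s.i = s.u
  · simp [h]
  · simp only [ne_eq, h, not_false_eq_true, if_true, false_and, if_false]
    split_ifs <;> rfl

lemma one_le_S_and_F (hθ : 0 < θ) (ω : Ω) (t : ℕ) (i : Fin K) :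
    1 ≤ (st ω t).S i ∧ 1 ≤ (st ω t).F i := by
  induction t with
  | zero => exact ⟨le_rfl, le_rfl⟩
  | succ t ih =>
    rw [state_succ hθ, next_S, next_F]
    constructor <;> split_ifs <;> omega

/-- The event that arm `i` has seen `k` losses and `f` non-losses. -/
def countEvent (i : Fin K) (k f : ℕ) : Set (State K) := {s | s.S i = k + 1 ∧ s.F i = f + 1}

/-- The event that arm `i` is played in round `t`, having seen `k` losses and `f` non-losses. -/
def playEvent (θ Q W : ℝ) (order : Equiv.Perm (Fin K))
    (X : ℕ → Fin K → Ω → Bool) (Z : ℕ → Fin K → ℕ → ℕ → Ω → ℝ) (t : ℕ) (i : Fin K) (k f : ℕ) :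
    Set Ω :=
  {ω | state θ Q W order X Z ω t ∈ countEvent i k f ∧
    Played Q order i (state θ Q W order X Z ω t) (samples Z t (state θ Q W order X Z ω t) ω)}

/-- The asymmetry between losses before `t` and draws up to `t` matters: the decision to play uses
the current draws but not the current losses. -/
lemma measurableSet_playEvent [MeasurableSpace Ω] (hθ : 0 < θ) {t : ℕ}
    (hX : ∀ s < t, ∀ i, Measurable (X s i))
    (hZ : ∀ s ≤ t, ∀ i a b, Measurable (Z s i a b)) (i : Fin K) (k f : ℕ) :
    MeasurableSet (playEvent θ Q W order X Z t i k f) := by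
  have hst : Measurable fun ω => st ω t := measurable_state hθ hX fun s hs => hZ s hs.le
  refine MeasurableSet.inter ?_ ?_
  · exact hst (MeasurableSet.of_discrete (s := countEvent i k f))
  · have : Measurable fun ω => ind (Played Q order i (st ω t) (samples Z t (st ω t) ω)) :=
      measurable_apply_countable hst (g := fun s ω => ind (Played Q order i s (samples Z t s ω)))
        fun s => measurable_ind ((measurable_samples (hZ t le_rfl) s) (measurableSet_played s i))
    have h2 : {ω | Played Q order i (st ω t) (samples Z t (st ω t) ω)} =
        (fun ω => ind (Played Q order i (st ω t) (samples Z t (st ω t) ω))) ⁻¹' {1} := by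
      ext ω
      by_cases h : Played Q order i (st ω t) (samples Z t (st ω t) ω)
      · simp [h, ind_of]
      · simp [h, ind_of_not]
    have h3 := this (measurableSet_singleton 1)
    rw [← h2] at h3
    exact h3

end Counts

/-! ### Expected sums over rounds and the flow of the counts of an arm. -/

section Run

variable {K : ℕ} {θ Q W : ℝ} {order : Equiv.Perm (Fin K)} {Ω : Type*}
  {X : ℕ → Fin K → Ω → Bool} {Z : ℕ → Fin K → ℕ → ℕ → Ω → ℝ}
  [MeasurableSpace Ω] {P : Measure Ω} {μ : Fin K → ℝ}

local notation "st" => state θ Q W order X Z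

lemma measurable_st (hθ : 0 < θ) (hN : IsNoise μ P X Z) (t : ℕ) : Measurable fun ω => st ω t :=
  measurable_state hθ (fun _ _ _ => hN.measurable_loss _ _) (fun _ _ _ _ _ => hN.measurable_draw _ _ _ _)

lemma measurable_samples_of (hN : IsNoise μ P X Z) (t : ℕ) (s : State K) :
    Measurable (samples Z t s) :=
  measurable_samples (fun _ _ _ => hN.measurable_draw _ _ _ _) s

lemma iIndepFun_samples (hN : IsNoise μ P X Z) (t : ℕ) (s : State K) :
    iIndepFun (fun i ω => samples Z t s ω i) P :=
  hN.indep_draw.precomp (g := fun i : Fin K => ((t, i), (s.S i, s.F i))) fun i j h => by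
    simpa using congrArg (fun p => p.1.2) h

lemma measure_samples (hN : IsNoise μ P X Z) (t : ℕ) {s : State K} {i : Fin K}
    (hS : 1 ≤ s.S i) (hF : 1 ≤ s.F i) {A : Set ℝ} (hA : MeasurableSet A) :
    P {ω | samples Z t s ω i ∈ A} = betaMeasure (s.S i : ℝ) (s.F i : ℝ) A := by
  rw [← hN.law_draw t i _ _ hS hF, Measure.map_apply (hN.measurable_draw _ _ _ _) hA]
  rfl

/-- The state is independent of the noise of the round. -/
lemma lintegral_state (hθ : 0 < θ) (hN : IsNoise μ P X Z) (t : ℕ)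
    (h : State K → (Fin K → ℝ) → (Fin K → Bool) → ℝ≥0∞)
    (hm : ∀ s, Measurable fun p : (Fin K → ℝ) × (Fin K → Bool) => h s p.1 p.2) :
    ∫⁻ ω, h (st ω t) (samples Z t (st ω t) ω) (fun i => X t i ω) ∂P =
      ∑' s, P {ω | st ω t = s} * ∫⁻ ω, h s (samples Z t s ω) (fun i => X t i ω) ∂P := by
  -- `I` collects the noise of past rounds, which determines the state; `J` collects the noise of
  -- round `t`.
  set I : Set ((ℕ × Fin K) ⊕ ((ℕ × Fin K) × (ℕ × ℕ))) :=
    {q | Sum.elim (fun p => p.1) (fun p => p.1.1) q < t}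
  set J : Set ((ℕ × Fin K) ⊕ ((ℕ × Fin K) × (ℕ × ℕ))) :=
    {q | Sum.elim (fun p => p.1) (fun p => p.1.1) q = t}
  have hIJ : Disjoint I J := by
    rw [Set.disjoint_left]
    exact fun q hI hJ => (ne_of_lt hI) hJ
  have hle : ∀ I' : Set ((ℕ × Fin K) ⊕ ((ℕ × Fin K) × (ℕ × ℕ))),
      (⨆ q ∈ I', noiseSigma X Z q) ≤ (inferInstance : MeasurableSpace Ω) := fun I' =>
    iSup₂_le fun q _ => noiseSigma_le hN q
  have hstI : Measurable[⨆ q ∈ I, noiseSigma X Z q] fun ω => st ω t :=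
    @measurable_state K θ Q W order Ω X Z hθ (⨆ q ∈ I, noiseSigma X Z q) t
      (fun s hs i => measurable_loss_of_mem hs) (fun s hs i a b => measurable_draw_of_mem hs)
  have hnow : ∀ s, Measurable[⨆ q ∈ J, noiseSigma X Z q]
      fun ω => h s (samples Z t s ω) (fun i => X t i ω) := fun s => by
    refine (hm s).comp (Measurable.prodMk ?_ ?_)
    · exact @measurable_samples K Ω Z (⨆ q ∈ J, noiseSigma X Z q) t
        (fun i a b => measurable_draw_of_mem rfl) s
    · exact @measurable_pi_lambda _ _ _ (⨆ q ∈ J, noiseSigma X Z q) _ _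
        fun i => measurable_loss_of_mem rfl
  have hst1 : ∀ s, Measurable[⨆ q ∈ I, noiseSigma X Z q] fun ω => ind (st ω t = s) := fun s =>
    (Measurable.of_discrete (f := fun r : State K => ind (r = s))).comp hstI
  have key : ∀ ω, h (st ω t) (samples Z t (st ω t) ω) (fun i => X t i ω) =
      ∑' s, ind (st ω t = s) * h s (samples Z t s ω) (fun i => X t i ω) := fun ω => by
    rw [tsum_eq_single (st ω t)]
    · rw [ind_of rfl, one_mul]
    · intro s hs
      rw [ind_of_not (Ne.symm hs), zero_mul]
  simp_rw [key]
  rw [lintegral_tsum]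
  · refine tsum_congr fun s => ?_
    rw [lintegral_mul_eq_lintegral_mul_lintegral_of_independent_measurableSpace (hle I) (hle J)
      (indep_noise hN hIJ) (hst1 s) (hnow s), lintegral_ind]
    exact measurable_st hθ hN t (measurableSet_singleton s)
  · intro s
    exact (((hst1 s).mono (hle I) le_rfl).mul ((hnow s).mono (hle J) le_rfl)).aemeasurable

/-- The expected sum of `h` over the first `T` rounds. -/
def occ (θ Q W : ℝ) (order : Equiv.Perm (Fin K)) (P : Measure Ω)
    (X : ℕ → Fin K → Ω → Bool) (Z : ℕ → Fin K → ℕ → ℕ → Ω → ℝ)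
    (T : ℕ) (h : State K → (Fin K → ℝ) → ℝ≥0∞) : ℝ≥0∞ :=
  ∑ t ∈ Finset.range T, ∫⁻ ω, h (state θ Q W order X Z ω t)
    (samples Z t (state θ Q W order X Z ω t) ω) ∂P

local notation "occ'" => occ θ Q W order P X Z

lemma measurable_occ_term (hθ : 0 < θ) (hN : IsNoise μ P X Z) (t : ℕ)
    {h : State K → (Fin K → ℝ) → ℝ≥0∞} (hm : ∀ s, Measurable (h s)) :
    Measurable fun ω => h (st ω t) (samples Z t (st ω t) ω) :=
  measurable_apply_countable (measurable_st hθ hN t)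
    (g := fun s ω => h s (samples Z t s ω)) fun s => (hm s).comp (measurable_samples_of hN t s)

/-- Inequalities between conditional expectations given the state. -/
lemma occ_le_occ (hθ : 0 < θ) (hN : IsNoise μ P X Z) (T : ℕ)
    {g h : State K → (Fin K → ℝ) → ℝ≥0∞} (hg : ∀ s, Measurable (g s)) (hh : ∀ s, Measurable (h s))
    (hle : ∀ t s, (∃ ω, st ω t = s) →
      ∫⁻ ω, g s (samples Z t s ω) ∂P ≤ ∫⁻ ω, h s (samples Z t s ω) ∂P) :
    occ' T g ≤ occ' T h := by
  refine Finset.sum_le_sum fun t _ => ?_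
  rw [lintegral_state hθ hN t (fun s z _ => g s z) (fun s => (hg s).comp measurable_fst),
    lintegral_state hθ hN t (fun s z _ => h s z) (fun s => (hh s).comp measurable_fst)]
  refine ENNReal.tsum_le_tsum fun s => ?_
  -- Only reachable states have positive probability, so invariants of the run may be used when
  -- comparing the conditional expectations.
  by_cases hs : ∃ ω, st ω t = s
  · exact mul_le_mul_right (hle t s hs) _
  · have : {ω | st ω t = s} = ∅ := by
      ext ω
      simp only [Set.mem_ofPred_eq, Set.mem_empty_iff_false, iff_false]
      exact fun h => hs ⟨ω, h⟩
    rw [this]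
    simp

lemma occ_mono {T : ℕ} {g h : State K → (Fin K → ℝ) → ℝ≥0∞}
    (hle : ∀ t ω, g (st ω t) (samples Z t (st ω t) ω) ≤ h (st ω t) (samples Z t (st ω t) ω)) :
    occ' T g ≤ occ' T h :=
  Finset.sum_le_sum fun t _ => lintegral_mono fun ω => hle t ω

lemma occ_add (hθ : 0 < θ) (hN : IsNoise μ P X Z) (T : ℕ)
    {g h : State K → (Fin K → ℝ) → ℝ≥0∞} (hg : ∀ s, Measurable (g s)) :
    occ' T (fun s z => g s z + h s z) = occ' T g + occ' T h := by
  rw [occ, occ, occ, ← Finset.sum_add_distrib]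
  exact Finset.sum_congr rfl fun t _ => lintegral_add_left (measurable_occ_term hθ hN t hg) _

lemma occ_const_mul (hθ : 0 < θ) (hN : IsNoise μ P X Z) (T : ℕ) (c : ℝ≥0∞)
    {h : State K → (Fin K → ℝ) → ℝ≥0∞} (hh : ∀ s, Measurable (h s)) :
    occ' T (fun s z => c * h s z) = c * occ' T h := by
  rw [occ, occ, Finset.mul_sum]
  exact Finset.sum_congr rfl fun t _ => lintegral_const_mul _ (measurable_occ_term hθ hN t hh)

lemma occ_sum (hθ : 0 < θ) (hN : IsNoise μ P X Z) (T : ℕ) {ι : Type*} (s : Finset ι)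
    {h : ι → State K → (Fin K → ℝ) → ℝ≥0∞} (hh : ∀ i s, Measurable (h i s)) :
    occ' T (fun r z => ∑ i ∈ s, h i r z) = ∑ i ∈ s, occ' T (h i) := by
  simp only [occ]
  rw [Finset.sum_comm]
  exact Finset.sum_congr rfl fun t _ =>
    lintegral_finsetSum _ fun i _ => measurable_occ_term hθ hN t (hh i)

/-- The loss of a round is independent of the decision to play the arm. -/
lemma measure_playEvent_inter (hθ : 0 < θ) (hN : IsNoise μ P X Z) (t : ℕ) (i : Fin K) (k f : ℕ)
    (b : Bool) : P (playEvent θ Q W order X Z t i k f ∩ {ω | X t i ω = b}) =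
      P (playEvent θ Q W order X Z t i k f) * P {ω | X t i ω = b} := by
  -- Draws of round `t` belong to `I`, losses of round `t` do not.
  set I : Set ((ℕ × Fin K) ⊕ ((ℕ × Fin K) × (ℕ × ℕ))) :=
    {q | Sum.elim (fun p => p.1 < t) (fun p => p.1.1 ≤ t) q}
  have hIJ : Disjoint I {Sum.inl (t, i)} := by
    rw [Set.disjoint_singleton_right]
    exact fun h => lt_irrefl t h
  refine (Indep_iff _ _ _).1 (indep_noise hN hIJ) _ _ ?_ ?_
  · exact @measurableSet_playEvent K θ Q W order Ω X Z (⨆ q ∈ I, noiseSigma X Z q) hθ t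
      (fun s hs i => measurable_loss_of_mem hs) (fun s hs i a b => measurable_draw_of_mem hs) i k f
  · exact measurable_loss_of_mem (I := {Sum.inl (t, i)}) rfl (measurableSet_singleton b)

lemma measure_loss_true (hN : IsNoise μ P X Z) (t : ℕ) (i : Fin K) :
    P {ω | X t i ω = true} = ENNReal.ofReal (μ i) := hN.prob_loss t i

lemma measure_loss_false [IsProbabilityMeasure P] (hN : IsNoise μ P X Z) (h0 : ∀ i, 0 ≤ μ i)
    (t : ℕ) (i : Fin K) : P {ω | X t i ω = false} = ENNReal.ofReal (1 - μ i) := by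
  have : {ω | X t i ω = false} = {ω | X t i ω = true}ᶜ := by ext; simp
  rw [this, prob_compl_eq_one_sub, hN.prob_loss, ENNReal.ofReal_sub _ (h0 i), ENNReal.ofReal_one]
  exact hN.measurable_loss t i (measurableSet_singleton true)

/-- The expected inflow into the counts `k`, `f` in round `t`. -/
def inflow (p : ℕ → ℕ → ℝ≥0∞) (m : ℝ) : ℕ → ℕ → ℝ≥0∞
  | 0, 0 => 0
  | k + 1, 0 => p k 0 * ENNReal.ofReal m
  | 0, f + 1 => p 0 f * ENNReal.ofReal (1 - m)
  | k + 1, f + 1 => p k (f + 1) * ENNReal.ofReal m + p (k + 1) f * ENNReal.ofReal (1 - m)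

/-- Balance of probability mass at a cell of counts: the mass after the round either stayed without
a play, or came from `(k - 1, f)` by a play with a loss, or from `(k, f - 1)` by a play without one.
Independence of loss and decision turns the last two into products. -/
lemma measure_count_succ [IsProbabilityMeasure P] (hθ : 0 < θ) (hN : IsNoise μ P X Z)
    (h0 : ∀ i, 0 ≤ μ i) (t : ℕ) (i : Fin K) (k f : ℕ) :
    P {ω | st ω (t + 1) ∈ countEvent i k f} + P (playEvent θ Q W order X Z t i k f) ≤
      P {ω | st ω t ∈ countEvent i k f} +
        inflow (fun k f => P (playEvent θ Q W order X Z t i k f)) (μ i) k f := by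
  set A := playEvent θ Q W order X Z t i with hA
  have hAm : ∀ k f, MeasurableSet (A k f) := fun k f =>
    measurableSet_playEvent hθ (fun _ _ _ => hN.measurable_loss _ _)
      (fun _ _ _ _ _ => hN.measurable_draw _ _ _ _) i k f
  have hsub : A k f ⊆ {ω | st ω t ∈ countEvent i k f} := fun ω hω => hω.1
  have hdiff : P ({ω | st ω t ∈ countEvent i k f} \ A k f) + P (A k f) =
      P {ω | st ω t ∈ countEvent i k f} := by
    rw [add_comm, ← measure_inter_add_sdiff {ω | st ω t ∈ countEvent i k f} (hAm k f),
      Set.inter_eq_right.2 hsub]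
  set B : Set Ω := {ω | 0 < k ∧ ω ∈ A (k - 1) f ∧ X t i ω = true} with hB
  set C : Set Ω := {ω | 0 < f ∧ ω ∈ A k (f - 1) ∧ X t i ω = false} with hC
  have hcover : {ω | st ω (t + 1) ∈ countEvent i k f} ⊆
      ({ω | st ω t ∈ countEvent i k f} \ A k f) ∪ (B ∪ C) := by
    intro ω hω
    simp only [Set.mem_ofPred_eq, countEvent] at hω
    rw [state_succ hθ, next_S, next_F] at hω
    obtain ⟨hp1, hp2⟩ := one_le_S_and_F (Q := Q) (W := W) (order := order) (X := X) (Z := Z)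
      hθ ω t i
    by_cases hpl : Played Q order i (st ω t) (samples Z t (st ω t) ω)
    · right
      cases hx : X t i ω
      · right
        simp only [hpl.1, hpl.2, hx, not_false_eq_true, and_true, if_true,
          Bool.false_eq_true, and_false, if_false] at hω
        refine ⟨by omega, ⟨⟨hω.1, ?_⟩, hpl⟩, hx⟩
        have := hω.2
        omega
      · left
        simp only [hpl.1, hpl.2, hx, not_false_eq_true, and_true, if_true,
          Bool.true_eq_false, and_false, if_false] at hω
        refine ⟨by omega, ⟨⟨?_, hω.2⟩, hpl⟩, hx⟩
        have := hω.1
        omega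
    · left
      have h1 : ∀ b, ¬ ((st ω t).i = (st ω t).u ∧
          i ∉ (st ω t).served Q order (samples Z t (st ω t) ω) ∧ X t i ω = b) :=
        fun b h => hpl ⟨h.1, h.2.1⟩
      rw [if_neg (h1 _), if_neg (h1 _)] at hω
      exact ⟨hω, fun h => hpl h.2⟩
  have hBC : P B + P C ≤ inflow (fun k f => P (A k f)) (μ i) k f := by
    have e1 : ∀ k f, P (A k f ∩ {ω | X t i ω = true}) = P (A k f) * ENNReal.ofReal (μ i) :=
      fun k f => by rw [hA, measure_playEvent_inter hθ hN, measure_loss_true hN]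
    have e2 : ∀ k f, P (A k f ∩ {ω | X t i ω = false}) = P (A k f) * ENNReal.ofReal (1 - μ i) :=
      fun k f => by rw [hA, measure_playEvent_inter hθ hN, measure_loss_false hN h0]
    have b1 : k = 0 → P B = 0 := fun h => by simp [hB, h]
    have b2 : ∀ k', k = k' + 1 → P B = P (A k' f) * ENNReal.ofReal (μ i) := fun k' h => by
      rw [← e1, hB, h]; congr 1; ext ω; simp
    have c1 : f = 0 → P C = 0 := fun h => by simp [hC, h]
    have c2 : ∀ f', f = f' + 1 → P C = P (A k f') * ENNReal.ofReal (1 - μ i) := fun f' h => by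
      rw [← e2, hC, h]; congr 1; ext ω; simp
    rcases k with _ | k <;> rcases f with _ | f
    · rw [b1 rfl, c1 rfl]; simp
    · rw [b1 rfl, c2 _ rfl]; simp [inflow]
    · rw [b2 _ rfl, c1 rfl]; simp [inflow]
    · rw [b2 _ rfl, c2 _ rfl]; simp [inflow]
  calc P {ω | st ω (t + 1) ∈ countEvent i k f} + P (A k f)
      ≤ (P ({ω | st ω t ∈ countEvent i k f} \ A k f) + (P B + P C)) + P (A k f) := by
        gcongr
        refine (measure_mono hcover).trans ((measure_union_le _ _).trans ?_)
        gcongr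
        exact measure_union_le _ _
    _ = P {ω | st ω t ∈ countEvent i k f} + (P B + P C) := by
        rw [← hdiff]; ring
    _ ≤ _ := by gcongr

/-- The counts of an arm evolve as for independent trials: each pair of counts is left by a play
with at most its binomial probability. -/
lemma sum_measure_playEvent_le [IsProbabilityMeasure P] (hθ : 0 < θ) (hN : IsNoise μ P X Z)
    (h0 : ∀ i, 0 ≤ μ i) (h1 : ∀ i, μ i ≤ 1) (i : Fin K) (T k f : ℕ) :
    P {ω | st ω T ∈ countEvent i k f} +
      ∑ t ∈ Finset.range T, P (playEvent θ Q W order X Z t i k f) ≤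
      ENNReal.ofReal (binom (μ i) k f) := by
  set v : ℕ → ℕ → ℕ → ℝ≥0∞ := fun T k f =>
    ∑ t ∈ Finset.range T, P (playEvent θ Q W order X Z t i k f) with hv
  -- The one-round balances telescope: present mass plus total outflow is at most initial mass plus
  -- total inflow.
  have flow : ∀ T k f, P {ω | st ω T ∈ countEvent i k f} + v T k f ≤
      P {ω | st ω 0 ∈ countEvent i k f} + inflow (v T) (μ i) k f := by
    intro T k f
    induction T with
    | zero => simp [hv]
    | succ T ih =>
      have e := measure_count_succ (Q := Q) (W := W) (order := order) hθ hN h0 T i k f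
      have hin : inflow (v (T + 1)) (μ i) k f = inflow (v T) (μ i) k f +
          inflow (fun k f => P (playEvent θ Q W order X Z T i k f)) (μ i) k f := by
        have : ∀ k f, v (T + 1) k f = v T k f + P (playEvent θ Q W order X Z T i k f) :=
          fun k f => Finset.sum_range_succ _ _
        rcases k with _ | k <;> rcases f with _ | f <;> simp only [inflow, this] <;> ring
      rw [hin]
      calc P {ω | st ω (T + 1) ∈ countEvent i k f} + v (T + 1) k f
          = (P {ω | st ω (T + 1) ∈ countEvent i k f} + P (playEvent θ Q W order X Z T i k f)) +
            v T k f := by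
            rw [show v (T + 1) k f = v T k f + P (playEvent θ Q W order X Z T i k f) from
              Finset.sum_range_succ _ _]
            ring
        _ ≤ (P {ω | st ω T ∈ countEvent i k f} +
            inflow (fun k f => P (playEvent θ Q W order X Z T i k f)) (μ i) k f) + v T k f := by
            gcongr
        _ = (P {ω | st ω T ∈ countEvent i k f} + v T k f) +
            inflow (fun k f => P (playEvent θ Q W order X Z T i k f)) (μ i) k f := by ring
        _ ≤ (P {ω | st ω 0 ∈ countEvent i k f} + inflow (v T) (μ i) k f) +
            inflow (fun k f => P (playEvent θ Q W order X Z T i k f)) (μ i) k f := by gcongr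
        _ = _ := by ring
  have start : ∀ k f, (k, f) ≠ (0, 0) → P {ω | st ω 0 ∈ countEvent i k f} = 0 := by
    intro k f hkf
    have : {ω | st ω 0 ∈ countEvent i k f} = ∅ := by
      ext ω
      simp only [countEvent, state, State.init, Set.mem_ofPred_eq, Set.mem_empty_iff_false, iff_false]
      rintro ⟨h1, h2⟩
      exact hkf (Prod.ext (by simpa using h1.symm) (by simpa using h2.symm))
    rw [this, measure_empty]
  have m1 : 0 ≤ 1 - μ i := by linarith [h1 i]
  -- Induction on `k + f`. The inflow of a cell comes from the previous diagonal, and Pascal's rule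
  -- for `binom` is exactly this recursion; only the cell `(0, 0)` has initial mass.
  suffices H : ∀ n k f, k + f = n → P {ω | st ω T ∈ countEvent i k f} + v T k f ≤
      ENNReal.ofReal (binom (μ i) k f) from H _ k f rfl
  intro n
  induction n with
  | zero =>
    intro k f hkf
    obtain ⟨rfl, rfl⟩ : k = 0 ∧ f = 0 := by omega
    refine (flow T 0 0).trans ?_
    simpa [inflow, binom_zero_zero] using prob_le_one
  | succ n ih =>
    intro k f hkf
    refine (flow T k f).trans ?_
    rw [start k f (by rintro h; cases h; omega), zero_add]
    have ih' : ∀ k f, k + f = n → v T k f ≤ ENNReal.ofReal (binom (μ i) k f) :=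
      fun k f h => le_add_self.trans (ih k f h)
    rcases k with _ | k <;> rcases f with _ | f
    · omega
    · rw [binom_zero_succ, ENNReal.ofReal_mul (binom_nonneg (h0 i) (h1 i) _ _)]
      exact mul_le_mul_left (ih' _ _ (by omega)) _
    · rw [binom_succ_zero, ENNReal.ofReal_mul (binom_nonneg (h0 i) (h1 i) _ _)]
      exact mul_le_mul_left (ih' _ _ (by omega)) _
    · rw [binom_succ_succ, ENNReal.ofReal_add
        (mul_nonneg (binom_nonneg (h0 i) (h1 i) _ _) (h0 i))
        (mul_nonneg (binom_nonneg (h0 i) (h1 i) _ _) m1),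
        ENNReal.ofReal_mul (binom_nonneg (h0 i) (h1 i) _ _),
        ENNReal.ofReal_mul (binom_nonneg (h0 i) (h1 i) _ _)]
      exact add_le_add (mul_le_mul_left (ih' _ _ (by omega)) _)
        (mul_le_mul_left (ih' _ _ (by omega)) _)

lemma eq_tsum_count (g : ℕ → ℕ → ℝ≥0∞) (i : Fin K) {s : State K} (hS : 1 ≤ s.S i)
    (hF : 1 ≤ s.F i) : g (s.S i) (s.F i) =
      ∑' p : ℕ × ℕ, ind (s ∈ countEvent i p.1 p.2) * g (p.1 + 1) (p.2 + 1) := by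
  rw [tsum_eq_single (s.S i - 1, s.F i - 1)]
  · rw [ind_of, one_mul, Nat.sub_add_cancel hS, Nat.sub_add_cancel hF]
    exact ⟨(Nat.sub_add_cancel hS).symm, (Nat.sub_add_cancel hF).symm⟩
  · intro p hp
    rw [ind_of_not, zero_mul]
    rintro ⟨h1, h2⟩
    exact hp (Prod.ext (by simp [h1]) (by simp [h2]))

/-- Sums over the plays of an arm are bounded by sums over all binomial weights. -/
lemma occ_played_le [IsProbabilityMeasure P] (hθ : 0 < θ) (hN : IsNoise μ P X Z)
    (h0 : ∀ i, 0 ≤ μ i) (h1 : ∀ i, μ i ≤ 1) (i : Fin K) (T : ℕ) (g : ℕ → ℕ → ℝ≥0∞) :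
    occ' T (fun s z => ind (Played Q order i s z) * g (s.S i) (s.F i)) ≤
      binomSum (μ i) fun k f => g (k + 1) (f + 1) := by
  have hAm : ∀ t k f, MeasurableSet (playEvent θ Q W order X Z t i k f) := fun t k f =>
    measurableSet_playEvent hθ (fun _ _ _ => hN.measurable_loss _ _)
      (fun _ _ _ _ _ => hN.measurable_draw _ _ _ _) i k f
  have key : ∀ t, ∫⁻ ω, ind (Played Q order i (st ω t) (samples Z t (st ω t) ω)) *
      g ((st ω t).S i) ((st ω t).F i) ∂P =
      ∑' p : ℕ × ℕ, P (playEvent θ Q W order X Z t i p.1 p.2) * g (p.1 + 1) (p.2 + 1) := by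
    intro t
    have : ∀ ω, ind (Played Q order i (st ω t) (samples Z t (st ω t) ω)) *
        g ((st ω t).S i) ((st ω t).F i) = ∑' p : ℕ × ℕ,
          ind (ω ∈ playEvent θ Q W order X Z t i p.1 p.2) * g (p.1 + 1) (p.2 + 1) := by
      intro ω
      obtain ⟨hS, hF⟩ := one_le_S_and_F (Q := Q) (W := W) (order := order) (X := X) (Z := Z)
        hθ ω t i
      rw [eq_tsum_count g i hS hF, ← ENNReal.tsum_mul_left]
      refine tsum_congr fun p => ?_
      rw [← mul_assoc, ← ind_and, and_comm]
      rfl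
    simp_rw [this]
    exact lintegral_tsum_ind fun p : ℕ × ℕ => hAm t p.1 p.2
  rw [occ, Finset.sum_congr rfl fun t _ => key t,
    ← Summable.tsum_finsetSum fun _ _ => ENNReal.summable]
  refine ENNReal.tsum_le_tsum fun p => ?_
  rw [← Finset.sum_mul]
  exact mul_le_mul_left (le_add_self.trans
    (sum_measure_playEvent_le hθ hN h0 h1 i T p.1 p.2)) _

/-- The counterpart of `occ_played_le` at a fixed time: the probability of finding given counts in
round `t` is also at most their binomial weight, although the number of observations is random. -/
lemma lintegral_count_le [IsProbabilityMeasure P] (hθ : 0 < θ) (hN : IsNoise μ P X Z)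
    (h0 : ∀ i, 0 ≤ μ i) (h1 : ∀ i, μ i ≤ 1) (i : Fin K) (t : ℕ) (g : ℕ → ℕ → ℝ≥0∞) :
    ∫⁻ ω, g ((st ω t).S i) ((st ω t).F i) ∂P ≤
      binomSum (μ i) fun k f => g (k + 1) (f + 1) := by
  have hAm : ∀ k f, MeasurableSet {ω | st ω t ∈ countEvent i k f} := fun k f =>
    measurable_st hθ hN t (MeasurableSet.of_discrete (s := countEvent i k f))
  have : ∀ ω, g ((st ω t).S i) ((st ω t).F i) = ∑' p : ℕ × ℕ,
      ind (st ω t ∈ countEvent i p.1 p.2) * g (p.1 + 1) (p.2 + 1) := fun ω => by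
    obtain ⟨hS, hF⟩ := one_le_S_and_F (Q := Q) (W := W) (order := order) (X := X) (Z := Z)
      hθ ω t i
    exact eq_tsum_count g i hS hF
  simp_rw [this]
  refine (lintegral_tsum_ind fun p : ℕ × ℕ => hAm p.1 p.2).trans_le
    (ENNReal.tsum_le_tsum fun p => ?_)
  exact mul_le_mul_left (le_self_add.trans
    (sum_measure_playEvent_le hθ hN h0 h1 i t p.1 p.2)) _

end Run

/-! ### Misleading observations -/

/-- After `k` losses and `f` non-losses, an arm with mean `m` has been observed fewer than `n` times
or has an empirical mean off by `δ`. -/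
def Misled (m δ n : ℝ) (k f : ℕ) : Prop :=
  ((k + f : ℕ) : ℝ) < n ∨ (k + f : ℕ) * δ ≤ |k - (k + f : ℕ) * m|

/-- A bound for the expected number of plays of a misled arm. -/
def misledBound (δ n : ℝ) : ℝ≥0∞ := ENNReal.ofReal (n + 1) + ENNReal.ofReal (2 * (1 + 4 / δ ^ 2))

/-- A bound for the posterior probability of a deviation by `δ` after `n` observations. -/
def deviation (δ n : ℝ) : ℝ := Real.exp (-(n * δ ^ 2 / 8)) * (2 * (1 + 8 / δ ^ 2))

lemma misledBound_ne_top (δ n : ℝ) : misledBound δ n ≠ ∞ :=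
  ENNReal.add_ne_top.2 ⟨ENNReal.ofReal_ne_top, ENNReal.ofReal_ne_top⟩

lemma deviation_nonneg (δ n : ℝ) : 0 ≤ deviation δ n := by unfold deviation; positivity

lemma binomSum_misled_le {m δ n : ℝ} (h0 : 0 ≤ m) (h1 : m ≤ 1) (hδ : 0 < δ) (hδ1 : δ ≤ 1)
    (hn : 0 ≤ n) : binomSum m (fun k f => ind (Misled m δ n k f)) ≤ misledBound δ n := by
  refine le_trans ?_ (add_le_add (binomSum_lt_le h0 h1 hn) (binomSum_tail_le h0 h1 hδ hδ1))
  rw [← binomSum_add]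
  refine binomSum_mono fun k f => (ind_le_add (fun h => h)).trans (le_of_eq ?_)
  unfold ind
  congr

lemma succ_mul_exp_le {a : ℝ} (ha : 0 < a) (n : ℕ) :
    ((n + 1 : ℕ) : ℝ) * Real.exp (-(n * a)) ≤ 1 + 1 / a := by
  have e1 : (n : ℝ) * a + 1 ≤ Real.exp (n * a) := Real.add_one_le_exp _
  rw [Real.exp_neg, ← div_eq_mul_inv, div_le_iff₀ (Real.exp_pos _)]
  push_cast
  have e2 : (1 + 1 / a) * (n * a + 1) = n * a + 1 + n + 1 / a := by
    field_simp
    ring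
  have e3 : 0 < 1 / a := by positivity
  have e4 : 0 ≤ (n : ℝ) * a := by positivity
  nlinarith [mul_le_mul_of_nonneg_left e1 (by linarith : 0 ≤ 1 + 1 / a)]

/-- Half of the exponent absorbs the factor `n + 1` from the Beta density; the other half gives the
decay in `s`. -/
lemma concentration_le_deviation {δ s : ℝ} (hδ : 0 < δ) {n : ℕ} (hs : s ≤ n) :
    ((n + 1 : ℕ) : ℝ) * (2 * Real.exp (-(n * δ ^ 2 / 4))) ≤ deviation δ s := by
  have e1 := succ_mul_exp_le (a := δ ^ 2 / 8) (by positivity) n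
  rw [one_div_div] at e1
  have e2 : Real.exp (-(n * δ ^ 2 / 4)) =
      Real.exp (-(n * (δ ^ 2 / 8))) * Real.exp (-(n * δ ^ 2 / 8)) := by
    rw [← Real.exp_add]; ring_nf
  have e3 : Real.exp (-(n * δ ^ 2 / 8)) ≤ Real.exp (-(s * δ ^ 2 / 8)) := by gcongr
  rw [e2, deviation]
  calc _ = Real.exp (-(n * δ ^ 2 / 8)) *
        (2 * (((n + 1 : ℕ) : ℝ) * Real.exp (-(n * (δ ^ 2 / 8))))) := by ring
    _ ≤ _ := by gcongr

/-- The empirical mean is within `δ` of `m`, so every `u ≤ y ≤ m - 2 δ` is at distance at least `δ`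
from it. -/
lemma betaMeasure_Iic_le_deviation {m δ n y : ℝ} (hδ : 0 < δ) (hδ1 : δ ≤ 1) (hy : y + 2 * δ ≤ m)
    {k f : ℕ} (h : ¬ Misled m δ n k f) :
    betaMeasure ((k + 1 : ℕ) : ℝ) ((f + 1 : ℕ) : ℝ) (Set.Iic y) ≤
      ENNReal.ofReal (deviation δ n) := by
  simp only [Misled, not_or, not_lt, not_le] at h
  refine (betaMeasure_le_exp measurableSet_Iic hδ.le hδ1 fun u hu => ?_).trans
    (ENNReal.ofReal_le_ofReal (concentration_le_deviation hδ h.1))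
  refine le_trans ?_ (le_abs_self _)
  have e1 := (abs_lt.1 h.2).1
  have e2 : ((k + f : ℕ) : ℝ) * u ≤ (k + f : ℕ) * (m - 2 * δ) :=
    mul_le_mul_of_nonneg_left (by have : u ≤ y := hu
                                  linarith) (Nat.cast_nonneg _)
  linarith

/-! ### Rounds of the regret minimization phase with a correct threshold estimate -/

/-- The threshold search has ended with an estimate that is as good as the threshold. -/
def Good {K : ℕ} (θ Q : ℝ) (M : ℕ) (s : State K) : Prop :=
  s.i = s.u ∧ s.numServed Q = M ∧ θ ≤ s.threshold Q

/-- The number of observations of arm `i`. -/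
def State.obs {K : ℕ} (s : State K) (i : Fin K) : ℕ := (s.S i - 1) + (s.F i - 1)

/-- Arm `i` is misled in state `s`. -/
def State.Misled {K : ℕ} (s : State K) (μ : Fin K → ℝ) (δ n : ℝ) (i : Fin K) : Prop :=
  CSB.Misled (μ i) δ n (s.S i - 1) (s.F i - 1)

section Run

variable {K : ℕ} {θ Q W : ℝ} {order : Equiv.Perm (Fin K)} {Ω : Type*}
  {X : ℕ → Fin K → Ω → Bool} {Z : ℕ → Fin K → ℕ → ℕ → Ω → ℝ}

lemma Good.played_iff {M : ℕ} {O : Finset (Fin K)} (hO : K - M = O.card) {s : State K}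
    (hs : Good θ Q M s) (i : Fin K) (z : Fin K → ℝ) :
    Played Q order i s z ↔ i ∈ smallest order O.card z := by
  simp [Played, State.served, hs.1, hs.2.1, hO]

lemma exists_of_state (hθ : 0 < θ) {t : ℕ} {s : State K} (h : ∃ ω, state θ Q W order X Z ω t = s) (i : Fin K) :
    1 ≤ s.S i ∧ 1 ≤ s.F i := by
  obtain ⟨ω, rfl⟩ := h
  exact one_le_S_and_F hθ ω t i

variable [MeasurableSpace Ω] {P : Measure Ω} {μ : Fin K → ℝ} {M : ℕ} {O : Finset (Fin K)}

local notation "st" => state θ Q W order X Z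
local notation "occ'" => occ θ Q W order P X Z

lemma lintegral_played (hN : IsNoise μ P X Z) (hO : K - M = O.card) {s : State K}
    (hs : Good θ Q M s) (t : ℕ) (i : Fin K) :
    ∫⁻ ω, ind (Played Q order i s (samples Z t s ω)) ∂P =
      P {ω | i ∈ smallest order O.card fun k => samples Z t s ω k} := by
  simp only [hs.played_iff hO]
  exact lintegral_ind (measurableSet_mem_smallest order _ i (measurable_samples_of hN t s))

lemma measurable_ind_played (i : Fin K) (s : State K) :
    Measurable fun z => ind (Played Q order i s z) :=
  measurable_ind (measurableSet_played s i)

lemma measurableSet_sample_le (j : Fin K) (y : ℝ) :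
    MeasurableSet {z : Fin K → ℝ | z j ≤ y} :=
  measurableSet_le (measurable_pi_apply j) measurable_const

lemma measurableSet_lt_sample (j : Fin K) (y : ℝ) :
    MeasurableSet {z : Fin K → ℝ | y < z j} :=
  measurableSet_lt measurable_const (measurable_pi_apply j)

lemma occ_misled_le [IsProbabilityMeasure P] (hθ : 0 < θ) (hN : IsNoise μ P X Z)
    (h0 : ∀ i, 0 ≤ μ i) (h1 : ∀ i, μ i ≤ 1) {δ n : ℝ} (hδ : 0 < δ) (hδ1 : δ ≤ 1) (hn : 0 ≤ n)
    (i : Fin K) (T : ℕ) :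
    occ' T (fun s z => ind (Played Q order i s z) * ind (s.Misled μ δ n i)) ≤ misledBound δ n :=
  (occ_played_le hθ hN h0 h1 i T fun a b => ind (Misled (μ i) δ n (a - 1) (b - 1))).trans
    (binomSum_misled_le (h0 i) (h1 i) hδ hδ1 hn)

lemma occ_obs_lt_le [IsProbabilityMeasure P] (hθ : 0 < θ) (hN : IsNoise μ P X Z)
    (h0 : ∀ i, 0 ≤ μ i) (h1 : ∀ i, μ i ≤ 1) {n : ℝ} (hn : 0 ≤ n) (i : Fin K) (T : ℕ) :
    occ' T (fun s z => ind (Played Q order i s z) * ind ((s.obs i : ℝ) < n)) ≤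
      ENNReal.ofReal (n + 1) := by
  refine (occ_played_le hθ hN h0 h1 i T
    fun a b => ind (((a - 1 + (b - 1) : ℕ) : ℝ) < n)).trans (le_trans ?_
      (binomSum_lt_le (h0 i) (h1 i) hn))
  refine binomSum_mono fun k f => le_of_eq ?_
  unfold ind
  congr

lemma measure_sample_le_deviation [IsProbabilityMeasure P] (hN : IsNoise μ P X Z) {δ n y : ℝ}
    (hδ : 0 < δ) (hδ1 : δ ≤ 1) {i : Fin K} (hy : y + 2 * δ ≤ μ i) {s : State K} (t : ℕ)
    (hS : 1 ≤ s.S i) (hF : 1 ≤ s.F i) (h : ¬ s.Misled μ δ n i) :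
    P {ω | samples Z t s ω i ≤ y} ≤ ENNReal.ofReal (deviation δ n) := by
  have := measure_samples hN t hS hF (measurableSet_Iic (a := y))
  rw [show {ω | samples Z t s ω i ≤ y} = {ω | samples Z t s ω i ∈ Set.Iic y} from rfl, this]
  have := betaMeasure_Iic_le_deviation hδ hδ1 hy h
  rwa [Nat.sub_add_cancel hS, Nat.sub_add_cancel hF] at this

/-- The constants of the analysis: `y` separates the means of the optimal arms from the others with
margin `2 * δ`. -/
structure Separated (μ : Fin K → ℝ) (O : Finset (Fin K)) (y δ : ℝ) : Prop where
  pos : ∀ i, 0 < μ i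
  le_one : ∀ i, μ i ≤ 1
  lt_of_mem : ∀ j ∈ O, μ j < y
  lt_one : y < 1
  delta_pos : 0 < δ
  delta_le_one : δ ≤ 1
  le_of_notMem : ∀ i ∉ O, y + 2 * δ ≤ μ i

/-- A bound for the expected number of rounds in which an optimal arm has a large sample. -/
def unluckyBound (μ : Fin K → ℝ) (y δ n : ℝ) (j : Fin K) : ℝ≥0∞ :=
  2 * (K * misledBound δ n) + 2 * binomSum (μ j) (fun k f => odds y (k + 1) (f + 1))

open Classical in
/-- The suboptimal arms which are not misled. -/
def reliable (μ : Fin K → ℝ) (O : Finset (Fin K)) (δ n : ℝ) (s : State K) : Finset (Fin K) :=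
  Oᶜ.filter fun i => ¬ s.Misled μ δ n i

lemma sum_sdiff_reliable_le {δ n : ℝ} {s : State K} {h : Fin K → ℝ≥0∞} :
    ∑ i ∈ Oᶜ \ reliable μ O δ n s, h i ≤ ∑ i ∈ Oᶜ, h i * ind (s.Misled μ δ n i) := by
  classical
  have : ∀ i ∈ Oᶜ \ reliable μ O δ n s, h i = h i * ind (s.Misled μ δ n i) := by
    intro i hi
    rw [Finset.mem_sdiff, reliable, Finset.mem_filter] at hi
    have : s.Misled μ δ n i := by
      by_contra hcon
      exact hi.2 ⟨hi.1, hcon⟩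
    rw [ind_of this, mul_one]
  rw [Finset.sum_congr rfl this]
  exact Finset.sum_le_sum_of_subset Finset.sdiff_subset

lemma disjoint_reliable {δ n : ℝ} {s : State K} : Disjoint O (reliable μ O δ n s) := by
  classical
  rw [Finset.disjoint_left]
  intro i hi hi'
  exact (Finset.mem_compl.1 (Finset.mem_filter.1 hi').1) hi

lemma measure_reliable_le [IsProbabilityMeasure P] (hN : IsNoise μ P X Z) {y δ n : ℝ}
    (hsep : Separated μ O y δ) {s : State K} (t : ℕ) (hSF : ∀ i, 1 ≤ s.S i ∧ 1 ≤ s.F i)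
    {c : ℝ≥0∞} (hn : ENNReal.ofReal (deviation δ n) ≤ c) :
    ∀ i ∈ reliable μ O δ n s, P {ω | samples Z t s ω i ≤ y} ≤ c := by
  classical
  intro i hi
  obtain ⟨hiO, hi⟩ := Finset.mem_filter.1 hi
  exact (measure_sample_le_deviation hN hsep.delta_pos hsep.delta_le_one
    (hsep.le_of_notMem i (Finset.mem_compl.1 hiO)) t (hSF i).1 (hSF i).2 hi).trans hn

lemma occ_sum_misled_le [IsProbabilityMeasure P] (hθ : 0 < θ) (hN : IsNoise μ P X Z) {y δ n : ℝ}
    (hsep : Separated μ O y δ) (hn0 : 0 ≤ n) (T : ℕ) :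
    occ' T (fun s z => ∑ i ∈ Oᶜ, ind (Played Q order i s z) * ind (s.Misled μ δ n i)) ≤
      K * misledBound δ n := by
  rw [occ_sum hθ hN T _ fun i s => (measurable_ind_played i s).mul_const _]
  refine (Finset.sum_le_sum fun i _ => occ_misled_le hθ hN (fun i => (hsep.pos i).le) hsep.le_one
    hsep.delta_pos hsep.delta_le_one hn0 i T).trans ?_
  rw [Finset.sum_const, nsmul_eq_mul]
  gcongr
  simpa using Finset.card_le_univ Oᶜ

/-- The expected number of rounds in which an optimal arm has a large sample is bounded. -/
lemma occ_lt_sample_le [IsProbabilityMeasure P] (hθ : 0 < θ) (hN : IsNoise μ P X Z)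
    (hO : K - M = O.card) {y δ n : ℝ} (hsep : Separated μ O y δ) (hn0 : 0 ≤ n)
    (hn : ENNReal.ofReal (deviation δ n) ≤ 1 / (2 * K)) {j : Fin K} (hj : j ∈ O) (T : ℕ) :
    occ' T (fun s z => ind (Good θ Q M s ∧ y < z j)) ≤ unluckyBound μ y δ n j := by
  have hmis : ∀ s, Measurable fun z : Fin K → ℝ =>
      ∑ i ∈ Oᶜ, ind (Played Q order i s z) * ind (s.Misled μ δ n i) := fun s =>
    Finset.measurable_sum _ fun i _ => (measurable_ind_played i s).mul_const _
  have hodds : ∀ s : State K, Measurable fun z : Fin K → ℝ =>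
      ind (Played Q order j s z) * odds y (s.S j) (s.F j) := fun s =>
    (measurable_ind_played j s).mul_const _
  calc occ' T (fun s z => ind (Good θ Q M s ∧ y < z j))
      ≤ occ' T (fun s z =>
          2 * ∑ i ∈ Oᶜ, ind (Played Q order i s z) * ind (s.Misled μ δ n i) +
          2 * (ind (Played Q order j s z) * odds y (s.S j) (s.F j))) := by
        refine occ_le_occ hθ hN T
          (fun s => measurable_ind ((MeasurableSet.const _).inter (measurableSet_lt_sample j y)))
          (fun s => ((hmis s).const_mul _).add ((hodds s).const_mul _)) fun t s hs => ?_
        have hSF := exists_of_state hθ hs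
        by_cases hg : Good θ Q M s
        swap
        · simp only [hg, false_and, ind_of_not not_false, lintegral_zero]; exact zero_le
        have hz := measurable_samples_of hN t s
        have hP : ∀ i, Measurable fun ω => ind (Played Q order i s (samples Z t s ω)) :=
          fun i => (measurable_ind_played i s).comp hz
        simp only [hg, true_and]
        rw [lintegral_ind (p := fun ω => y < samples Z t s ω j) (hz (measurableSet_lt_sample j y)),
          lintegral_add_left ((Finset.measurable_sum _ fun i _ => (hP i).mul_const _).const_mul _),
          lintegral_const_mul _ (Finset.measurable_sum _ fun i _ => (hP i).mul_const _),
          lintegral_const_mul _ ((hP j).mul_const _),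
          lintegral_finsetSum _ fun i _ => (hP i).mul_const _,
          lintegral_mul_const _ (hP j), lintegral_played hN hO hg]
        have hle : P {ω | samples Z t s ω j ≤ y} =
            betaMeasure (s.S j : ℝ) (s.F j : ℝ) (Set.Iic y) :=
          measure_samples hN t (hSF j).1 (hSF j).2 measurableSet_Iic
        have hlt : P {ω | y < samples Z t s ω j} =
            betaMeasure (s.S j : ℝ) (s.F j : ℝ) (Set.Ioi y) :=
          measure_samples hN t (hSF j).1 (hSF j).2 measurableSet_Ioi
        have hy0 : 0 < y := (hsep.pos j).trans (hsep.lt_of_mem j hj)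
        have hpos : P {ω | samples Z t s ω j ≤ y} ≠ 0 := by
          rw [hle]
          have := betaMeasure_Iic_pos hy0 hsep.lt_one (s.S j - 1) (s.F j - 1)
          rw [Nat.sub_add_cancel (hSF j).1, Nat.sub_add_cancel (hSF j).2] at this
          exact this.ne'
        refine (measure_lt_le_add_odds order (iIndepFun_samples hN t s)
          (fun i => (measurable_pi_apply i).comp hz) O (reliable μ O δ n s) disjoint_reliable hj
          (measure_reliable_le hN hsep t hSF hn) hpos).trans ?_
        refine add_le_add (mul_le_mul_right ?_ _) (mul_le_mul_right ?_ _)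
        · refine sum_sdiff_reliable_le.trans (Finset.sum_le_sum fun i _ => ?_)
          rw [lintegral_mul_const _ (hP i), lintegral_played hN hO hg]
        · rw [hle, hlt, mul_comm]
          rfl
    _ = 2 * occ' T (fun s z =>
          ∑ i ∈ Oᶜ, ind (Played Q order i s z) * ind (s.Misled μ δ n i)) +
        2 * occ' T (fun s z => ind (Played Q order j s z) * odds y (s.S j) (s.F j)) := by
        rw [occ_add hθ hN T fun s => (hmis s).const_mul _, occ_const_mul hθ hN T _ hmis,
          occ_const_mul hθ hN T _ hodds]
    _ ≤ _ := by
        refine add_le_add (mul_le_mul_right (occ_sum_misled_le hθ hN hsep hn0 T) _)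
          (mul_le_mul_right ?_ _)
        exact occ_played_le hθ hN (fun i => (hsep.pos i).le) hsep.le_one j T (odds y)

/-- A bound for the expected number of rounds before an optimal arm has `r` observations. -/
def waitBound (μ : Fin K → ℝ) (y δ n r : ℝ) (j : Fin K) : ℝ≥0∞ :=
  unluckyBound μ y δ n j + (2 * ENNReal.ofReal (r + 1) + 2 * (K * misledBound δ n))

/-- While arm `j` has few observations, either its sample is large, which happens boundedly often,
or with conditional weight at least `1 / 2` the arm itself or a misled suboptimal arm is played. The
former uses up one of its first `r` observations; the latter is bounded by `misledBound`. -/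
lemma occ_obs_lt_optimal_le [IsProbabilityMeasure P] (hθ : 0 < θ) (hN : IsNoise μ P X Z)
    (hO : K - M = O.card) {y δ n r : ℝ} (hsep : Separated μ O y δ) (hn0 : 0 ≤ n)
    (hn : ENNReal.ofReal (deviation δ n) ≤ 1 / (2 * K)) (hr : 0 ≤ r) {j : Fin K} (hj : j ∈ O)
    (T : ℕ) :
    occ' T (fun s _ => ind (Good θ Q M s ∧ (s.obs j : ℝ) < r)) ≤ waitBound μ y δ n r j := by
  have hmis : ∀ s, Measurable fun z : Fin K → ℝ =>
      ∑ i ∈ Oᶜ, ind (Played Q order i s z) * ind (s.Misled μ δ n i) := fun s =>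
    Finset.measurable_sum _ fun i _ => (measurable_ind_played i s).mul_const _
  have hobs : ∀ s : State K, Measurable fun z : Fin K → ℝ =>
      ind (Played Q order j s z) * ind ((s.obs j : ℝ) < r) := fun s =>
    (measurable_ind_played j s).mul_const _
  have hsmall : ∀ s : State K, Measurable fun z : Fin K → ℝ =>
      ind ((Good θ Q M s ∧ (s.obs j : ℝ) < r) ∧ z j ≤ y) := fun s =>
    measurable_ind ((MeasurableSet.const _).inter (measurableSet_sample_le j y))
  have hlarge : ∀ s : State K, Measurable fun z : Fin K → ℝ =>
      ind (Good θ Q M s ∧ y < z j) := fun s =>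
    measurable_ind ((MeasurableSet.const _).inter (measurableSet_lt_sample j y))
  calc occ' T (fun s _ => ind (Good θ Q M s ∧ (s.obs j : ℝ) < r))
      ≤ occ' T (fun s z => ind (Good θ Q M s ∧ y < z j) +
          ind ((Good θ Q M s ∧ (s.obs j : ℝ) < r) ∧ z j ≤ y)) := by
        refine occ_mono fun t ω => ind_le_add fun h => ?_
        rcases lt_or_ge y (samples Z t (st ω t) ω j) with h' | h'
        exacts [Or.inl ⟨h.1, h'⟩, Or.inr ⟨h, h'⟩]
    _ = occ' T (fun s z => ind (Good θ Q M s ∧ y < z j)) +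
        occ' T (fun s z => ind ((Good θ Q M s ∧ (s.obs j : ℝ) < r) ∧ z j ≤ y)) :=
        occ_add hθ hN T hlarge
    _ ≤ unluckyBound μ y δ n j + occ' T (fun s z =>
          2 * (ind (Played Q order j s z) * ind ((s.obs j : ℝ) < r)) +
          2 * ∑ i ∈ Oᶜ, ind (Played Q order i s z) * ind (s.Misled μ δ n i)) := by
        refine add_le_add (occ_lt_sample_le hθ hN hO hsep hn0 hn hj T)
          (occ_le_occ hθ hN T hsmall
          (fun s => ((hobs s).const_mul _).add ((hmis s).const_mul _)) fun t s hs => ?_)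
        have hSF := exists_of_state hθ hs
        by_cases hg : Good θ Q M s ∧ (s.obs j : ℝ) < r
        swap
        · simp only [hg, false_and, ind_of_not not_false, lintegral_zero]; exact zero_le
        have hz := measurable_samples_of hN t s
        have hP : ∀ i, Measurable fun ω => ind (Played Q order i s (samples Z t s ω)) :=
          fun i => (measurable_ind_played i s).comp hz
        simp only [hg.1, hg.2, true_and]
        rw [lintegral_ind (p := fun ω => samples Z t s ω j ≤ y) (hz (measurableSet_sample_le j y)),
          lintegral_add_left (((hP j).mul_const _).const_mul _),
          lintegral_const_mul _ ((hP j).mul_const _),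
          lintegral_const_mul _ (Finset.measurable_sum _ fun i _ => (hP i).mul_const _),
          lintegral_finsetSum _ fun i _ => (hP i).mul_const _,
          lintegral_mul_const _ (hP j), lintegral_played hN hO hg.1,
          ind_of trivial, mul_one]
        refine (measure_le_le_add order (iIndepFun_samples hN t s)
          (fun i => (measurable_pi_apply i).comp hz) O (reliable μ O δ n s) disjoint_reliable hj
          (measure_reliable_le hN hsep t hSF hn)).trans ?_
        refine add_le_add le_rfl (mul_le_mul_right ?_ _)
        refine sum_sdiff_reliable_le.trans (Finset.sum_le_sum fun i _ => ?_)
        rw [lintegral_mul_const _ (hP i), lintegral_played hN hO hg.1]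
    _ ≤ _ := by
        refine add_le_add le_rfl ?_
        rw [occ_add hθ hN T fun s => (hobs s).const_mul _, occ_const_mul hθ hN T _ hmis,
          occ_const_mul hθ hN T _ hobs]
        exact add_le_add (mul_le_mul_right (occ_obs_lt_le hθ hN (fun i => (hsep.pos i).le)
          hsep.le_one hr j T) _) (mul_le_mul_right (occ_sum_misled_le hθ hN hsep hn0 T) _)

/-- Few plays of a suboptimal arm happen while an optimal arm has few observations. -/
lemma occ_played_obs_lt_le [IsProbabilityMeasure P] (hθ : 0 < θ) (hN : IsNoise μ P X Z)
    (hO : K - M = O.card) {y δ n r : ℝ} (hsep : Separated μ O y δ) (hn0 : 0 ≤ n)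
    (hn : ENNReal.ofReal (deviation δ n) ≤ 1 / (2 * K)) (hr : 0 ≤ r) {j : Fin K} (hj : j ∈ O)
    {i : Fin K} (hi : i ∉ O) {n' : ℝ} (hn' : 0 ≤ n') (T : ℕ) :
    occ' T (fun s z => ind (Good θ Q M s ∧ (s.obs j : ℝ) < r ∧ Played Q order i s z)) ≤
      ∑ j' ∈ O, unluckyBound μ y δ n j' + (misledBound δ n' +
        ENNReal.ofReal (deviation δ n') * waitBound μ y δ n r j) := by
  have hlarge : ∀ j' (s : State K), Measurable fun z : Fin K → ℝ =>
      ind (Good θ Q M s ∧ y < z j') := fun j' s =>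
    measurable_ind ((MeasurableSet.const _).inter (measurableSet_lt_sample j' y))
  have hmis : ∀ s : State K, Measurable fun z : Fin K → ℝ =>
      ind (Played Q order i s z) * ind (s.Misled μ δ n' i) := fun s =>
    (measurable_ind_played i s).mul_const _
  have hrare : ∀ s : State K, Measurable fun z : Fin K → ℝ =>
      ind ((Good θ Q M s ∧ (s.obs j : ℝ) < r ∧ ¬ s.Misled μ δ n' i) ∧ z i ≤ y) := fun s =>
    measurable_ind ((MeasurableSet.const _).inter (measurableSet_sample_le i y))
  calc occ' T (fun s z => ind (Good θ Q M s ∧ (s.obs j : ℝ) < r ∧ Played Q order i s z))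
      ≤ occ' T (fun s z => ∑ j' ∈ O, ind (Good θ Q M s ∧ y < z j') +
          (ind (Played Q order i s z) * ind (s.Misled μ δ n' i) +
          ind ((Good θ Q M s ∧ (s.obs j : ℝ) < r ∧ ¬ s.Misled μ δ n' i) ∧ z i ≤ y))) := by
        refine occ_mono fun t ω => ?_
        generalize st ω t = s
        generalize samples Z t s ω = z
        by_cases h : ∃ j' ∈ O, y < z j'
        · refine le_trans ?_ le_self_add
          exact ind_le_sum fun hg => by
            obtain ⟨j', hj', h⟩ := h
            exact ⟨j', hj', hg.1, h⟩
        · refine le_trans ?_ le_add_self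
          rw [← ind_and]
          refine ind_le_add fun hg => ?_
          by_cases hm : s.Misled μ δ n' i
          · exact Or.inl ⟨hg.2.2, hm⟩
          · refine Or.inr ⟨⟨hg.1, hg.2.1, hm⟩, ?_⟩
            -- A selected suboptimal arm displaces some optimal arm, and its sample is no larger
            -- than the displaced one; hence it is at most `y`.
            have hiS := (hg.1.played_iff (order := order) hO i z).1 hg.2.2
            obtain ⟨j', hj'O, hj'⟩ := exists_notMem_smallest hi hiS
            push Not at h
            exact (le_of_mem_of_notMem_smallest order hiS hj').trans (h j' hj'O)
    _ = ∑ j' ∈ O, occ' T (fun s z => ind (Good θ Q M s ∧ y < z j')) +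
          (occ' T (fun s z => ind (Played Q order i s z) * ind (s.Misled μ δ n' i)) +
          occ' T (fun s z => ind ((Good θ Q M s ∧ (s.obs j : ℝ) < r ∧ ¬ s.Misled μ δ n' i) ∧
            z i ≤ y))) := by
        rw [occ_add hθ hN T fun s => Finset.measurable_sum _ fun j' _ => hlarge j' s,
          occ_add hθ hN T hmis, occ_sum hθ hN T _ hlarge]
    _ ≤ _ := by
        refine add_le_add (Finset.sum_le_sum fun j' hj' =>
          occ_lt_sample_le hθ hN hO hsep hn0 hn hj' T) (add_le_add
          (occ_misled_le hθ hN (fun i => (hsep.pos i).le) hsep.le_one hsep.delta_pos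
            hsep.delta_le_one hn' i T) ?_)
        -- In each waiting round a suboptimal arm that is not misled has a sample at most `y` with
        -- conditional probability at most `deviation δ n'`. The long waiting time thus enters only
        -- multiplied by an exponentially small factor.
        refine le_trans ?_ (mul_le_mul_right
          (occ_obs_lt_optimal_le (Q := Q) (W := W) (order := order) hθ hN hO hsep hn0 hn hr hj T) _)
        rw [← occ_const_mul hθ hN T _ fun s => measurable_const]
        refine occ_le_occ hθ hN T hrare (fun s => measurable_const) fun t s hs => ?_
        have hSF := exists_of_state hθ hs
        by_cases hg : Good θ Q M s ∧ (s.obs j : ℝ) < r ∧ ¬ s.Misled μ δ n' i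
        swap
        · simp only [hg, false_and, ind_of_not not_false, lintegral_zero]; exact zero_le
        have hz := measurable_samples_of hN t s
        simp only [hg.1, hg.2.1, hg.2.2, true_and, not_false_eq_true, ind_of trivial, mul_one,
          lintegral_const, measure_univ]
        rw [lintegral_ind (p := fun ω => samples Z t s ω i ≤ y) (hz (measurableSet_sample_le i y))]
        exact measure_sample_le_deviation hN hsep.delta_pos hsep.delta_le_one
          (hsep.le_of_notMem i hi) t (hSF i).1 (hSF i).2 hg.2.2

/-- Two suboptimal arms rarely have small samples at once. -/
lemma occ_two_le [IsProbabilityMeasure P] (hθ : 0 < θ) (hN : IsNoise μ P X Z)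
    (hO : K - M = O.card) {y δ : ℝ} (hsep : Separated μ O y δ)
    {i i' : Fin K} (hi' : i' ∉ O) (hne : i ≠ i') {n' : ℝ} (hn' : 0 ≤ n')
    (hhalf : ENNReal.ofReal (deviation δ n') ≤ 1 / 2) (T : ℕ) :
    occ' T (fun s z => ind (Good θ Q M s ∧ Played Q order i s z ∧ Played Q order i' s z ∧
      z i ≤ y ∧ z i' ≤ y)) ≤ misledBound δ n' + 2 * (ENNReal.ofReal (deviation δ n') *
        occ' T (fun s z => ind (Good θ Q M s ∧ Played Q order i s z))) := by
  have hmis : ∀ s : State K, Measurable fun z : Fin K → ℝ =>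
      ind (Played Q order i' s z) * ind (s.Misled μ δ n' i') := fun s =>
    (measurable_ind_played i' s).mul_const _
  have hgp : ∀ s : State K, Measurable fun z : Fin K → ℝ =>
      ind (Good θ Q M s ∧ Played Q order i s z) := fun s =>
    measurable_ind ((MeasurableSet.const _).inter (measurableSet_played s i))
  have hset : ∀ s : State K, MeasurableSet {z : Fin K → ℝ | (i ∈ smallest order O.card z) ∧
      z i ≤ y ∧ z i' ≤ y} := fun s =>
    (measurableSet_mem_smallest order _ i measurable_id).inter
      ((measurableSet_sample_le i y).inter (measurableSet_sample_le i' y))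
  have hrare : ∀ s : State K, Measurable fun z : Fin K → ℝ =>
      ind ((Good θ Q M s ∧ ¬ s.Misled μ δ n' i') ∧ (i ∈ smallest order O.card z) ∧
        z i ≤ y ∧ z i' ≤ y) := fun s =>
    measurable_ind ((MeasurableSet.const _).inter (hset s))
  calc _ ≤ occ' T (fun s z => ind (Played Q order i' s z) * ind (s.Misled μ δ n' i') +
          ind ((Good θ Q M s ∧ ¬ s.Misled μ δ n' i') ∧ (i ∈ smallest order O.card z) ∧
            z i ≤ y ∧ z i' ≤ y)) := by
        refine occ_mono fun t ω => ?_
        rw [← ind_and]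
        refine ind_le_add fun h => ?_
        by_cases hm : (st ω t).Misled μ δ n' i'
        · exact Or.inl ⟨h.2.2.1, hm⟩
        · exact Or.inr ⟨⟨h.1, hm⟩, (h.1.played_iff hO i _).1 h.2.1, h.2.2.2⟩
    _ = occ' T (fun s z => ind (Played Q order i' s z) * ind (s.Misled μ δ n' i')) +
        occ' T (fun s z => ind ((Good θ Q M s ∧ ¬ s.Misled μ δ n' i') ∧
          (i ∈ smallest order O.card z) ∧ z i ≤ y ∧ z i' ≤ y)) := occ_add hθ hN T hmis
    _ ≤ _ := by
        refine add_le_add (occ_misled_le hθ hN (fun i => (hsep.pos i).le) hsep.le_one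
          hsep.delta_pos hsep.delta_le_one hn' i' T) ?_
        rw [← occ_const_mul hθ hN T _ hgp, ← occ_const_mul hθ hN T _ fun s => (hgp s).const_mul _]
        refine occ_le_occ hθ hN T hrare (fun s => ((hgp s).const_mul _).const_mul _)
          fun t s hs => ?_
        have hSF := exists_of_state hθ hs
        by_cases hg : Good θ Q M s ∧ ¬ s.Misled μ δ n' i'
        swap
        · simp only [hg, false_and, ind_of_not not_false, lintegral_zero]; exact zero_le
        have hz := measurable_samples_of hN t s
        have hP : ∀ i, Measurable fun ω => ind (Played Q order i s (samples Z t s ω)) :=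
          fun i => (measurable_ind_played i s).comp hz
        simp only [hg.1, hg.2, true_and, not_false_eq_true]
        rw [lintegral_ind (p := fun ω => i ∈ smallest order O.card (samples Z t s ω) ∧
            samples Z t s ω i ≤ y ∧ samples Z t s ω i' ≤ y) (hz (hset s)),
          lintegral_const_mul _ ((hP i).const_mul _), lintegral_const_mul _ (hP i),
          lintegral_played hN hO hg.1]
        have hd := measure_sample_le_deviation hN hsep.delta_pos hsep.delta_le_one
          (hsep.le_of_notMem i' hi') t (hSF i').1 (hSF i').2 hg.2
        refine (measure_two_le order (iIndepFun_samples hN t s)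
          (fun i => (measurable_pi_apply i).comp hz) hne (hd.trans hhalf)).trans ?_
        gcongr

/-- After many observations the samples of an arm are close to its mean. -/
lemma occ_deviation_le [IsProbabilityMeasure P] (hθ : 0 < θ) (hN : IsNoise μ P X Z)
    (h0 : ∀ i, 0 ≤ μ i) (h1 : ∀ i, μ i ≤ 1) {η r : ℝ} (hη : 0 < η) (hη1 : η ≤ 1)
    (j : Fin K) (T : ℕ) :
    occ' T (fun s z => ind (r ≤ s.obs j ∧ 2 * η < |z j - μ j|)) ≤
      T * (2 * ENNReal.ofReal (deviation η r)) := by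
  -- A sample off by `2 η` means that the empirical mean is off by `η` (the event `D`) or that the
  -- sample is off from the empirical mean by at least `η`. Each is bounded in every round
  -- separately, which produces the factor `T`.
  set D : State K → Prop := fun s => r ≤ s.obs j ∧
    (s.obs j : ℝ) * η ≤ |((s.S j - 1 : ℕ) : ℝ) - s.obs j * μ j| with hD
  have hset : MeasurableSet {z : Fin K → ℝ | 2 * η < |z j - μ j|} :=
    measurableSet_lt measurable_const (by fun_prop)
  have hrare : ∀ s : State K, Measurable fun z : Fin K → ℝ =>
      ind ((r ≤ s.obs j ∧ ¬ D s) ∧ 2 * η < |z j - μ j|) := fun s =>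
    measurable_ind ((MeasurableSet.const _).inter hset)
  calc _ ≤ occ' T (fun s z => ind (D s) +
          ind ((r ≤ s.obs j ∧ ¬ D s) ∧ 2 * η < |z j - μ j|)) := by
        refine occ_mono fun t ω => ind_le_add fun h => ?_
        by_cases hd : D (st ω t)
        exacts [Or.inl hd, Or.inr ⟨⟨h.1, hd⟩, h.2⟩]
    _ = occ' T (fun s _ => ind (D s)) +
        occ' T (fun s z => ind ((r ≤ s.obs j ∧ ¬ D s) ∧ 2 * η < |z j - μ j|)) :=
        occ_add hθ hN T fun s => measurable_const
    _ ≤ T * ENNReal.ofReal (deviation η r) + T * ENNReal.ofReal (deviation η r) := by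
        refine add_le_add ?_ ?_
        · rw [occ]
          refine (Finset.sum_le_card_nsmul _ _ (ENNReal.ofReal (deviation η r)) fun t _ => ?_).trans
            (by rw [Finset.card_range, nsmul_eq_mul])
          refine (lintegral_count_le hθ hN h0 h1 j t fun a b => ind (r ≤ ((a - 1 + (b - 1) : ℕ) : ℝ) ∧
            ((a - 1 + (b - 1) : ℕ) : ℝ) * η ≤
              |((a - 1 : ℕ) : ℝ) - ((a - 1 + (b - 1) : ℕ) : ℝ) * μ j|)).trans ?_
          refine le_trans (binomSum_mono fun k f => le_of_eq ?_)
            (binomSum_late_tail_le (s := r) (h0 j) (h1 j) hη hη1)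
          unfold ind
          congr
        · have : occ' T (fun s z => ind ((r ≤ s.obs j ∧ ¬ D s) ∧ 2 * η < |z j - μ j|)) ≤
              occ' T (fun _ _ => ENNReal.ofReal (deviation η r)) := by
            refine occ_le_occ hθ hN T hrare (fun s => measurable_const) fun t s hs => ?_
            have hSF := exists_of_state hθ hs j
            by_cases hg : r ≤ s.obs j ∧ ¬ D s
            swap
            · simp only [hg, false_and, ind_of_not not_false, lintegral_zero]; exact zero_le
            have hz := measurable_samples_of hN t s
            simp only [hg.1, hg.2, true_and, not_false_eq_true, lintegral_const, measure_univ,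
              mul_one]
            rw [lintegral_ind (p := fun ω => 2 * η < |samples Z t s ω j - μ j|) (hz hset)]
            have hA : MeasurableSet {u : ℝ | 2 * η < |u - μ j|} :=
              measurableSet_lt measurable_const (by fun_prop)
            have e := measure_samples hN t hSF.1 hSF.2 hA
            rw [show {ω | 2 * η < |samples Z t s ω j - μ j|} =
              {ω | samples Z t s ω j ∈ {u : ℝ | 2 * η < |u - μ j|}} from rfl, e]
            have hc := hg.2
            rw [hD] at hc
            simp only [hg.1, true_and, not_le] at hc
            have := betaMeasure_le_exp (k := s.S j - 1) (f := s.F j - 1) hA hη.le hη1 fun u hu => ?_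
            · rw [Nat.sub_add_cancel hSF.1, Nat.sub_add_cancel hSF.2] at this
              exact this.trans (ENNReal.ofReal_le_ofReal (concentration_le_deviation hη hg.1))
            · have hu' : 2 * η < |u - μ j| := hu
              have hnn : (0 : ℝ) ≤ s.obs j := Nat.cast_nonneg _
              change (s.obs j : ℝ) * η ≤ |((s.S j - 1 : ℕ) : ℝ) - s.obs j * u|
              have t1 : |(s.obs j : ℝ) * u - s.obs j * μ j| = s.obs j * |u - μ j| := by
                rw [← mul_sub, abs_mul, abs_of_nonneg hnn]
              have t2 := abs_sub_le ((s.obs j : ℝ) * u) ((s.S j - 1 : ℕ) : ℝ) (s.obs j * μ j)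
              rw [abs_sub_comm ((s.obs j : ℝ) * u) ((s.S j - 1 : ℕ) : ℝ)] at t2
              have t3 : (s.obs j : ℝ) * (2 * η) ≤ s.obs j * |u - μ j| := by gcongr
              linarith
          refine this.trans ?_
          simp [occ]
    _ = _ := by ring

/-- The leading term: plays of a suboptimal arm with a small sample. -/
lemma occ_played_small_le [IsProbabilityMeasure P] (hθ : 0 < θ) (hN : IsNoise μ P X Z)
    (h0 : ∀ i, 0 ≤ μ i) (h1 : ∀ i, μ i ≤ 1) {i : Fin K} {x y v n : ℝ} (hyx : y < x) (hx1 : x ≤ 1)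
    (hv : 0 < v) (hvd : v ≤ klBer x y) (hn : 0 ≤ n) {T : ℕ} (hT : 1 ≤ T)
    (hnT : Real.log T ≤ n * (klBer x y - v)) :
    occ' T (fun s z => ind (Played Q order i s z ∧ z i ≤ y)) ≤
      ENNReal.ofReal (n + 1) + (binomSum (μ i) (fun k f => ind ((k : ℝ) < (k + f : ℕ) * x)) +
        ENNReal.ofReal (1 + 1 / v)) := by
  -- Plays are split into three classes: fewer than `n` observations, empirical mean below `x` (the
  -- event `D`), and the rest, where the posterior large deviation bound applies.
  set D : State K → Prop := fun s => ((s.S i - 1 : ℕ) : ℝ) < s.obs i * x with hD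
  have hm1 : ∀ s : State K, Measurable fun z : Fin K → ℝ =>
      ind (Played Q order i s z) * ind ((s.obs i : ℝ) < n) := fun s =>
    (measurable_ind_played i s).mul_const _
  have hm2 : ∀ s : State K, Measurable fun z : Fin K → ℝ =>
      ind (Played Q order i s z) * ind (D s) := fun s =>
    (measurable_ind_played i s).mul_const _
  have hm3 : ∀ s : State K, Measurable fun z : Fin K → ℝ =>
      ind ((n ≤ s.obs i ∧ ¬ D s) ∧ z i ≤ y) := fun s =>
    measurable_ind ((MeasurableSet.const _).inter (measurableSet_sample_le i y))
  calc _ ≤ occ' T (fun s z => ind (Played Q order i s z) * ind ((s.obs i : ℝ) < n) +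
          (ind (Played Q order i s z) * ind (D s) +
          ind ((n ≤ s.obs i ∧ ¬ D s) ∧ z i ≤ y))) := by
        refine occ_mono fun t ω => ?_
        rw [← ind_and, ← ind_and]
        by_cases hn : ((st ω t).obs i : ℝ) < n
        · exact (ind_mono fun h => ⟨h.1, hn⟩).trans le_self_add
        · refine le_trans (ind_le_add fun h => ?_) le_add_self
          by_cases hd : D (st ω t)
          exacts [Or.inl ⟨h.1, hd⟩, Or.inr ⟨⟨not_lt.1 hn, hd⟩, h.2⟩]
    _ = occ' T (fun s z => ind (Played Q order i s z) * ind ((s.obs i : ℝ) < n)) +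
        (occ' T (fun s z => ind (Played Q order i s z) * ind (D s)) +
          occ' T (fun s z => ind ((n ≤ s.obs i ∧ ¬ D s) ∧ z i ≤ y))) := by
        rw [occ_add hθ hN T hm1, occ_add hθ hN T hm2]
    _ ≤ _ := by
        refine add_le_add (occ_obs_lt_le hθ hN h0 h1 hn i T) (add_le_add ?_ ?_)
        · exact occ_played_le hθ hN h0 h1 i T fun a b =>
            ind (((a - 1 : ℕ) : ℝ) < ((a - 1 + (b - 1) : ℕ) : ℝ) * x)
        · have hT0 : (0 : ℝ) < T := by exact_mod_cast hT
          have : occ' T (fun s z => ind ((n ≤ s.obs i ∧ ¬ D s) ∧ z i ≤ y)) ≤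
              occ' T (fun _ _ => ENNReal.ofReal (1 / T * (1 + 1 / v))) := by
            refine occ_le_occ hθ hN T hm3 (fun s => measurable_const) fun t s hs => ?_
            have hSF := exists_of_state hθ hs i
            by_cases hg : n ≤ s.obs i ∧ ¬ D s
            swap
            · simp only [hg, false_and, ind_of_not not_false, lintegral_zero]; exact zero_le
            have hz := measurable_samples_of hN t s
            simp only [hg.1, hg.2, true_and, not_false_eq_true, lintegral_const, measure_univ,
              mul_one]
            rw [lintegral_ind (p := fun ω => samples Z t s ω i ≤ y) (hz (measurableSet_sample_le i y)),
              show {ω | samples Z t s ω i ≤ y} = {ω | samples Z t s ω i ∈ Set.Iic y} from rfl,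
              measure_samples hN t hSF.1 hSF.2 measurableSet_Iic]
            have hk : ((s.S i - 1 + (s.F i - 1) : ℕ) : ℝ) * x ≤ ((s.S i - 1 : ℕ) : ℝ) :=
              not_lt.1 hg.2
            have := betaMeasure_Iic_le_klBer hyx hx1 hk
            rw [Nat.sub_add_cancel hSF.1, Nat.sub_add_cancel hSF.2] at this
            refine this.trans (ENNReal.ofReal_le_ofReal ?_)
            change ((s.obs i + 1 : ℕ) : ℝ) * Real.exp (-((s.obs i : ℝ) * klBer x y)) ≤ _
            have e1 := succ_mul_exp_le hv (s.obs i)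
            have e2 : Real.log T ≤ s.obs i * (klBer x y - v) :=
              hnT.trans (mul_le_mul_of_nonneg_right hg.1 (by linarith))
            -- The part `v` of the divergence is reserved for absorbing the factor `obs + 1`; the
            -- remainder, over at least `n` observations, yields `1 / T`, so the sum over `T` rounds
            -- is bounded.
            have e3 : Real.exp (-((s.obs i : ℝ) * klBer x y)) ≤
                1 / T * Real.exp (-((s.obs i : ℝ) * v)) := by
              rw [show (1 / T : ℝ) = Real.exp (-Real.log T) by
                rw [Real.exp_neg, Real.exp_log hT0, one_div], ← Real.exp_add]
              gcongr
              linarith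
            calc _ ≤ ((s.obs i + 1 : ℕ) : ℝ) * (1 / T * Real.exp (-((s.obs i : ℝ) * v))) := by
                  gcongr
              _ = 1 / T * (((s.obs i + 1 : ℕ) : ℝ) * Real.exp (-((s.obs i : ℝ) * v))) := by ring
              _ ≤ _ := by gcongr
          refine this.trans (le_of_eq ?_)
          have hT' : (T : ℝ≥0∞) = ENNReal.ofReal T := by simp
          simp only [occ, lintegral_const, measure_univ, mul_one, Finset.sum_const,
            Finset.card_range, nsmul_eq_mul]
          rw [hT', ← ENNReal.ofReal_mul hT0.le]
          congr 1
          field_simp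

end Run

/-! ### The candidate thresholds -/

section Candidates

variable {K : ℕ} {θ Q : ℝ}

lemma candidate_eq_getElem {i : ℕ} (h : i - 1 < (candidates K Q).card) :
    candidate K Q i = ((candidates K Q).sort (· ≤ ·))[i - 1]'(by simpa using h) := by
  rw [candidate, List.getD_eq_getElem _ _ (by simpa using h)]

lemma candidate_mem {i : ℕ} (h1 : 1 ≤ i) (h2 : i ≤ (candidates K Q).card) :
    candidate K Q i ∈ candidates K Q := by
  rw [candidate_eq_getElem (by omega), ← Finset.mem_sort (r := (· ≤ ·))]
  exact List.getElem_mem _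

lemma candidate_lt {i j : ℕ} (h1 : 1 ≤ i) (h : i < j) (h2 : j ≤ (candidates K Q).card) :
    candidate K Q i < candidate K Q j := by
  rw [candidate_eq_getElem (by omega), candidate_eq_getElem (by omega)]
  exact (Finset.sortedLT_sort (candidates K Q)).strictMono_get
    (a := ⟨i - 1, by simpa using (by omega : i - 1 < (candidates K Q).card)⟩)
    (b := ⟨j - 1, by simpa using (by omega : j - 1 < (candidates K Q).card)⟩)
    (by rw [Fin.mk_lt_mk]; omega)

lemma candidate_le {i j : ℕ} (h1 : 1 ≤ i) (h : i ≤ j) (h2 : j ≤ (candidates K Q).card) :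
    candidate K Q i ≤ candidate K Q j := by
  rcases h.eq_or_lt with rfl | h
  exacts [le_rfl, (candidate_lt h1 h h2).le]

lemma exists_candidate_eq {c : ℝ} (hc : c ∈ candidates K Q) :
    ∃ i, 1 ≤ i ∧ i ≤ (candidates K Q).card ∧ candidate K Q i = c := by
  rw [← Finset.mem_sort (r := (· ≤ ·))] at hc
  obtain ⟨n, hn, rfl⟩ := List.getElem_of_mem hc
  have hn' : n < (candidates K Q).card := by simpa using hn
  exact ⟨n + 1, by omega, by omega, candidate_eq_getElem (by simpa using hn')⟩

lemma mem_candidates {c : ℝ} : c ∈ candidates K Q ↔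
    c = min 1 Q ∨ (∃ m : ℕ, 1 ≤ m ∧ m ≤ K ∧ Q / m = c) ∧ c ≤ min 1 Q := by
  simp only [candidates, Finset.mem_insert, Finset.mem_filter, Finset.mem_image, Finset.mem_Icc,
    and_assoc]

lemma le_of_mem_candidates {c : ℝ} (hc : c ∈ candidates K Q) : c ≤ min 1 Q := by
  rcases mem_candidates.1 hc with rfl | h
  exacts [le_rfl, h.2]

lemma candidate_card (K : ℕ) (Q : ℝ) : candidate K Q (candidates K Q).card = min 1 Q := by
  obtain ⟨i, h1, h2, h⟩ := exists_candidate_eq (mem_candidates.2 (Or.inl rfl) :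
    min 1 Q ∈ candidates K Q)
  refine le_antisymm (le_of_mem_candidates (candidate_mem (h1.trans h2) le_rfl)) ?_
  rw [← h]
  exact candidate_le h1 h2 le_rfl

/-- Apart from the last candidate, `Q / Θ[i]` is exactly an integer `m`. Being below `1` forces `Q ≤
m`, so a search round with such a candidate probes at least `Q` arms. -/
lemma candidate_eq_div {i : ℕ} (h1 : 1 ≤ i) (h2 : i < (candidates K Q).card) :
    ∃ m : ℕ, 1 ≤ m ∧ m ≤ K ∧ candidate K Q i = Q / m ∧ Q ≤ m := by
  have hlt : candidate K Q i < min 1 Q := by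
    rw [← candidate_card K Q]
    exact candidate_lt h1 h2 le_rfl
  rcases mem_candidates.1 (candidate_mem h1 h2.le) with h | ⟨⟨m, hm1, hmK, hm⟩, -⟩
  · exact absurd h hlt.ne
  · refine ⟨m, hm1, hmK, hm.symm, ?_⟩
    have hm0 : (0 : ℝ) < m := by exact_mod_cast hm1
    rw [← hm] at hlt
    exact ((div_lt_one hm0).1 (hlt.trans_le (min_le_left _ _))).le

/-- Since not all arms can be covered, `⌊Q / θ⌋ < K`, and the candidate `Q / K` lies strictly below
the threshold. -/
lemma div_card_mem (hθ : 0 < θ) (hθ1 : θ ≤ 1) (hQ : θ ≤ Q) (hM : numCovered K θ Q < K) :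
    Q / K < θ ∧ Q / K ∈ candidates K Q := by
  have hK : (0 : ℝ) < K := by exact_mod_cast (Nat.zero_le _).trans_lt hM
  have hM' : ⌊Q / θ⌋₊ < K := by
    rw [numCovered, min_lt_iff] at hM
    simpa using hM
  have h1 : Q / K < θ := by
    rw [div_lt_iff₀ hK, mul_comm, ← div_lt_iff₀ hθ]
    exact (Nat.floor_lt' (by omega)).1 hM'
  exact ⟨h1, mem_candidates.2 (Or.inr ⟨⟨K, by omega, le_rfl, rfl⟩,
    h1.le.trans (le_min hθ1 hQ)⟩)⟩

lemma candidate_one_lt (hθ : 0 < θ) (hθ1 : θ ≤ 1) (hQ : θ ≤ Q) (hM : numCovered K θ Q < K) :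
    candidate K Q 1 < θ := by
  obtain ⟨h1, h2⟩ := div_card_mem hθ hθ1 hQ hM
  obtain ⟨i, hi1, hi2, h⟩ := exists_candidate_eq h2
  exact (candidate_le le_rfl hi1 hi2).trans_lt (h ▸ h1)

lemma two_le_card_candidates (hθ : 0 < θ) (hθ1 : θ ≤ 1) (hQ : θ ≤ Q)
    (hM : numCovered K θ Q < K) : 2 ≤ (candidates K Q).card := by
  obtain ⟨h1, h2⟩ := div_card_mem hθ hθ1 hQ hM
  refine Finset.one_lt_card.2 ⟨_, h2, min 1 Q, mem_candidates.2 (Or.inl rfl), ?_⟩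
  exact (h1.trans_le (le_min hθ1 hQ)).ne

/-- The smallest candidate that is at least `θ` yields the correct number of arms. -/
lemma floor_div_candidate (hθ : 0 < θ) (hQ : θ ≤ Q) (hM : numCovered K θ Q < K)
    {u : ℕ} (h1 : 1 < u) (h2 : u ≤ (candidates K Q).card) (hlow : candidate K Q (u - 1) < θ)
    (hup : θ ≤ candidate K Q u) : ⌊Q / candidate K Q u⌋₊ = numCovered K θ Q := by
  have hQ0 : 0 < Q := hθ.trans_le hQ
  have hMf : numCovered K θ Q = ⌊Q / θ⌋₊ := by
    rw [numCovered, min_lt_iff] at hM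
    rw [numCovered, min_eq_left (by simpa using (by simpa using hM : ⌊Q / θ⌋₊ < K).le)]
  rw [hMf]
  refine le_antisymm (Nat.floor_mono (div_le_div_of_nonneg_left hQ0.le hθ hup)) ?_
  have hc0 : 0 < candidate K Q u := hθ.trans_le hup
  set m := ⌊Q / θ⌋₊ with hm
  have hm1 : 1 ≤ m := (Nat.one_le_floor_iff _).2 ((one_le_div hθ).2 hQ)
  have hm0 : (0 : ℝ) < m := by exact_mod_cast hm1
  have hmle : (m : ℝ) ≤ Q / θ := Nat.floor_le (by positivity)
  have hdiv : θ ≤ Q / m := by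
    rw [le_div_iff₀ hm0, mul_comm]
    exact (le_div_iff₀ hθ).1 hmle
  -- `Q / M` is at least `θ`. If it is a candidate, the smallest candidate not below `θ` cannot
  -- exceed it; otherwise it exceeds `min 1 Q`, hence every candidate.
  have hle : candidate K Q u ≤ Q / m := by
    by_cases h : Q / m ≤ min 1 Q
    · obtain ⟨i, hi1, hi2, hi⟩ := exists_candidate_eq (mem_candidates.2
        (Or.inr ⟨⟨m, hm1, by omega, rfl⟩, h⟩) : Q / m ∈ candidates K Q)
      rw [← hi]
      refine candidate_le (by omega) ?_ hi2
      by_contra hcon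
      have := candidate_le (K := K) (Q := Q) hi1 (by omega : i ≤ u - 1) (by omega)
      linarith
    · exact (le_of_mem_candidates (candidate_mem h1.le h2)).trans (not_le.1 h).le
  refine Nat.le_floor ?_
  rw [le_div_iff₀ hc0]
  rw [le_div_iff₀ hm0] at hle
  linarith

end Candidates

/-! ### The binary search -/

section Search

variable {K : ℕ} {θ Q W : ℝ}

/-- The number of rounds without loss after which the upper end of the search moves. -/
def windowRounds (W : ℝ) : ℕ := max 1 ⌈W⌉₊

/-- The invariant of the binary search. -/
structure State.Bracket (θ Q W : ℝ) (s : State K) : Prop where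
  lt : s.l < s.i
  le : s.i ≤ s.u
  le_card : s.u ≤ (candidates K Q).card
  mid : s.i = s.l + (s.u - s.l + 1) / 2
  lower : s.l = 0 ∨ candidate K Q s.l < θ
  count : s.C + 1 ≤ windowRounds W

/-- The served arms of a search round produce a loss. -/
def LossIn (A : Finset (Fin K)) (x : Fin K → Bool) : Prop := ∃ j ∈ A, x j = true

lemma State.next_of_eq {s : State K} (h : s.i = s.u) (A : Finset (Fin K)) (x : Fin K → Bool) :
    (s.next θ Q W A x).l = s.l ∧ (s.next θ Q W A x).u = s.u ∧ (s.next θ Q W A x).i = s.i ∧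
      (s.next θ Q W A x).C = s.C := by
  simp [State.next, h]

lemma State.next_of_loss {s : State K} (h : s.i ≠ s.u) (hlt : s.threshold Q < θ)
    {A : Finset (Fin K)} {x : Fin K → Bool} (hx : LossIn A x) :
    (s.next θ Q W A x).l = s.i ∧ (s.next θ Q W A x).u = s.u ∧
      (s.next θ Q W A x).i = s.i + (s.u - s.i + 1) / 2 ∧ (s.next θ Q W A x).C = 0 := by
  have hx' : ∃ j ∈ A, x j = true := hx
  simp [State.next, h, hlt, hx']

lemma State.next_of_window {s : State K} (h : s.i ≠ s.u) {A : Finset (Fin K)} {x : Fin K → Bool}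
    (hx : ¬ (s.threshold Q < θ ∧ LossIn A x)) (hC : W ≤ ((s.C + 1 : ℕ) : ℝ)) :
    (s.next θ Q W A x).l = s.l ∧ (s.next θ Q W A x).u = s.i ∧
      (s.next θ Q W A x).i = s.i - (s.i - s.l) / 2 ∧ (s.next θ Q W A x).C = 0 := by
  have hx' : ¬ (s.threshold Q < θ ∧ ∃ j ∈ A, x j = true) := hx
  unfold State.next
  rw [if_pos h, if_neg hx', if_pos hC]
  exact ⟨rfl, rfl, rfl, rfl⟩

lemma State.next_of_wait {s : State K} (h : s.i ≠ s.u) {A : Finset (Fin K)} {x : Fin K → Bool}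
    (hx : ¬ (s.threshold Q < θ ∧ LossIn A x)) (hC : ¬ W ≤ ((s.C + 1 : ℕ) : ℝ)) :
    (s.next θ Q W A x).l = s.l ∧ (s.next θ Q W A x).u = s.u ∧
      (s.next θ Q W A x).i = s.i ∧ (s.next θ Q W A x).C = s.C + 1 := by
  have hx' : ¬ (s.threshold Q < θ ∧ ∃ j ∈ A, x j = true) := hx
  unfold State.next
  rw [if_pos h, if_neg hx', if_neg hC]
  exact ⟨rfl, rfl, rfl, rfl⟩

lemma windowRounds_le {n : ℕ} (h : W ≤ ((n + 1 : ℕ) : ℝ)) : windowRounds W ≤ n + 1 :=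
  max_le (by omega) (Nat.ceil_le.2 h)

lemma le_windowRounds {n : ℕ} (h : ¬ W ≤ ((n + 1 : ℕ) : ℝ)) : n + 1 + 1 ≤ windowRounds W :=
  le_max_of_le_right (Nat.lt_ceil.2 (not_le.1 h))

lemma State.Bracket.init (hcard : 2 ≤ (candidates K Q).card) :
    (State.init K Q).Bracket θ Q W where
  lt := by simp only [State.init]; omega
  le := by simp only [State.init]; omega
  le_card := le_rfl
  mid := by simp [State.init]
  lower := Or.inl rfl
  count := by simp [State.init, windowRounds]

lemma State.Bracket.next {s : State K} (hs : s.Bracket θ Q W) (A : Finset (Fin K))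
    (x : Fin K → Bool) : (s.next θ Q W A x).Bracket θ Q W := by
  obtain ⟨h1, h2, h3, h4, h5, h6⟩ := hs
  by_cases h : s.i = s.u
  · obtain ⟨e1, e2, e3, e4⟩ := State.next_of_eq (θ := θ) (Q := Q) (W := W) h A x
    constructor <;> simp only [e1, e2, e3, e4] <;> assumption
  by_cases hx : s.threshold Q < θ ∧ LossIn A x
  · obtain ⟨e1, e2, e3, e4⟩ := State.next_of_loss (W := W) h hx.1 hx.2
    constructor <;> simp only [e1, e2, e3, e4]
    · omega
    · omega
    · exact h3
    · exact Or.inr hx.1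
    · simp [windowRounds]
  by_cases hC : W ≤ ((s.C + 1 : ℕ) : ℝ)
  · obtain ⟨e1, e2, e3, e4⟩ := State.next_of_window h hx hC
    constructor <;> simp only [e1, e2, e3, e4]
    · omega
    · omega
    · omega
    · omega
    · exact h5
    · simp [windowRounds]
  · obtain ⟨e1, e2, e3, e4⟩ := State.next_of_wait h hx hC
    constructor <;> simp only [e1, e2, e3, e4]
    · omega
    · omega
    · omega
    · exact h4
    · exact h5
    · exact le_windowRounds hC

/-- If the search has ended with an estimate that is not too small, then the estimate is good. -/
lemma State.Bracket.good (hθ : 0 < θ) (hθ1 : θ ≤ 1) (hQ : θ ≤ Q) (hM : numCovered K θ Q < K)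
    {s : State K} (hs : s.Bracket θ Q W) (h : s.i = s.u) (hup : θ ≤ candidate K Q s.u) :
    Good θ Q (numCovered K θ Q) s := by
  obtain ⟨h1, h2, h3, h4, h5, h6⟩ := hs
  -- With `i` the rounded-up midpoint, `i = u` forces an interval of length one, so the candidate
  -- preceding the estimate is the lower end.
  have h7 : s.l = s.u - 1 := by omega
  have h8 : 1 < s.u := by
    by_contra hcon
    have : s.u = 1 := by omega
    rw [this] at hup
    exact absurd hup (not_le.2 (candidate_one_lt hθ hθ1 hQ hM))
  refine ⟨h, ?_, ?_⟩
  · rw [State.numServed, State.threshold, h]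
    refine floor_div_candidate hθ hQ hM h8 h3 ?_ hup
    rw [← h7]
    exact h5.resolve_left (by omega)
  · rw [State.threshold, h]
    exact hup

/-- The arms served in the search rounds. -/
def State.probed (Q : ℝ) (order : Equiv.Perm (Fin K)) (s : State K) : Finset (Fin K) :=
  Finset.univ.filter fun j => ((order j : Fin K) : ℕ) < s.numServed Q

lemma State.served_eq_probed {order : Equiv.Perm (Fin K)} {s : State K} (h : s.i ≠ s.u)
    (z : Fin K → ℝ) : s.served Q order z = s.probed Q order := by
  rw [State.served, if_pos h, State.probed]

lemma card_probed (order : Equiv.Perm (Fin K)) {s : State K} (hQ : 0 < Q)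
    (hs : s.Bracket θ Q W) (h : s.i ≠ s.u) :
    1 ≤ (s.probed Q order).card ∧ Q ≤ (s.probed Q order).card := by
  obtain ⟨h1, h2, h3, h4, h5, h6⟩ := hs
  obtain ⟨m, hm1, hmK, hm, hQm⟩ := candidate_eq_div (K := K) (Q := Q) (i := s.i) (by omega)
    (by omega)
  have hn : s.numServed Q = m := by
    rw [State.numServed, State.threshold, hm, div_div_cancel₀ hQ.ne', Nat.floor_natCast]
  have : (s.probed Q order).card = m := by
    rw [State.probed, hn]
    have e : (Finset.univ.filter fun j => ((order j : Fin K) : ℕ) < m) =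
        (Finset.univ.filter fun j : Fin K => (j : ℕ) < m).map order.symm.toEmbedding := by
      ext j
      simp
    rw [e, Finset.card_map]
    exact Fin.card_filter_val_lt.trans (min_eq_right hmK)
  rw [this]
  exact ⟨hm1, hQm⟩

end Search

/-! ### The length and the error of the binary search -/

section SearchBounds

variable {K : ℕ} {θ Q W : ℝ} {order : Equiv.Perm (Fin K)} {Ω : Type*}
  {X : ℕ → Fin K → Ω → Bool} {Z : ℕ → Fin K → ℕ → ℕ → Ω → ℝ}

lemma bracket_state (hθ : 0 < θ) (hcard : 2 ≤ (candidates K Q).card) {t : ℕ} {s : State K}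
    (h : ∃ ω, state θ Q W order X Z ω t = s) : s.Bracket θ Q W := by
  obtain ⟨ω, rfl⟩ := h
  induction t with
  | zero => exact State.Bracket.init hcard
  | succ t ih =>
    rw [state_succ hθ]
    exact ih.next _ _

/-- The search runs with an estimate below the threshold. -/
def Below (θ Q : ℝ) (s : State K) : Prop := s.i ≠ s.u ∧ s.threshold Q < θ

/-- The search runs with an estimate that is at least the threshold. -/
def Above (θ Q : ℝ) (s : State K) : Prop := s.i ≠ s.u ∧ θ ≤ s.threshold Q

/-- The upper end of the search is below the threshold. -/
def Failed (θ Q : ℝ) (s : State K) : Prop := candidate K Q s.u < θ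

open Classical in
/-- A bound for the number of remaining rounds with estimates at least the threshold. -/
def remaining (θ Q W : ℝ) (s : State K) : ℕ :=
  windowRounds W * (Nat.clog 2 (s.u - s.l) - if s.l = 0 then 1 else 0) -
    if Above θ Q s then s.C else 0

lemma clog_half {d e : ℕ} (hd : 2 ≤ d) (he : e ≤ (d + 1) / 2) :
    Nat.clog 2 e + 1 ≤ Nat.clog 2 d := by
  rw [Nat.clog_of_two_le one_lt_two hd]
  have : (d + 2 - 1) / 2 = (d + 1) / 2 := rfl
  rw [this]
  exact Nat.succ_le_succ (Nat.clog_mono_right 2 he)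

/-- Each halving lowers the binary logarithm, rounded up, by at least one, which pays for one full
window. One unit is withheld while `l = 0`: the first candidate is below `θ`, so an `Above` test
with `l = 0` never shrinks the interval to length one. When `l` leaves `0` the halving itself pays
for releasing the unit. -/
lemma remaining_next (hlow : candidate K Q 1 < θ) {s : State K} (hs : s.Bracket θ Q W)
    (A : Finset (Fin K)) (x : Fin K → Bool) :
    (open Classical in if Above θ Q s then 1 else 0) + remaining θ Q W (s.next θ Q W A x) ≤
      remaining θ Q W s := by
  classical
  obtain ⟨h1, h2, h3, h4, h5, h6⟩ := hs
  by_cases h : s.i = s.u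
  · obtain ⟨e1, e2, e3, e4⟩ := State.next_of_eq (θ := θ) (Q := Q) (W := W) h A x
    simp [remaining, Above, State.threshold, e1, e2, e3, h]
  by_cases hx : s.threshold Q < θ ∧ LossIn A x
  · obtain ⟨e1, e2, e3, e4⟩ := State.next_of_loss (W := W) h hx.1 hx.2
    have hA : ¬ Above θ Q s := fun hA => (not_lt.2 hA.2) hx.1
    have hi : s.i ≠ 0 := by omega
    have hc := clog_half (d := s.u - s.l) (e := s.u - s.i) (by omega) (by omega)
    simp only [remaining, e1, e2, e4, hA, hi, if_false, ite_self, tsub_zero, zero_add]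
    refine Nat.mul_le_mul_left _ ?_
    split_ifs <;> omega
  by_cases hC : W ≤ ((s.C + 1 : ℕ) : ℝ)
  · obtain ⟨e1, e2, e3, e4⟩ := State.next_of_window h hx hC
    have hc := clog_half (d := s.u - s.l) (e := s.i - s.l) (by omega) (by omega)
    simp only [remaining, e1, e2, e4, ite_self, tsub_zero]
    by_cases hA : Above θ Q s
    · simp only [hA, if_true]
      have hw := windowRounds_le hC
      have hB : (Nat.clog 2 (s.i - s.l) - if s.l = 0 then 1 else 0) + 1 ≤
          Nat.clog 2 (s.u - s.l) - if s.l = 0 then 1 else 0 := by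
        split_ifs with hl
        -- The test is at or above the threshold while the first candidate is below it, so the
        -- shortened interval has length at least two and the truncated subtraction loses nothing.
        · have hi : s.i ≠ 1 := by
            intro hi
            have := hA.2
            rw [State.threshold, hi] at this
            linarith
          have := Nat.clog_pos (b := 2) (n := s.i - s.l) one_lt_two (by omega)
          omega
        · omega
      have := Nat.mul_le_mul_left (windowRounds W) hB
      rw [mul_add, mul_one] at this
      omega
    · simp only [hA, if_false, tsub_zero, zero_add]
      refine Nat.mul_le_mul_left _ ?_
      omega
  · obtain ⟨e1, e2, e3, e4⟩ := State.next_of_wait h hx hC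
    have hA : Above θ Q (s.next θ Q W A x) ↔ Above θ Q s := by
      simp [Above, State.threshold, e2, e3]
    simp only [remaining, e1, e2, e4, hA]
    by_cases hA : Above θ Q s
    · simp only [hA, if_true]
      have hw := le_windowRounds hC
      have hB : 1 ≤ Nat.clog 2 (s.u - s.l) - if s.l = 0 then 1 else 0 := by
        split_ifs with hl
        · have hi : s.i ≠ 1 := by
            intro hi
            have := hA.2
            rw [State.threshold, hi] at this
            linarith
          have := clog_half (d := s.u - s.l) (e := s.i - s.l) (by omega) (by omega)
          have := Nat.clog_pos (b := 2) (n := s.i - s.l) one_lt_two (by omega)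
          omega
        · have := Nat.clog_pos (b := 2) (n := s.u - s.l) one_lt_two (by omega)
          omega
      have := Nat.mul_le_mul_left (windowRounds W) hB
      omega
    · simp only [hA, if_false, zero_add, le_refl]

variable [MeasurableSpace Ω] {P : Measure Ω} {μ : Fin K → ℝ}

local notation "st" => state θ Q W order X Z
local notation "occ'" => occ θ Q W order P X Z

/-- Bounds by a potential that decreases in conditional expectation. -/
lemma occ_add_lintegral_le [IsProbabilityMeasure P] (hθ : 0 < θ) (hN : IsNoise μ P X Z)
    {g h : State K → ℝ≥0∞} (hstep : ∀ t s, (∃ ω, st ω t = s) →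
      g s + ∫⁻ ω, h (s.next θ Q W (s.served Q order (samples Z t s ω)) fun i => X t i ω) ∂P ≤ h s)
    (T : ℕ) : occ' T (fun s _ => g s) + ∫⁻ ω, h (st ω T) ∂P ≤ h (State.init K Q) := by
  have hd : ∀ f : State K → ℝ≥0∞, Measurable f := fun f => Measurable.of_discrete
  have step : ∀ t, ∫⁻ ω, g (st ω t) ∂P + ∫⁻ ω, h (st ω (t + 1)) ∂P ≤ ∫⁻ ω, h (st ω t) ∂P := by
    intro t
    have e1 := lintegral_state (order := order) (W := W) (Q := Q) hθ hN t (fun s _ _ => g s)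
      fun s => measurable_const
    have e2 := lintegral_state (order := order) (W := W) (Q := Q) hθ hN t (fun s _ _ => h s)
      fun s => measurable_const
    have e3 := lintegral_state (order := order) (W := W) (Q := Q) hθ hN t
      (fun s z x => h (s.next θ Q W (s.served Q order z) x))
      fun s => (hd h).comp (measurable_next s measurable_fst measurable_snd)
    simp only [state_succ hθ]
    rw [e1, e2, e3, ← ENNReal.tsum_add]
    refine ENNReal.tsum_le_tsum fun s => ?_
    rw [← mul_add]
    by_cases hs : ∃ ω, st ω t = s
    · refine mul_le_mul_right ?_ _
      simpa using hstep t s hs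
    · have : {ω | st ω t = s} = ∅ := by
        ext ω
        simp only [Set.mem_ofPred_eq, Set.mem_empty_iff_false, iff_false]
        exact fun h => hs ⟨ω, h⟩
      rw [this]
      simp
  induction T with
  | zero => simp [occ, state]
  | succ T ih =>
    refine le_trans ?_ ih
    have : occ' (T + 1) (fun s _ => g s) = occ' T (fun s _ => g s) + ∫⁻ ω, g (st ω T) ∂P :=
      Finset.sum_range_succ _ _
    rw [this, add_assoc]
    exact add_le_add le_rfl (step T)

/-- The number of search rounds with an estimate that is at least the threshold. -/
lemma occ_above_le [IsProbabilityMeasure P] (hθ : 0 < θ) (hN : IsNoise μ P X Z)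
    (hcard : 2 ≤ (candidates K Q).card) (hlow : candidate K Q 1 < θ) (T : ℕ) :
    occ' T (fun s _ => ind (Above θ Q s)) ≤
      (windowRounds W * (Nat.clog 2 (candidates K Q).card - 1) : ℕ) := by
  refine le_self_add.trans ((occ_add_lintegral_le hθ hN (g := fun s => ind (Above θ Q s))
    (h := fun s => (remaining θ Q W s : ℝ≥0∞)) (fun t s hs => ?_) T).trans ?_)
  · have hb := bracket_state hθ hcard hs
    have : ∀ ω, ind (Above θ Q s) + (remaining θ Q W (s.next θ Q W
        (s.served Q order (samples Z t s ω)) fun i => X t i ω) : ℝ≥0∞) ≤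
        (remaining θ Q W s : ℝ≥0∞) := fun ω => by
      have := remaining_next hlow hb (s.served Q order (samples Z t s ω)) fun i => X t i ω
      rw [← Nat.cast_le (α := ℝ≥0∞)] at this
      refine le_trans (le_of_eq ?_) this
      push_cast
      rfl
    have e := lintegral_mono (μ := P) this
    rwa [lintegral_add_left measurable_const, lintegral_const, lintegral_const, measure_univ,
      mul_one, mul_one] at e
  · rw [Nat.cast_le]
    refine (Nat.sub_le _ _).trans (le_of_eq ?_)
    simp [State.init]

/-- The withheld unit pays off here: the rounded-up binary logarithm minus one is at most `Real.logb
2 N`. Rounding `W` up costs only a term independent of `W`. -/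
lemma windowRounds_mul_le (hW : 0 ≤ W) {N : ℕ} (hN : 2 ≤ N) :
    ((windowRounds W * (Nat.clog 2 N - 1) : ℕ) : ℝ) ≤ (W + 1) * Real.logb 2 N := by
  have h1 : (windowRounds W : ℝ) ≤ W + 1 := by
    rw [windowRounds, Nat.cast_max, Nat.cast_one]
    exact max_le (by linarith) (Nat.ceil_lt_add_one hW).le
  have h2 : ((Nat.clog 2 N - 1 : ℕ) : ℝ) ≤ Real.logb 2 N := by
    have hN0 : (0 : ℝ) < N := by positivity
    rw [Real.le_logb_iff_rpow_le one_lt_two hN0, Real.rpow_natCast]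
    have hc := Nat.clog_pos (b := 2) (n := N) one_lt_two (by omega)
    have : ¬ N ≤ 2 ^ (Nat.clog 2 N - 1) := by
      rw [← Nat.clog_le_iff_le_pow one_lt_two]
      omega
    exact_mod_cast (not_le.1 this).le
  push_cast
  exact mul_le_mul h1 h2 (Nat.cast_nonneg _) (by linarith)

lemma measurableSet_lossIn (hN : IsNoise μ P X Z) (t : ℕ) (A : Finset (Fin K)) :
    MeasurableSet {ω | LossIn A fun i => X t i ω} := by
  have : {ω | LossIn A fun i => X t i ω} = ⋃ j ∈ A, {ω | X t j ω = true} := by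
    ext ω
    simp [LossIn]
  rw [this]
  exact Finset.measurableSet_biUnion _ fun j _ =>
    hN.measurable_loss t j (measurableSet_singleton true)

/-- A loss is observed at the probed arms with probability at least `ε`. -/
lemma le_measure_lossIn (hN : IsNoise μ P X Z) {ε : ℝ} (hμε : ∀ i, ε ≤ μ i) (t : ℕ)
    {A : Finset (Fin K)} (hA : 1 ≤ A.card) :
    ENNReal.ofReal ε ≤ P {ω | LossIn A fun i => X t i ω} := by
  obtain ⟨j, hj⟩ := Finset.card_pos.1 hA
  refine (ENNReal.ofReal_le_ofReal (hμε j)).trans ?_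
  rw [← hN.prob_loss t j]
  exact measure_mono fun ω hω => ⟨j, hj, hω⟩

/-- The expected number of search rounds with an estimate below the threshold is bounded. -/
lemma occ_below_le [IsProbabilityMeasure P] (hθ : 0 < θ) (hQ : 0 < Q) (hN : IsNoise μ P X Z)
    (hcard : 2 ≤ (candidates K Q).card) {ε : ℝ} (hε : 0 < ε) (hμε : ∀ i, ε ≤ μ i) (T : ℕ) :
    occ' T (fun s _ => ind (Below θ Q s)) ≤ ENNReal.ofReal ((candidates K Q).card / ε) := by
  have hε' : ENNReal.ofReal ε ≠ 0 := by simpa using hε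
  have key := occ_add_lintegral_le (order := order) (Q := Q) (W := W) hθ hN
    (g := fun s => ENNReal.ofReal ε * ind (Below θ Q s))
    -- The potential is the distance of the lower end from `|Θ|`. A loss in a `Below` round lowers
    -- it by at least one, and no transition raises it.
    (h := fun s : State K => (((candidates K Q).card - s.l : ℕ) : ℝ≥0∞)) (fun t s hs => ?_) T
  · rw [occ_const_mul hθ hN T _ fun s => measurable_const] at key
    have := le_self_add.trans key
    rw [mul_comm, ← ENNReal.le_div_iff_mul_le (Or.inl hε') (Or.inl ENNReal.ofReal_ne_top)] at this
    refine this.trans (le_of_eq ?_)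
    rw [ENNReal.ofReal_div_of_pos hε, ENNReal.ofReal_natCast]
    simp [State.init]
  · obtain ⟨h1, h2, h3, h4, h5, h6⟩ := bracket_state hθ hcard hs
    by_cases hB : Below θ Q s
    · set A := s.probed Q order with hA
      have hcA := card_probed order hQ (bracket_state hθ hcard hs) hB.1
      simp only [State.served_eq_probed hB.1, ← hA, ind_of hB, mul_one]
      have hmL := measurable_ind (measurableSet_lossIn hN t A)
      have hpt : ∀ ω, ind (LossIn A fun i => X t i ω) +
          (((candidates K Q).card - (s.next θ Q W A fun i => X t i ω).l : ℕ) : ℝ≥0∞) ≤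
          (((candidates K Q).card - s.l : ℕ) : ℝ≥0∞) := fun ω => by
        by_cases hL : LossIn A fun i => X t i ω
        · rw [ind_of hL, (State.next_of_loss (W := W) hB.1 hB.2 hL).1]
          norm_cast
          omega
        · rw [ind_of_not hL, zero_add]
          by_cases hC : W ≤ ((s.C + 1 : ℕ) : ℝ)
          · rw [(State.next_of_window hB.1 (fun h => hL h.2) hC).1]
          · rw [(State.next_of_wait hB.1 (fun h => hL h.2) hC).1]
      have e := lintegral_mono (μ := P) hpt
      rw [lintegral_add_left hmL, lintegral_ind (measurableSet_lossIn hN t A), lintegral_const,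
        measure_univ, mul_one] at e
      exact (add_le_add (le_measure_lossIn hN hμε t hcA.1) le_rfl).trans e
    · rw [ind_of_not hB, mul_zero, zero_add]
      have hpt : ∀ ω, (((candidates K Q).card - (s.next θ Q W
          (s.served Q order (samples Z t s ω)) fun i => X t i ω).l : ℕ) : ℝ≥0∞) ≤
          (((candidates K Q).card - s.l : ℕ) : ℝ≥0∞) := fun ω => by
        by_cases h : s.i = s.u
        · rw [(State.next_of_eq h _ _).1]
        have hx : ¬ (s.threshold Q < θ ∧ LossIn (s.served Q order (samples Z t s ω))
          fun i => X t i ω) := fun hx => hB ⟨h, hx.1⟩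
        by_cases hC : W ≤ ((s.C + 1 : ℕ) : ℝ)
        · rw [(State.next_of_window h hx hC).1]
        · rw [(State.next_of_wait h hx hC).1]
      have e := lintegral_mono (μ := P) hpt
      rwa [lintegral_const, measure_univ, mul_one] at e

/-- The probability that none of the probed arms has a loss. -/
lemma measure_not_lossIn_le [IsProbabilityMeasure P] (hN : IsNoise μ P X Z) {ε : ℝ}
    (hμ : ∀ i, μ i ∈ Set.Icc (0 : ℝ) 1) (hε1 : ε < 1) (hε : 0 < ε) (hμε : ∀ i, ε ≤ μ i) (t : ℕ)
    {A : Finset (Fin K)} (hA : Q ≤ A.card) :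
    P {ω | ¬ LossIn A fun i => X t i ω} ≤ ENNReal.ofReal ((1 - ε) ^ Q) := by
  have hset : {ω | ¬ LossIn A fun i => X t i ω} = ⋂ j ∈ A, X t j ⁻¹' {false} := by
    ext ω
    simp [LossIn]
  have hind : iIndepFun (fun i => X t i) P :=
    hN.indep_loss.precomp (g := fun i : Fin K => (t, i)) fun i j h => by
      simpa using congrArg Prod.snd h
  rw [hset, hind.measure_inter_preimage_eq_mul A fun _ _ => measurableSet_singleton false]
  have h1 : ∀ j ∈ A, P (X t j ⁻¹' {false}) ≤ ENNReal.ofReal (1 - ε) := fun j _ => by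
    have := measure_loss_false hN (fun i => (hμ i).1) t j
    rw [show X t j ⁻¹' {false} = {ω | X t j ω = false} from rfl, this]
    exact ENNReal.ofReal_le_ofReal (by linarith [hμε j])
  -- At least `Q` arms are probed, and the base `1 - ε` is at most one, so the integer exponent can
  -- be lowered to the real number `Q`.
  refine (Finset.prod_le_prod' h1).trans ?_
  rw [Finset.prod_const, ← ENNReal.ofReal_pow (by linarith), ← Real.rpow_natCast]
  exact ENNReal.ofReal_le_ofReal
    (Real.rpow_le_rpow_of_exponent_ge (by linarith) (by linarith) hA)

open Classical in
/-- A supermartingale that dominates the failure of the search. -/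
def risk (θ Q W r : ℝ) (s : State K) : ℝ :=
  if Failed θ Q s then 1 else ((s.u - s.l : ℕ) : ℝ) * r ^ windowRounds W +
    if Below θ Q s then r ^ (windowRounds W - s.C) else 0

/-- Every move of an end shortens the interval by at least one, and the released `r ^ windowRounds
W` pays for starting a new test with a fresh counter. -/
lemma risk_le_of_not_failed {r : ℝ} (hr : 0 ≤ r) {s : State K} (h : ¬ Failed θ Q s) (hC : s.C = 0) :
    risk θ Q W r s ≤ ((s.u - s.l + 1 : ℕ) : ℝ) * r ^ windowRounds W := by
  rw [risk, if_neg h, hC]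
  push_cast
  split_ifs
  · simp only [tsub_zero]
    linarith
  · have : 0 ≤ r ^ windowRounds W := by positivity
    linarith

/-- The one-step change of the risk. -/
lemma risk_next_le {r : ℝ} (hr : 0 ≤ r) {s : State K} (hs : s.Bracket θ Q W)
    (A : Finset (Fin K)) (x : Fin K → Bool) :
    (¬ (Below θ Q s ∧ ¬ Failed θ Q s) → risk θ Q W r (s.next θ Q W A x) ≤ risk θ Q W r s) ∧
    (Below θ Q s ∧ ¬ Failed θ Q s → risk θ Q W r (s.next θ Q W A x) ≤
      ((s.u - s.l : ℕ) : ℝ) * r ^ windowRounds W +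
        (open Classical in if LossIn A x then 0 else r ^ (windowRounds W - s.C - 1))) := by
  classical
  have hpw : 0 ≤ r ^ windowRounds W := by positivity
  have hcast : ∀ {a b : ℕ}, a ≤ b → (a : ℝ) * r ^ windowRounds W ≤ b * r ^ windowRounds W :=
    fun h => mul_le_mul_of_nonneg_right (by exact_mod_cast h) hpw
  obtain ⟨h1, h2, h3, h4, h5, h6⟩ := hs
  by_cases h : s.i = s.u
  · have hB : ¬ Below θ Q s := fun hB => hB.1 h
    obtain ⟨e1, e2, e3, e4⟩ := State.next_of_eq (θ := θ) (Q := Q) (W := W) h A x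
    refine ⟨fun _ => le_of_eq ?_, fun hB' => absurd hB'.1 hB⟩
    have hF' : Failed θ Q (s.next θ Q W A x) ↔ Failed θ Q s := by
      rw [Failed, Failed, e2]
    have hB' : Below θ Q (s.next θ Q W A x) ↔ Below θ Q s := by
      simp [Below, State.threshold, e2, e3]
    simp only [risk, hF', hB', e1, e2, e4]
  by_cases hx : s.threshold Q < θ ∧ LossIn A x
  · obtain ⟨e1, e2, e3, e4⟩ := State.next_of_loss (W := W) h hx.1 hx.2
    have hB : Below θ Q s := ⟨h, hx.1⟩
    by_cases hF : Failed θ Q s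
    · refine ⟨fun _ => le_of_eq ?_, fun hB' => absurd hF hB'.2⟩
      have hF' : Failed θ Q (s.next θ Q W A x) := by rw [Failed, e2]; exact hF
      rw [risk, risk, if_pos hF, if_pos hF']
    · have hF' : ¬ Failed θ Q (s.next θ Q W A x) := by rw [Failed, e2]; exact hF
      refine ⟨fun hc => absurd ⟨hB, hF⟩ hc, fun _ => ?_⟩
      rw [if_pos hx.2, add_zero]
      refine (risk_le_of_not_failed hr hF' e4).trans (hcast ?_)
      rw [e1, e2]
      omega
  by_cases hC : W ≤ ((s.C + 1 : ℕ) : ℝ)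
  · obtain ⟨e1, e2, e3, e4⟩ := State.next_of_window h hx hC
    -- The window is just being completed, so `r ^ (windowRounds W - C - 1) = 1`, which covers the
    -- jump of the risk to one if the test was below the threshold.
    have hw : windowRounds W = s.C + 1 := le_antisymm (windowRounds_le hC) h6
    by_cases hF : Failed θ Q s
    · refine ⟨fun _ => le_of_eq ?_, fun hB' => absurd hF hB'.2⟩
      have hF' : Failed θ Q (s.next θ Q W A x) := by
        rw [Failed, e2]
        exact (candidate_lt (by omega) (by omega) h3).trans hF
      rw [risk, risk, if_pos hF, if_pos hF']
    by_cases hB : s.threshold Q < θ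
    · refine ⟨fun hc => absurd ⟨⟨h, hB⟩, hF⟩ hc, fun _ => ?_⟩
      have hF' : Failed θ Q (s.next θ Q W A x) := by
        rw [Failed, e2]
        exact hB
      have hL : ¬ LossIn A x := fun hL => hx ⟨hB, hL⟩
      rw [risk, if_pos hF', if_neg hL, hw]
      simp only [add_tsub_cancel_left, tsub_self, pow_zero]
      have : 0 ≤ ((s.u - s.l : ℕ) : ℝ) * r ^ (s.C + 1) := by positivity
      linarith
    · refine ⟨fun _ => ?_, fun hB' => absurd hB'.1.2 hB⟩
      have hF' : ¬ Failed θ Q (s.next θ Q W A x) := by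
        rw [Failed, e2]
        exact hB
      refine (risk_le_of_not_failed hr hF' e4).trans ?_
      have hB' : ¬ Below θ Q s := fun hB' => hB hB'.2
      rw [risk, if_neg hF, if_neg hB', add_zero, e1, e2]
      exact hcast (by omega)
  · obtain ⟨e1, e2, e3, e4⟩ := State.next_of_wait h hx hC
    have hF' : Failed θ Q (s.next θ Q W A x) ↔ Failed θ Q s := by
      rw [Failed, Failed, e2]
    have hB' : Below θ Q (s.next θ Q W A x) ↔ Below θ Q s := by
      simp [Below, State.threshold, e2, e3]
    refine ⟨fun hc => le_of_eq ?_, fun hB => le_of_eq ?_⟩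
    · simp only [risk, hF', hB', e1, e2]
      by_cases hF : Failed θ Q s
      · rw [if_pos hF, if_pos hF]
      · have hB : ¬ Below θ Q s := fun hB => hc ⟨hB, hF⟩
        rw [if_neg hF, if_neg hF, if_neg hB, if_neg hB]
    · have hL : ¬ LossIn A x := fun hL => hx ⟨hB.1.2, hL⟩
      simp only [risk, hF', hB', e1, e2, e4, hB.1, hB.2, hL, if_true, if_false, Nat.sub_sub]

/-- The search rarely ends below the threshold. -/
lemma measure_failed_le [IsProbabilityMeasure P] (hθ : 0 < θ) (hθ1 : θ ≤ 1) (hQ : θ ≤ Q)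
    (hN : IsNoise μ P X Z) (hcard : 2 ≤ (candidates K Q).card)
    (hμ : ∀ i, μ i ∈ Set.Icc (0 : ℝ) 1) {ε : ℝ} (hε : 0 < ε) (hε1 : ε < 1) (hμε : ∀ i, ε ≤ μ i)
    (T : ℕ) : P {ω | Failed θ Q (st ω T)} ≤ ENNReal.ofReal (((candidates K Q).card + 1 : ℕ) *
      ((1 - ε) ^ Q) ^ windowRounds W) := by
  have hQ0 : 0 < Q := hθ.trans_le hQ
  set r : ℝ := (1 - ε) ^ Q with hr
  have hr0 : 0 ≤ r := Real.rpow_nonneg (by linarith) _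
  have key := occ_add_lintegral_le (order := order) (Q := Q) (W := W) hθ hN (g := fun _ => 0)
    (h := fun s : State K => ENNReal.ofReal (risk θ Q W r s)) (fun t s hs => ?_) T
  · refine le_trans ?_ ((le_add_self.trans key).trans (ENNReal.ofReal_le_ofReal ?_))
    · rw [← lintegral_ind (p := fun ω => Failed θ Q (st ω T)) (measurable_st hθ hN T
        (MeasurableSet.of_discrete (s := {s : State K | Failed θ Q s})))]
      refine lintegral_mono fun ω => ?_
      by_cases hF : Failed θ Q (st ω T)
      · rw [risk, if_pos hF, ind_of hF, ENNReal.ofReal_one]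
      · rw [ind_of_not hF]; exact zero_le
    · have hF : ¬ Failed θ Q (State.init K Q) := by
        rw [Failed, State.init, candidate_card]
        exact not_lt.2 (le_min hθ1 hQ)
      exact (risk_le_of_not_failed hr0 hF rfl).trans (le_of_eq (by simp [State.init]))
  · have hb := bracket_state hθ hcard hs
    rw [zero_add]
    by_cases hB : Below θ Q s ∧ ¬ Failed θ Q s
    swap
    · refine (lintegral_mono fun ω => ENNReal.ofReal_le_ofReal
        ((risk_next_le hr0 hb _ _).1 hB)).trans ?_
      rw [lintegral_const, measure_univ, mul_one]
    set A := s.probed Q order with hA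
    have hcA := card_probed order hQ0 hb hB.1.1
    simp only [State.served_eq_probed hB.1.1, ← hA]
    -- The counter invariant gives `C < windowRounds W`. A silent round has conditional probability
    -- at most `r`, which restores the missing factor in `r ^ (windowRounds W - C)`.
    have hw : windowRounds W - s.C = (windowRounds W - s.C - 1) + 1 := by
      have := hb.count
      omega
    calc _ ≤ ∫⁻ ω, (ENNReal.ofReal (((s.u - s.l : ℕ) : ℝ) * r ^ windowRounds W) +
          ENNReal.ofReal (r ^ (windowRounds W - s.C - 1)) *
            ind (¬ LossIn A fun i => X t i ω)) ∂P := by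
          refine lintegral_mono fun ω => ?_
          refine (ENNReal.ofReal_le_ofReal ((risk_next_le hr0 hb A _).2 hB)).trans ?_
          rw [ENNReal.ofReal_add (by positivity) (by split_ifs <;> positivity)]
          refine add_le_add le_rfl (le_of_eq ?_)
          by_cases hL : LossIn A fun i => X t i ω
          · rw [if_pos hL, ind_of_not (not_not.2 hL), mul_zero, ENNReal.ofReal_zero]
          · rw [if_neg hL, ind_of hL, mul_one]
      _ = ENNReal.ofReal (((s.u - s.l : ℕ) : ℝ) * r ^ windowRounds W) +
          ENNReal.ofReal (r ^ (windowRounds W - s.C - 1)) *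
            P {ω | ¬ LossIn A fun i => X t i ω} := by
          have hm := (measurableSet_lossIn hN t A).compl
          rw [lintegral_add_left measurable_const, lintegral_const, measure_univ, mul_one,
            lintegral_const_mul _ (measurable_ind (p := fun ω => ¬ LossIn A fun i => X t i ω) hm),
            lintegral_ind (p := fun ω => ¬ LossIn A fun i => X t i ω) hm]
      _ ≤ ENNReal.ofReal (((s.u - s.l : ℕ) : ℝ) * r ^ windowRounds W) +
          ENNReal.ofReal (r ^ (windowRounds W - s.C - 1)) * ENNReal.ofReal r := by
          gcongr
          exact measure_not_lossIn_le hN hμ hε1 hε hμε t hcA.2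
      _ = ENNReal.ofReal (risk θ Q W r s) := by
          rw [← ENNReal.ofReal_mul (by positivity), ← pow_succ, ← hw,
            ← ENNReal.ofReal_add (by positivity) (by positivity), risk, if_neg hB.2, if_pos hB.1]

end SearchBounds

/-! ### Gaps of allocations -/

section Gap

variable {K : ℕ} {μ : Fin K → ℝ} {θ Q W : ℝ} {order : Equiv.Perm (Fin K)}

lemma meanLoss_eq_sum (μ : Fin K → ℝ) (θ : ℝ) (a : Fin K → ℝ) :
    meanLoss μ θ a = ∑ i with a i < θ, μ i := by
  simp [meanLoss, Finset.sum_filter]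

lemma meanLoss_nonneg (hμ : ∀ i, μ i ∈ Set.Icc (0 : ℝ) 1) (a : Fin K → ℝ) :
    0 ≤ meanLoss μ θ a := by
  rw [meanLoss_eq_sum]
  exact Finset.sum_nonneg fun i _ => (hμ i).1

lemma meanLoss_le (hμ : ∀ i, μ i ∈ Set.Icc (0 : ℝ) 1) (a : Fin K → ℝ) :
    meanLoss μ θ a ≤ K := by
  rw [meanLoss_eq_sum]
  refine (Finset.sum_le_card_nsmul _ _ 1 fun i _ => (hμ i).2).trans ?_
  rw [nsmul_eq_mul, mul_one, Nat.cast_le]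
  simpa using Finset.card_le_univ (Finset.univ.filter fun i => a i < θ)

lemma bddBelow_meanLoss (hμ : ∀ i, μ i ∈ Set.Icc (0 : ℝ) 1) (θ Q : ℝ) :
    BddBelow (meanLoss μ θ '' feasible K Q) :=
  ⟨0, by rintro _ ⟨a, -, rfl⟩; exact meanLoss_nonneg hμ a⟩

lemma zero_mem_feasible (hQ : 0 ≤ Q) : (0 : Fin K → ℝ) ∈ feasible K Q :=
  ⟨fun _ => ⟨le_rfl, zero_le_one⟩, by simpa using hQ⟩

lemma gap_nonneg (hμ : ∀ i, μ i ∈ Set.Icc (0 : ℝ) 1) {a : Fin K → ℝ} (ha : a ∈ feasible K Q) :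
    0 ≤ gap μ θ Q a :=
  sub_nonneg.2 (csInf_le (bddBelow_meanLoss hμ θ Q) ⟨a, ha, rfl⟩)

lemma optLoss_nonneg (hμ : ∀ i, μ i ∈ Set.Icc (0 : ℝ) 1) (θ Q : ℝ) : 0 ≤ optLoss μ θ Q :=
  Real.sInf_nonneg (by rintro _ ⟨a, -, rfl⟩; exact meanLoss_nonneg hμ a)

lemma gap_le_card (hμ : ∀ i, μ i ∈ Set.Icc (0 : ℝ) 1) (a : Fin K → ℝ) : gap μ θ Q a ≤ K :=
  (sub_le_self _ (optLoss_nonneg hμ θ Q)).trans (meanLoss_le hμ a)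

lemma gap_le_maxGap (hμ : ∀ i, μ i ∈ Set.Icc (0 : ℝ) 1) {a : Fin K → ℝ} (ha : a ∈ feasible K Q) :
    gap μ θ Q a ≤ maxGap μ θ Q :=
  le_csSup ⟨K, by rintro _ ⟨a, -, rfl⟩; exact gap_le_card hμ a⟩ ⟨a, ha, rfl⟩

lemma maxGap_nonneg (hμ : ∀ i, μ i ∈ Set.Icc (0 : ℝ) 1) (hQ : 0 ≤ Q) : 0 ≤ maxGap μ θ Q :=
  (gap_nonneg hμ (zero_mem_feasible hQ)).trans (gap_le_maxGap hμ (zero_mem_feasible hQ))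

/-- A set with the smallest means has the smallest total mean among the sets which are at least
as large. -/
lemma sum_le_sum_of_card_le {O L : Finset (Fin K)} {c : ℝ} (hc : 0 ≤ c) (hO : ∀ i ∈ O, μ i ≤ c)
    (hO' : ∀ i ∉ O, c ≤ μ i) (h : O.card ≤ L.card) : ∑ i ∈ O, μ i ≤ ∑ i ∈ L, μ i := by
  rw [← Finset.sum_inter_add_sum_sdiff O L, ← Finset.sum_inter_add_sum_sdiff L O,
    Finset.inter_comm L O]
  have hcard : (O \ L).card ≤ (L \ O).card := by
    have := Finset.card_sdiff_add_card_inter O L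
    have := Finset.card_sdiff_add_card_inter L O
    rw [Finset.inter_comm L O] at this
    omega
  have h1 : ∑ i ∈ O \ L, μ i ≤ (O \ L).card * c := by
    rw [← nsmul_eq_mul]
    exact Finset.sum_le_card_nsmul _ _ _ fun i hi => hO i (Finset.mem_sdiff.1 hi).1
  have h2 : (L \ O).card * c ≤ ∑ i ∈ L \ O, μ i := by
    rw [← nsmul_eq_mul]
    exact Finset.card_nsmul_le_sum _ _ _ fun i hi => hO' i (Finset.mem_sdiff.1 hi).2
  have h3 : ((O \ L).card : ℝ) * c ≤ (L \ O).card * c :=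
    mul_le_mul_of_nonneg_right (by exact_mod_cast hcard) hc
  linarith

variable {p : Fin K}

lemma mem_Iic_le (hmono : Monotone μ) : ∀ i ∈ Finset.Iic p, μ i ≤ μ p :=
  fun _ hi => hmono (Finset.mem_Iic.1 hi)

lemma le_of_notMem_Iic (hmono : Monotone μ) : ∀ i ∉ Finset.Iic p, μ p ≤ μ i :=
  fun _ hi => hmono (not_le.1 fun h => hi (Finset.mem_Iic.2 h)).le

/-- At most `⌊Q / θ⌋` arms can receive `θ`, so at least `K - M` stay uncovered, and the arms up to
`p` are the cheapest choice. For an upper bound on the regret only this direction is needed. -/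
lemma sum_Iic_le_optLoss (hμ : ∀ i, μ i ∈ Set.Icc (0 : ℝ) 1) (hmono : Monotone μ) (hθ : 0 < θ)
    (hQ : θ ≤ Q) (hp : (p : ℕ) + 1 + numCovered K θ Q = K) :
    ∑ i ∈ Finset.Iic p, μ i ≤ optLoss μ θ Q := by
  refine le_csInf ⟨_, _, zero_mem_feasible (hθ.le.trans hQ), rfl⟩ ?_
  rintro _ ⟨a, ha, rfl⟩
  rw [meanLoss_eq_sum]
  refine sum_le_sum_of_card_le (hμ p).1 (mem_Iic_le hmono) (le_of_notMem_Iic hmono) ?_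
  have h1 := Finset.card_filter_add_card_filter_not (s := Finset.univ) fun i => a i < θ
  rw [Finset.card_univ, Fintype.card_fin] at h1
  have h2 : ((Finset.univ.filter fun i => ¬ a i < θ).card : ℝ) * θ ≤ Q := by
    refine le_trans ?_ ha.2
    rw [← nsmul_eq_mul]
    refine (Finset.card_nsmul_le_sum _ a θ fun i hi =>
      not_lt.1 (Finset.mem_filter.1 hi).2).trans ?_
    exact Finset.sum_le_sum_of_subset_of_nonneg (Finset.subset_univ _) fun i _ _ => (ha.1 i).1
  have h3 : (Finset.univ.filter fun i => ¬ a i < θ).card ≤ ⌊Q / θ⌋₊ :=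
    Nat.le_floor ((le_div_iff₀ hθ).2 h2)
  rw [Fin.card_Iic]
  rw [numCovered] at hp
  omega

lemma candidate_pos (hQ : 0 < Q) {i : ℕ} (h1 : 1 ≤ i) (h2 : i ≤ (candidates K Q).card) :
    0 < candidate K Q i := by
  rcases mem_candidates.1 (candidate_mem h1 h2) with h | ⟨⟨m, hm1, -, hm⟩, -⟩
  · rw [h]
    exact lt_min one_pos hQ
  · rw [← hm]
    have : (0 : ℝ) < m := by exact_mod_cast hm1
    positivity

lemma card_served_le (s : State K) (z : Fin K → ℝ) :
    (s.served Q order z).card ≤ s.numServed Q := by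
  unfold State.served
  split_ifs
  · have e : (Finset.univ.filter fun j => ((order j : Fin K) : ℕ) < s.numServed Q) =
        (Finset.univ.filter fun j : Fin K => (j : ℕ) < s.numServed Q).map
          order.symm.toEmbedding := by
      ext j
      simp
    rw [e, Finset.card_map, Fin.card_filter_val_lt]
    exact min_le_right _ _
  · rw [Finset.card_compl, card_smallest order (Nat.sub_le _ _), Fintype.card_fin]
    omega

lemma alloc_mem_feasible (hQ : 0 < Q) {s : State K} (hs : s.Bracket θ Q W) (z : Fin K → ℝ) :
    s.alloc Q order z ∈ feasible K Q := by
  have h1 : 1 ≤ s.i := by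
    have := hs.lt
    omega
  have h2 : s.i ≤ (candidates K Q).card := hs.le.trans hs.le_card
  have hpos : 0 < s.threshold Q := candidate_pos hQ h1 h2
  have hle : s.threshold Q ≤ min 1 Q := le_of_mem_candidates (candidate_mem h1 h2)
  constructor
  · intro j
    unfold State.alloc
    split_ifs
    exacts [⟨hpos.le, hle.trans (min_le_left _ _)⟩, ⟨le_rfl, zero_le_one⟩]
  · have : ∑ j, s.alloc Q order z j = (s.served Q order z).card * s.threshold Q := by
      simp [State.alloc]
    rw [this, ← le_div_iff₀ hpos]
    have h3 : ((s.served Q order z).card : ℝ) ≤ s.numServed Q :=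
      Nat.cast_le.2 (card_served_le s z)
    exact h3.trans (Nat.floor_le (by positivity))

/-- The gap in a round with a good threshold estimate. -/
lemma Good.gap_le (hμ : ∀ i, μ i ∈ Set.Icc (0 : ℝ) 1) (hmono : Monotone μ) (hθ : 0 < θ)
    (hQ : θ ≤ Q) (hp : (p : ℕ) + 1 + numCovered K θ Q = K) {s : State K}
    (hs : Good θ Q (numCovered K θ Q) s) (z : Fin K → ℝ) :
    gap μ θ Q (s.alloc Q order z) ≤
      ∑ i ∈ smallest order (Finset.Iic p).card z, μ i - ∑ i ∈ Finset.Iic p, μ i := by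
  have hO : K - numCovered K θ Q = (Finset.Iic p).card := by
    rw [Fin.card_Iic]
    omega
  refine sub_le_sub (le_of_eq ?_) (sum_Iic_le_optLoss hμ hmono hθ hQ hp)
  rw [meanLoss_eq_sum]
  congr 1
  ext j
  rw [← hs.played_iff hO j z, Finset.mem_filter]
  simp only [Finset.mem_univ, true_and, State.alloc, Played, hs.1]
  split_ifs with h
  · simp [h, hs.2.2]
  · simp [h, hθ]

/-- The excess loss of the arms with the smallest samples: with accurate samples of the optimal
arms and at most one small sample of a suboptimal arm, it is at most the excess of that arm. -/
lemma excess_le (hmono : Monotone μ) {z : Fin K → ℝ} {η y : ℝ} (hy : μ p + 2 * η ≤ y)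
    (hacc : ∀ i ∉ Finset.Iic p, i ∈ smallest order (Finset.Iic p).card z →
      ∀ j ∈ Finset.Iic p, |z j - μ j| ≤ 2 * η)
    (hone : ∀ i ∉ Finset.Iic p, ∀ i' ∉ Finset.Iic p, i ≠ i' →
      i ∈ smallest order (Finset.Iic p).card z → i' ∈ smallest order (Finset.Iic p).card z →
      z i ≤ y → ¬ z i' ≤ y) :
    ∑ i ∈ smallest order (Finset.Iic p).card z, μ i - ∑ i ∈ Finset.Iic p, μ i ≤ 0 ∨
      ∃ i ∉ Finset.Iic p, i ∈ smallest order (Finset.Iic p).card z ∧ z i ≤ μ p + 2 * η ∧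
        ∑ i ∈ smallest order (Finset.Iic p).card z, μ i - ∑ i ∈ Finset.Iic p, μ i ≤
          μ i - μ p + 4 * η := by
  set O := Finset.Iic p with hO
  set L := smallest order O.card z with hL
  have hcard : L.card = O.card :=
    card_smallest order (by simpa using Finset.card_le_univ O) z
  have hLO : (L \ O).card = (O \ L).card := by
    have h1 := Finset.card_sdiff_add_card_inter O L
    have h2 := Finset.card_sdiff_add_card_inter L O
    rw [Finset.inter_comm L O] at h2
    omega
  have hsum : ∑ i ∈ L, μ i - ∑ i ∈ O, μ i = ∑ i ∈ L \ O, μ i - ∑ i ∈ O \ L, μ i := by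
    rw [← Finset.sum_inter_add_sum_sdiff O L, ← Finset.sum_inter_add_sum_sdiff L O,
      Finset.inter_comm L O]
    ring
  rw [hsum]
  rcases Finset.eq_empty_or_nonempty (L \ O) with h0 | ⟨i, hi⟩
  · left
    rw [h0, Finset.card_empty] at hLO
    rw [h0, Finset.card_eq_zero.1 hLO.symm]
    simp
  right
  obtain ⟨hiL, hiO⟩ := Finset.mem_sdiff.1 hi
  have hacc' := hacc i hiO hiL
  have hsmall : ∀ k ∈ L \ O, z k ≤ μ p + 2 * η := by
    intro k hk
    obtain ⟨hkL, hkO⟩ := Finset.mem_sdiff.1 hk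
    -- The displaced optimal arm `j` has an accurate sample, and `μ j ≤ μ p`; this caps the sample
    -- of the intruder `k`.
    obtain ⟨j, hjO, hj⟩ := exists_notMem_smallest hkO hkL
    have h1 := le_of_mem_of_notMem_smallest order hkL hj
    have h2 := (abs_le.1 (hacc' j hjO)).2
    have h3 := mem_Iic_le hmono j hjO
    linarith
  have hsingle : L \ O = {i} := by
    refine Finset.eq_singleton_iff_unique_mem.2 ⟨hi, fun k hk => ?_⟩
    by_contra hne
    obtain ⟨hkL, hkO⟩ := Finset.mem_sdiff.1 hk
    exact hone k hkO i hiO hne hkL hiL ((hsmall k hk).trans hy) ((hsmall i hi).trans hy)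
  refine ⟨i, hiO, hiL, hsmall i hi, ?_⟩
  rw [hsingle, Finset.card_singleton] at hLO
  obtain ⟨j, hj⟩ := Finset.card_eq_one.1 hLO.symm
  rw [hsingle, hj, Finset.sum_singleton, Finset.sum_singleton]
  obtain ⟨hjO, hjL⟩ := Finset.mem_sdiff.1 (hj ▸ Finset.mem_singleton_self j : j ∈ O \ L)
  have hpO : p ∈ O := Finset.mem_Iic.2 le_rfl
  have hη : 0 ≤ 2 * η := (abs_nonneg _).trans (hacc' p hpO)
  rcases eq_or_ne j p with rfl | hjp
  · linarith
  -- If the displaced arm `j` is not `p`, then `p` is selected ahead of it, so `z p ≤ z j`. Accuracy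
  -- of both samples gives `μ p ≤ μ j + 4 η`, which is why the excess compares with `μ p` and not
  -- with a smaller mean.
  · have hpL : p ∈ L := by
      by_contra hpL
      have : p ∈ O \ L := Finset.mem_sdiff.2 ⟨hpO, hpL⟩
      rw [hj, Finset.mem_singleton] at this
      exact hjp this.symm
    have h1 := le_of_mem_of_notMem_smallest order hpL hjL
    have h2 := (abs_le.1 (hacc' p hpO)).1
    have h3 := (abs_le.1 (hacc' j hjO)).2
    linarith

/-- The exceptional rounds: some optimal arm has few observations, or a sample of an optimal arm
is inaccurate, or two suboptimal arms have small samples. -/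
def exceptional (μ : Fin K → ℝ) (θ Q : ℝ) (order : Equiv.Perm (Fin K)) (O : Finset (Fin K))
    (M : ℕ) (y η r : ℝ) (s : State K) (z : Fin K → ℝ) : ℝ≥0∞ :=
  ∑ i ∈ Oᶜ, ∑ j ∈ O, ind (Good θ Q M s ∧ (s.obs j : ℝ) < r ∧ Played Q order i s z) +
    (∑ j ∈ O, ind (r ≤ s.obs j ∧ 2 * η < |z j - μ j|) +
    ∑ i ∈ Oᶜ, ∑ i' ∈ Oᶜ.erase i, ind (Good θ Q M s ∧ Played Q order i s z ∧
      Played Q order i' s z ∧ z i ≤ y ∧ z i' ≤ y))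

/-- The quantity `exceptional` is a sum of indicators: either it vanishes, and `excess_le` applies,
or it is at least one, and the trivial bound `K` on the gap suffices. -/
lemma Good.ofReal_gap_le (hμ : ∀ i, μ i ∈ Set.Icc (0 : ℝ) 1) (hmono : Monotone μ) (hθ : 0 < θ)
    (hQ : θ ≤ Q) (hp : (p : ℕ) + 1 + numCovered K θ Q = K) {s : State K}
    (hs : Good θ Q (numCovered K θ Q) s) (z : Fin K → ℝ) {η y : ℝ} (hy : μ p + 2 * η ≤ y)
    (r : ℝ) : ENNReal.ofReal (gap μ θ Q (s.alloc Q order z)) ≤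
      ∑ i ∈ (Finset.Iic p)ᶜ, ENNReal.ofReal (μ i - μ p + 4 * η) *
        ind (Played Q order i s z ∧ z i ≤ μ p + 2 * η) +
      K * exceptional μ θ Q order (Finset.Iic p) (numCovered K θ Q) y η r s z := by
  have hO : K - numCovered K θ Q = (Finset.Iic p).card := by
    rw [Fin.card_Iic]
    omega
  have hg := hs.gap_le (order := order) hμ hmono hθ hQ hp z
  have hcrude : ENNReal.ofReal (gap μ θ Q (s.alloc Q order z)) ≤ K := by
    rw [← ENNReal.ofReal_natCast]
    exact ENNReal.ofReal_le_ofReal (gap_le_card hμ _)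
  set O := Finset.Iic p
  by_cases hE : exceptional μ θ Q order O (numCovered K θ Q) y η r s z = 0
  swap
  · refine hcrude.trans (le_trans ?_ le_add_self)
    refine le_mul_of_one_le_right zero_le ?_
    by_contra hlt
    refine hE ?_
    have hlt' := not_le.1 hlt
    have zero_of_lt : ∀ q : Prop, ind q < 1 → ind q = 0 := fun q hq => by
      by_cases h : q
      · rw [ind_of h] at hq; exact absurd hq (lt_irrefl _)
      · exact ind_of_not h
    unfold exceptional at hlt' ⊢
    have a1 := lt_of_le_of_lt le_self_add hlt'
    have a2 := lt_of_le_of_lt le_self_add (lt_of_le_of_lt le_add_self hlt')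
    have a3 := lt_of_le_of_lt le_add_self (lt_of_le_of_lt le_add_self hlt')
    have single : ∀ {f : Fin K → ℝ≥0∞} {S : Finset (Fin K)}, ∑ i ∈ S, f i < 1 →
        ∀ i ∈ S, f i < 1 := fun h i hi =>
      (Finset.single_le_sum (fun _ _ => zero_le) hi).trans_lt h
    rw [Finset.sum_eq_zero fun i hi => Finset.sum_eq_zero fun j hj =>
        zero_of_lt _ (single (single a1 i hi) j hj),
      Finset.sum_eq_zero fun j hj => zero_of_lt _ (single a2 j hj),
      Finset.sum_eq_zero fun i hi => Finset.sum_eq_zero fun j hj =>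
        zero_of_lt _ (single (single a3 i hi) j hj)]
    simp
  refine le_trans ?_ le_self_add
  have ind_ne : ∀ {q : Prop}, ind q = 0 → ¬ q := fun h hq => by simp [ind_of hq] at h
  simp only [exceptional, add_eq_zero, Finset.sum_eq_zero_iff] at hE
  obtain ⟨e1, e2, e3⟩ := hE
  have hpl := fun i => hs.played_iff (order := order) hO i z
  rcases excess_le (order := order) hmono hy (z := z)
    (fun i hi hiL j hj => by
      have h1 := ind_ne (e1 i (Finset.mem_compl.2 hi) j hj)
      have h2 := ind_ne (e2 j hj)
      have hr : r ≤ s.obs j := by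
        by_contra hcon
        exact h1 ⟨hs, not_le.1 hcon, (hpl i).2 hiL⟩
      by_contra hcon
      exact h2 ⟨hr, not_le.1 hcon⟩)
    (fun i hi i' hi' hne hiL hiL' hz hz' => ind_ne (e3 i (Finset.mem_compl.2 hi) i'
      (Finset.mem_erase.2 ⟨hne.symm, Finset.mem_compl.2 hi'⟩))
        ⟨hs, (hpl i).2 hiL, (hpl i').2 hiL', hz, hz'⟩) with h | ⟨i, hi, hiL, hz, h⟩
  · rw [ENNReal.ofReal_of_nonpos (hg.trans h)]
    exact zero_le
  · refine le_trans ?_ (Finset.single_le_sum (fun _ _ => zero_le) (Finset.mem_compl.2 hi))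
    rw [ind_of ⟨(hpl i).2 hiL, hz⟩, mul_one]
    exact ENNReal.ofReal_le_ofReal (hg.trans h)

end Gap

/-! ### Growth of the error bounds -/

open Filter Topology

open scoped NNReal

/-- `f` grows at most like the `k`-th power. -/
def GrowthLE (k : ℕ) (f : ℝ → ℝ≥0∞) : Prop :=
  ∃ C : ℝ≥0, ∀ᶠ x : ℝ in atTop, f x ≤ C * ENNReal.ofReal (x ^ k)

lemma GrowthLE.mono {k : ℕ} {f g : ℝ → ℝ≥0∞} (hg : GrowthLE k g) (h : ∀ᶠ x in atTop, f x ≤ g x) :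
    GrowthLE k f := by
  obtain ⟨C, hC⟩ := hg
  refine ⟨C, ?_⟩
  filter_upwards [hC, h] with x h1 h2 using h2.trans h1

lemma GrowthLE.of_le {k l : ℕ} {f : ℝ → ℝ≥0∞} (hf : GrowthLE k f) (h : k ≤ l) : GrowthLE l f := by
  obtain ⟨C, hC⟩ := hf
  refine ⟨C, ?_⟩
  filter_upwards [hC, eventually_ge_atTop 1] with x h1 h2
  refine h1.trans ?_
  gcongr

lemma GrowthLE.add {k : ℕ} {f g : ℝ → ℝ≥0∞} (hf : GrowthLE k f) (hg : GrowthLE k g) :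
    GrowthLE k fun x => f x + g x := by
  obtain ⟨C, hC⟩ := hf
  obtain ⟨D, hD⟩ := hg
  refine ⟨C + D, ?_⟩
  filter_upwards [hC, hD] with x h1 h2
  rw [ENNReal.coe_add, add_mul]
  exact add_le_add h1 h2

lemma growthLE_const {c : ℝ≥0∞} (hc : c ≠ ∞) (k : ℕ) : GrowthLE k fun _ => c := by
  refine ⟨c.toNNReal, ?_⟩
  filter_upwards [eventually_ge_atTop 1] with x hx
  rw [ENNReal.coe_toNNReal hc]
  refine le_mul_of_one_le_right zero_le ?_
  rw [ENNReal.one_le_ofReal]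
  exact one_le_pow₀ hx

lemma GrowthLE.const_mul {k : ℕ} {f : ℝ → ℝ≥0∞} (hf : GrowthLE k f) {c : ℝ≥0∞} (hc : c ≠ ∞) :
    GrowthLE k fun x => c * f x := by
  obtain ⟨C, hC⟩ := hf
  refine ⟨c.toNNReal * C, ?_⟩
  filter_upwards [hC] with x h
  rw [ENNReal.coe_mul, ENNReal.coe_toNNReal hc, mul_assoc]
  gcongr

lemma GrowthLE.sum {ι : Type*} {k : ℕ} {s : Finset ι} {f : ι → ℝ → ℝ≥0∞}
    (hf : ∀ i ∈ s, GrowthLE k (f i)) : GrowthLE k fun x => ∑ i ∈ s, f i x := by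
  classical
  induction s using Finset.induction_on with
  | empty => simpa using growthLE_const ENNReal.zero_ne_top k
  | insert i s hi ih =>
    simp only [Finset.sum_insert hi]
    exact (hf i (Finset.mem_insert_self _ _)).add (ih fun j hj => hf j (Finset.mem_insert_of_mem hj))

lemma growthLE_ofReal {k : ℕ} {f : ℝ → ℝ} (C : ℝ) (h : ∀ᶠ x in atTop, f x ≤ C * x ^ k) :
    GrowthLE k fun x => ENNReal.ofReal (f x) := by
  refine ⟨C.toNNReal, ?_⟩
  filter_upwards [h, eventually_ge_atTop 0] with x hx h0
  rw [← ENNReal.ofReal, ← ENNReal.ofReal_mul' (by positivity)]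
  exact ENNReal.ofReal_le_ofReal hx

lemma growthLE_misledBound (δ : ℝ) : GrowthLE 2 fun x => misledBound δ (x ^ 2) := by
  refine GrowthLE.add (growthLE_ofReal 2 ?_) (growthLE_const ENNReal.ofReal_ne_top 2)
  filter_upwards [eventually_ge_atTop 1] with x hx
  nlinarith

/-- `exp (-c x ^ 2) * x ^ 6` is bounded because `exp t ≥ t ^ 3 / 6`. The power `6` leaves room for
the waiting time of order `x ^ 5` and the play count of order `x ^ 3`. -/
lemma growthLE_deviation_mul {δ : ℝ} (hδ : 0 < δ) {f : ℝ → ℝ≥0∞} (hf : GrowthLE 6 f) :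
    GrowthLE 2 fun x => ENNReal.ofReal (deviation δ (x ^ 2)) * f x := by
  obtain ⟨C, hC⟩ := hf
  have ha : 0 < δ ^ 2 / 8 := by positivity
  refine GrowthLE.of_le (k := 0) ⟨(6 / (δ ^ 2 / 8) ^ 3 * (2 * (1 + 8 / δ ^ 2))).toNNReal * C, ?_⟩
    (by omega)
  filter_upwards [hC, eventually_gt_atTop 0] with x h hx
  calc ENNReal.ofReal (deviation δ (x ^ 2)) * f x
      ≤ ENNReal.ofReal (deviation δ (x ^ 2)) * (C * ENNReal.ofReal (x ^ 6)) := by gcongr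
    _ = ENNReal.ofReal (deviation δ (x ^ 2) * x ^ 6) * C := by
        rw [ENNReal.ofReal_mul (deviation_nonneg _ _)]
        ring
    _ ≤ _ := by
        rw [pow_zero, ENNReal.ofReal_one, mul_one, ENNReal.coe_mul, ← ENNReal.ofReal]
        refine mul_le_mul_left (ENNReal.ofReal_le_ofReal ?_) _
        have h1 := Real.pow_div_factorial_le_exp (x := x ^ 2 * (δ ^ 2 / 8)) (by positivity) 3
        have h3 : Nat.factorial 3 = 6 := rfl
        rw [h3] at h1
        push_cast at h1
        have h2 : Real.exp (-(x ^ 2 * δ ^ 2 / 8)) * x ^ 6 ≤ 6 / (δ ^ 2 / 8) ^ 3 := by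
          rw [Real.exp_neg, ← div_eq_inv_mul, div_le_div_iff₀ (Real.exp_pos _) (by positivity)]
          rw [div_le_iff₀ (by norm_num)] at h1
          calc x ^ 6 * (δ ^ 2 / 8) ^ 3 = (x ^ 2 * (δ ^ 2 / 8)) ^ 3 := by ring
            _ ≤ Real.exp (x ^ 2 * (δ ^ 2 / 8)) * 6 := h1
            _ = 6 * Real.exp (x ^ 2 * δ ^ 2 / 8) := by rw [mul_comm, mul_div_assoc]
        calc deviation δ (x ^ 2) * x ^ 6 =
            Real.exp (-(x ^ 2 * δ ^ 2 / 8)) * x ^ 6 * (2 * (1 + 8 / δ ^ 2)) := by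
              rw [deviation]; ring
          _ ≤ _ := by gcongr

lemma tendsto_deviation {δ : ℝ} (hδ : 0 < δ) : Tendsto (deviation δ) atTop (𝓝 0) := by
  have h1 : Tendsto (fun n : ℝ => n * δ ^ 2 / 8) atTop atTop := by
    refine (tendsto_id.atTop_mul_const (by positivity : 0 < δ ^ 2 / 8)).congr fun n => ?_
    simp only [id]
    ring
  have := (Real.tendsto_exp_neg_atTop_nhds_zero.comp h1).mul_const (2 * (1 + 8 / δ ^ 2))
  rwa [zero_mul] at this

lemma eventually_deviation_le {δ : ℝ} (hδ : 0 < δ) {c : ℝ≥0∞} (hc : 0 < c) :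
    ∀ᶠ n in atTop, ENNReal.ofReal (deviation δ n) ≤ c := by
  have h := (ENNReal.continuous_ofReal.tendsto 0).comp (tendsto_deviation hδ)
  rw [ENNReal.ofReal_zero] at h
  exact (h.eventually_lt_const hc).mono fun n hn => hn.le

/-- Inaccurate samples of well observed arms. -/
lemma growthLE_late_deviation :
    GrowthLE 2 fun x => ENNReal.ofReal (Real.exp (x ^ 3)) *
      (2 * ENNReal.ofReal (deviation (1 / x) (16 * x ^ 5))) := by
  refine GrowthLE.of_le (k := 0) ⟨36, ?_⟩ (by omega)
  filter_upwards [eventually_gt_atTop 0] with x hx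
  rw [pow_zero, ENNReal.ofReal_one, mul_one]
  have h2 : (2 : ℝ≥0∞) = ENNReal.ofReal 2 := by simp
  have h36 : ((36 : ℝ≥0) : ℝ≥0∞) = ENNReal.ofReal 36 := by simp
  rw [h2, h36, ← ENNReal.ofReal_mul (by norm_num), ← ENNReal.ofReal_mul (Real.exp_pos _).le]
  refine ENNReal.ofReal_le_ofReal ?_
  -- The constant `16` makes the exponent `2 x ^ 3`: one copy cancels `T = exp (x ^ 3)`, the other
  -- absorbs the factor `1 + 8 x ^ 2`.
  have e1 : 16 * x ^ 5 * (1 / x) ^ 2 / 8 = x ^ 3 + x ^ 3 := by field_simp; ring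
  rw [deviation, e1, neg_add, Real.exp_add, one_div, inv_pow, div_inv_eq_mul]
  have e2 : Real.exp (x ^ 3) * Real.exp (-x ^ 3) = 1 := by
    rw [← Real.exp_add, add_neg_cancel, Real.exp_zero]
  have e3 : Real.exp (-x ^ 3) * (1 + 8 * x ^ 2) ≤ 9 := by
    have := Real.add_one_le_exp (x ^ 3)
    rw [Real.exp_neg, ← div_eq_inv_mul, div_le_iff₀ (Real.exp_pos _)]
    have h4 : x ^ 2 ≤ x ^ 3 + 1 := by
      rcases le_total x 1 with h | h
      · have : x ^ 2 ≤ 1 := pow_le_one₀ hx.le h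
        have : 0 < x ^ 3 := by positivity
        linarith
      · have := pow_le_pow_right₀ h (show 2 ≤ 3 by omega)
        linarith
    nlinarith [pow_pos hx 3]
  calc _ = 4 * (Real.exp (x ^ 3) * Real.exp (-x ^ 3)) *
        (Real.exp (-x ^ 3) * (1 + 8 * x ^ 2)) := by ring
    _ ≤ 36 := by rw [e2]; linarith

/-! ### The leading term -/

/-- The divergence is differentiable along the perturbations that are used. -/
lemma differentiableAt_klBer {u m : ℝ} (hm : 0 < m) (hm1 : m < 1) (hu : 0 < u) (hu1 : u ≤ 1) :
    DifferentiableAt ℝ (fun h => klBer (u - (1 - u) * h) (m + 2 * h)) 0 := by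
  -- The factor `1 - u` in the perturbation freezes the first argument when `u = 1`; moving it would
  -- meet the singularity of `t log t` at `0`.
  rcases hu1.eq_or_lt with rfl | hu1
  · have : (fun h : ℝ => klBer (1 - (1 - 1) * h) (m + 2 * h)) =
        fun h => Real.log (1 / (m + 2 * h)) := by
      funext h
      simp [klBer]
    rw [this]
    have h1 : m + 2 * (0 : ℝ) ≠ 0 := by simpa using hm.ne'
    have h2 : 1 / (m + 2 * (0 : ℝ)) ≠ 0 := one_div_ne_zero h1
    fun_prop (disch := assumption)
  · unfold klBer
    have h1 : m + 2 * (0 : ℝ) ≠ 0 := by simpa using hm.ne'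
    have h2 : 1 - (m + 2 * (0 : ℝ)) ≠ 0 := by
      have : 1 - m ≠ 0 := by linarith
      simpa using this
    have h3 : (u - (1 - u) * 0) / (m + 2 * (0 : ℝ)) ≠ 0 := div_ne_zero (by simpa using hu.ne') h1
    have h4 : (1 - (u - (1 - u) * 0)) / (1 - (m + 2 * (0 : ℝ))) ≠ 0 := by
      refine div_ne_zero ?_ h2
      have : 1 - u ≠ 0 := by linarith
      simpa using this
    fun_prop (disch := assumption)

/-- Differentiability at zero gives a Lipschitz bound along perturbations of size `1 / x`. -/
lemma klBer_perturb {u m : ℝ} (hm : 0 < m) (hm1 : m < 1) (hu : 0 < u) (hu1 : u ≤ 1) :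
    ∃ C, 0 ≤ C ∧ ∀ᶠ x : ℝ in atTop,
      klBer u m - C * (1 / x) ≤ klBer (u - (1 - u) * (1 / x)) (m + 2 * (1 / x)) := by
  obtain ⟨C, hC0, hC⟩ := (differentiableAt_klBer hm hm1 hu hu1).isBigO_sub.exists_nonneg
  have ht : Tendsto (fun x : ℝ => 1 / x) atTop (𝓝 0) := by
    simpa using tendsto_inv_atTop_zero (𝕜 := ℝ)
  refine ⟨C, hC0, ?_⟩
  filter_upwards [ht.eventually hC.bound, eventually_gt_atTop 0] with x hx h0
  simp only [mul_zero, sub_zero, add_zero, Real.norm_eq_abs] at hx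
  rw [abs_of_pos (by positivity : 0 < 1 / x)] at hx
  linarith [(abs_le.1 hx).1]

/-- A bound for the regret due to an arm of mean `u` with a small sample. -/
def leadingBound (u m x : ℝ) : ℝ :=
  (u - m + 4 * (1 / x)) *
    (x ^ 3 / (klBer (u - (1 - u) * (1 / x)) (m + 2 * (1 / x)) - 1 / x) + 1 +
      (2 * (1 + 4 / ((1 - u) * (1 / x)) ^ 2) + (1 + 1 / (1 / x))))

/-- The denominator is `d - O(1 / x)`, so the quotient is `x ^ 3 / d + O(x ^ 2)`; the prefactor
error `4 / x` times `x ^ 3` and the concentration cost `1 / (1 / x) ^ 2` are of order `x ^ 2` as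
well. This balance fixes the accuracy at `1 / x`. -/
lemma leadingBound_le {u m : ℝ} (hm : 0 < m) (hmu : m < u) (hu1 : u ≤ 1) :
    ∃ C, ∀ᶠ x : ℝ in atTop,
      1 / x < klBer (u - (1 - u) * (1 / x)) (m + 2 * (1 / x)) ∧
      leadingBound u m x ≤ (u - m) * x ^ 3 / klBer u m + C * x ^ 2 := by
  have hm1 : m < 1 := hmu.trans_le hu1
  obtain ⟨C, hC0, hC⟩ := klBer_perturb hm hm1 (hm.trans hmu) hu1
  set d := klBer u m with hd
  have hd0 : 0 < d := klBer_pos (hm.trans hmu) hu1 hm hm1 hmu.ne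
  have ht : Tendsto (fun x : ℝ => 1 / x) atTop (𝓝 0) := by
    simpa using tendsto_inv_atTop_zero (𝕜 := ℝ)
  have ht2 : Tendsto (fun x : ℝ => (C + 1) * (1 / x)) atTop (𝓝 0) := by
    simpa using ht.const_mul (C + 1)
  refine ⟨4 / d + 5 * (2 * (C + 1) / d ^ 2 + 8 / (1 - u) ^ 2 + 5), ?_⟩
  filter_upwards [hC, ht2.eventually_lt_const (half_pos hd0), eventually_ge_atTop 1]
    with x h1 h2 hx
  have hx0 : 0 < x := by linarith
  set e := klBer (u - (1 - u) * (1 / x)) (m + 2 * (1 / x)) - 1 / x with he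
  have he1 : d - (C + 1) * (1 / x) ≤ e := by rw [he]; linarith
  have he0 : d / 2 < e := by linarith
  refine ⟨by linarith, ?_⟩
  have k1 : x ^ 3 / e ≤ x ^ 3 / d + 2 * (C + 1) / d ^ 2 * x ^ 2 := by
    rw [div_le_iff₀ (by linarith)]
    have a1 : (x ^ 3 / d + 2 * (C + 1) / d ^ 2 * x ^ 2) * (d - (C + 1) * (1 / x)) =
        x ^ 3 + (C + 1) * x ^ 2 * (d - 2 * ((C + 1) * (1 / x))) / d ^ 2 := by
      field_simp
      ring
    have a2 : 0 ≤ (C + 1) * x ^ 2 * (d - 2 * ((C + 1) * (1 / x))) / d ^ 2 := by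
      have : 0 ≤ d - 2 * ((C + 1) * (1 / x)) := by linarith
      positivity
    calc x ^ 3 ≤ (x ^ 3 / d + 2 * (C + 1) / d ^ 2 * x ^ 2) * (d - (C + 1) * (1 / x)) := by
          rw [a1]; linarith
      _ ≤ _ := by gcongr
  -- For `u = 1` both sides are zero by the convention for division; this matches
  -- `binomSum_lt_shrink_le`, where the sum then vanishes.
  have k2 : 4 / ((1 - u) * (1 / x)) ^ 2 = 4 / (1 - u) ^ 2 * x ^ 2 := by
    rw [mul_pow, one_div, inv_pow, ← div_div, div_inv_eq_mul]
  have k3 : 1 / x ≤ 1 := by rw [div_le_one hx0]; exact hx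
  have k4 : 0 < 1 / x := by positivity
  have hx2 : 1 ≤ x ^ 2 := one_le_pow₀ hx
  have hxx : x ≤ x ^ 2 := by nlinarith
  have hq : 0 ≤ 4 / (1 - u) ^ 2 := by positivity
  rw [leadingBound, ← he, k2, one_div_one_div]
  set A := 2 * (C + 1) / d ^ 2 with hA
  have hA0 : 0 ≤ A := by positivity
  set B := 4 / (1 - u) ^ 2 with hB
  have hB8 : 8 / (1 - u) ^ 2 = 2 * B := by rw [hB]; ring
  rw [hB8]
  have k5 : x ^ 3 / e + 1 + (2 * (1 + B * x ^ 2) + (1 + x)) ≤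
      x ^ 3 / d + (A + 2 * B + 5) * x ^ 2 := by nlinarith
  have k6 : 0 ≤ (A + 2 * B + 5) * x ^ 2 := by positivity
  calc _ ≤ (u - m + 4 * (1 / x)) * (x ^ 3 / d + (A + 2 * B + 5) * x ^ 2) :=
        mul_le_mul_of_nonneg_left k5 (by linarith)
    _ = (u - m) * x ^ 3 / d + 4 / d * x ^ 2 +
        (u - m + 4 * (1 / x)) * ((A + 2 * B + 5) * x ^ 2) := by
        field_simp
    _ ≤ (u - m) * x ^ 3 / d + 4 / d * x ^ 2 + 5 * ((A + 2 * B + 5) * x ^ 2) := by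
        gcongr
        linarith
    _ = _ := by ring

/-! ### The expected regret -/

lemma binomSum_lt_mul_le {m x δ : ℝ} (h0 : 0 ≤ m) (h1 : m ≤ 1) (hδ : 0 < δ) (hδ1 : δ ≤ 1)
    (hx : x + δ ≤ m) : binomSum m (fun k f => ind ((k : ℝ) < (k + f : ℕ) * x)) ≤
      ENNReal.ofReal (2 * (1 + 4 / δ ^ 2)) := by
  refine le_trans (binomSum_mono fun k f => ?_) (binomSum_tail_le h0 h1 hδ hδ1)
  refine le_trans (ind_mono (q := (k + f : ℕ) * δ ≤ |(k : ℝ) - (k + f : ℕ) * m|) fun h => ?_)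
    (le_of_eq ?_)
  · refine le_trans ?_ (neg_le_abs _)
    have : ((k + f : ℕ) : ℝ) * (x + δ) ≤ (k + f : ℕ) * m := by gcongr
    linarith
  · unfold ind
    congr

/-- The case `m = 1` is included: then there are no non-losses. -/
lemma binomSum_lt_shrink_le {m η : ℝ} (h0 : 0 ≤ m) (h1 : m ≤ 1) (hη : 0 < η) (hη1 : η ≤ 1) :
    binomSum m (fun k f => ind ((k : ℝ) < (k + f : ℕ) * (m - (1 - m) * η))) ≤
      ENNReal.ofReal (2 * (1 + 4 / ((1 - m) * η) ^ 2)) := by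
  rcases h1.eq_or_lt with rfl | h1'
  · refine le_trans (le_of_eq ?_) zero_le
    rw [binomSum, ENNReal.tsum_eq_zero]
    rintro ⟨k, f⟩
    rcases f with _ | f
    · rw [ind_of_not (by simp), mul_zero]
    · simp [binom]
  · have hd : 0 < (1 - m) * η := mul_pos (by linarith) hη
    exact binomSum_lt_mul_le h0 h1 hd (mul_le_one₀ (by linarith) hη.le hη1) (by linarith)

lemma unluckyBound_ne_top {K : ℕ} {μ : Fin K → ℝ} {O : Finset (Fin K)} {y δ : ℝ}
    (hsep : Separated μ O y δ) (n : ℝ) {j : Fin K} (hj : j ∈ O) : unluckyBound μ y δ n j ≠ ∞ :=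
  ENNReal.add_ne_top.2 ⟨ENNReal.mul_ne_top ENNReal.ofNat_ne_top
    (ENNReal.mul_ne_top (ENNReal.natCast_ne_top K) (misledBound_ne_top δ n)),
    ENNReal.mul_ne_top ENNReal.ofNat_ne_top
      (binomSum_odds_lt_top (hsep.pos j) (hsep.lt_of_mem j hj) hsep.lt_one).ne⟩

/-- A bound for the expected number of plays of a suboptimal arm. -/
def playBound {K : ℕ} (μ : Fin K → ℝ) (O : Finset (Fin K)) (y δ n x : ℝ) : ℝ≥0∞ :=
  ∑ j ∈ O, unluckyBound μ y δ n j +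
    (ENNReal.ofReal (x ^ 3 / (klBer (y + δ) y / 2) + 1) + (ENNReal.ofReal (2 * (1 + 4 / δ ^ 2)) +
      ENNReal.ofReal (1 + 1 / (klBer (y + δ) y / 2))))

/-- A bound for the expected number of exceptional rounds. -/
def exceptionalBound {K : ℕ} (μ : Fin K → ℝ) (O : Finset (Fin K)) (y δ n x : ℝ) : ℝ≥0∞ :=
  ∑ _i ∈ Oᶜ, ∑ j ∈ O, (∑ j' ∈ O, unluckyBound μ y δ n j' + (misledBound δ (x ^ 2) +
    ENNReal.ofReal (deviation δ (x ^ 2)) * waitBound μ y δ n (16 * x ^ 5) j)) +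
  (∑ _j ∈ O, ENNReal.ofReal (Real.exp (x ^ 3)) *
      (2 * ENNReal.ofReal (deviation (1 / x) (16 * x ^ 5))) +
    ∑ i ∈ Oᶜ, ∑ _i' ∈ Oᶜ.erase i, (misledBound δ (x ^ 2) +
      2 * (ENNReal.ofReal (deviation δ (x ^ 2)) * playBound μ O y δ n x)))

lemma growthLE_playBound {K : ℕ} {μ : Fin K → ℝ} {O : Finset (Fin K)} {y δ : ℝ}
    (hsep : Separated μ O y δ) (n : ℝ) : GrowthLE 6 (playBound μ O y δ n) := by
  refine (GrowthLE.sum fun j hj => growthLE_const (unluckyBound_ne_top hsep n hj) 6).add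
    (GrowthLE.add ?_ (growthLE_const (ENNReal.add_ne_top.2
      ⟨ENNReal.ofReal_ne_top, ENNReal.ofReal_ne_top⟩) 6))
  refine GrowthLE.of_le (k := 3) (growthLE_ofReal (1 / (klBer (y + δ) y / 2) + 1) ?_) (by omega)
  filter_upwards [Filter.eventually_ge_atTop 1] with x hx
  have := one_le_pow₀ hx (n := 3)
  rw [add_mul, one_mul, div_mul_eq_mul_div, one_mul]
  linarith

lemma growthLE_waitBound {K : ℕ} {μ : Fin K → ℝ} {O : Finset (Fin K)} {y δ : ℝ}
    (hsep : Separated μ O y δ) (n : ℝ) {j : Fin K} (hj : j ∈ O) :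
    GrowthLE 6 fun x => waitBound μ y δ n (16 * x ^ 5) j := by
  refine (growthLE_const (unluckyBound_ne_top hsep n hj) 6).add
    (GrowthLE.add (GrowthLE.const_mul ?_ ENNReal.ofNat_ne_top)
      (growthLE_const (ENNReal.mul_ne_top ENNReal.ofNat_ne_top
        (ENNReal.mul_ne_top (ENNReal.natCast_ne_top K) (misledBound_ne_top δ n))) 6))
  refine GrowthLE.of_le (k := 5) (growthLE_ofReal 17 ?_) (by omega)
  filter_upwards [Filter.eventually_ge_atTop 1] with x hx
  have := one_le_pow₀ hx (n := 5)
  linarith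

lemma growthLE_exceptionalBound {K : ℕ} {μ : Fin K → ℝ} {O : Finset (Fin K)} {y δ : ℝ}
    (hsep : Separated μ O y δ) (n : ℝ) : GrowthLE 2 (exceptionalBound μ O y δ n) := by
  refine (GrowthLE.sum fun i _ => GrowthLE.sum fun j hj => (GrowthLE.sum fun j' hj' =>
    growthLE_const (unluckyBound_ne_top hsep n hj') 2).add ((growthLE_misledBound δ).add
      (growthLE_deviation_mul hsep.delta_pos (growthLE_waitBound hsep n hj)))).add
    ((GrowthLE.sum fun _ _ => growthLE_late_deviation).add (GrowthLE.sum fun i _ =>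
      GrowthLE.sum fun i' _ => (growthLE_misledBound δ).add (GrowthLE.const_mul
        (growthLE_deviation_mul hsep.delta_pos (growthLE_playBound hsep n))
        ENNReal.ofNat_ne_top)))

section Run

variable {K : ℕ} {θ Q W : ℝ} {order : Equiv.Perm (Fin K)} {Ω : Type*}
  {X : ℕ → Fin K → Ω → Bool} {Z : ℕ → Fin K → ℕ → ℕ → Ω → ℝ}
  [MeasurableSpace Ω] {P : Measure Ω} {μ : Fin K → ℝ} {M : ℕ} {O : Finset (Fin K)}

local notation "st" => state θ Q W order X Z
local notation "occ'" => occ θ Q W order P X Z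

/-- A played suboptimal arm displaces an optimal one, so either some optimal sample exceeds `y` or
its own sample is at most `y`. The result is of order `log T` with a poor constant, which is enough
as it is later multiplied by an exponentially small factor. -/
lemma occ_good_played_le [IsProbabilityMeasure P] (hθ : 0 < θ) (hN : IsNoise μ P X Z)
    (hO : K - M = O.card) {y δ n : ℝ} (hsep : Separated μ O y δ) (hn0 : 0 ≤ n)
    (hn : ENNReal.ofReal (deviation δ n) ≤ 1 / (2 * K)) (hy : 0 < y) {i : Fin K} (hi : i ∉ O)
    {T : ℕ} (hT : 1 ≤ T) {x : ℝ} (hx : 0 ≤ x) (hTx : Real.log T = x ^ 3) :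
    occ' T (fun s z => ind (Good θ Q M s ∧ Played Q order i s z)) ≤ playBound μ O y δ n x := by
  have hlarge : ∀ j (s : State K), Measurable fun z : Fin K → ℝ =>
      ind (Good θ Q M s ∧ y < z j) := fun j s =>
    measurable_ind ((MeasurableSet.const _).inter (measurableSet_lt_sample j y))
  have hδ := hsep.delta_pos
  have hyd : y + δ ≤ 1 := by
    have := hsep.le_of_notMem i hi
    have := hsep.le_one i
    linarith
  have hkl : 0 < klBer (y + δ) y := klBer_pos (by linarith) hyd hy hsep.lt_one (by linarith)
  calc _ ≤ occ' T (fun s z => ∑ j ∈ O, ind (Good θ Q M s ∧ y < z j) +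
          ind (Played Q order i s z ∧ z i ≤ y)) := by
        refine occ_mono fun t ω => ?_
        by_cases h : ∃ j ∈ O, y < samples Z t (st ω t) ω j
        · refine le_trans ?_ le_self_add
          exact ind_le_sum fun hg => by
            obtain ⟨j', hj', h⟩ := h
            exact ⟨j', hj', hg.1, h⟩
        · refine le_trans (ind_mono fun hg => ⟨hg.2, ?_⟩) le_add_self
          have hiS := (hg.1.played_iff (order := order) hO i _).1 hg.2
          obtain ⟨j', hj'O, hj'⟩ := exists_notMem_smallest hi hiS
          push Not at h
          exact (le_of_mem_of_notMem_smallest order hiS hj').trans (h j' hj'O)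
    _ = ∑ j ∈ O, occ' T (fun s z => ind (Good θ Q M s ∧ y < z j)) +
          occ' T (fun s z => ind (Played Q order i s z ∧ z i ≤ y)) := by
        rw [occ_add hθ hN T fun s => Finset.measurable_sum _ fun j _ => hlarge j s,
          occ_sum hθ hN T _ hlarge]
    _ ≤ _ := by
        refine add_le_add (Finset.sum_le_sum fun j hj =>
          occ_lt_sample_le hθ hN hO hsep hn0 hn hj T) ?_
        refine (occ_played_small_le hθ hN (fun i => (hsep.pos i).le) hsep.le_one
          (x := y + δ) (y := y) (v := klBer (y + δ) y / 2) (n := x ^ 3 / (klBer (y + δ) y / 2))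
          (by linarith) hyd (by linarith) (by linarith) (by positivity) hT ?_).trans ?_
        · rw [hTx, sub_half, div_mul_cancel₀ _ (by positivity)]
        · gcongr
          exact binomSum_lt_mul_le (hsep.pos i).le (hsep.le_one i) hδ hsep.delta_le_one
            (by linarith [hsep.le_of_notMem i hi])

lemma occ_exceptional_le [IsProbabilityMeasure P] (hθ : 0 < θ) (hN : IsNoise μ P X Z)
    (hO : K - M = O.card) {y δ n : ℝ} (hsep : Separated μ O y δ) (hn0 : 0 ≤ n)
    (hn : ENNReal.ofReal (deviation δ n) ≤ 1 / (2 * K)) (hy : 0 < y)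
    {T : ℕ} (hT : 1 ≤ T) {x : ℝ} (hx : 1 ≤ x) (hTx : Real.log T = x ^ 3)
    (hhalf : ENNReal.ofReal (deviation δ (x ^ 2)) ≤ 1 / 2) :
    occ' T (exceptional μ θ Q order O M y (1 / x) (16 * x ^ 5)) ≤
      exceptionalBound μ O y δ n x := by
  have hx0 : 0 < x := by linarith
  have m1 : ∀ i j (s : State K), Measurable fun z : Fin K → ℝ =>
      ind (Good θ Q M s ∧ (s.obs j : ℝ) < 16 * x ^ 5 ∧ Played Q order i s z) := fun i j s =>
    measurable_ind ((MeasurableSet.const _).inter ((MeasurableSet.const _).inter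
      (measurableSet_played s i)))
  have m2 : ∀ j (s : State K), Measurable fun z : Fin K → ℝ =>
      ind (16 * x ^ 5 ≤ s.obs j ∧ 2 * (1 / x) < |z j - μ j|) := fun j s =>
    measurable_ind ((MeasurableSet.const _).inter (measurableSet_lt measurable_const
      (by fun_prop : Measurable fun z : Fin K → ℝ => |z j - μ j|)))
  have m3 : ∀ i i' (s : State K), Measurable fun z : Fin K → ℝ =>
      ind (Good θ Q M s ∧ Played Q order i s z ∧ Played Q order i' s z ∧ z i ≤ y ∧ z i' ≤ y) :=
    fun i i' s => measurable_ind ((MeasurableSet.const _).inter ((measurableSet_played s i).inter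
      ((measurableSet_played s i').inter ((measurableSet_sample_le i y).inter
        (measurableSet_sample_le i' y)))))
  have hT0 : (0 : ℝ) < T := by exact_mod_cast hT
  have hTe : (T : ℝ≥0∞) = ENNReal.ofReal (Real.exp (x ^ 3)) := by
    rw [← hTx, Real.exp_log hT0, ENNReal.ofReal_natCast]
  unfold exceptional
  rw [occ_add hθ hN T fun s => Finset.measurable_sum _ fun i _ => Finset.measurable_sum _
      fun j _ => m1 i j s,
    occ_add hθ hN T fun s => Finset.measurable_sum _ fun j _ => m2 j s,
    occ_sum hθ hN T _ fun i s => Finset.measurable_sum _ fun j _ => m1 i j s,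
    occ_sum hθ hN T _ m2,
    occ_sum hθ hN T _ fun i s => Finset.measurable_sum _ fun j _ => m3 i j s]
  simp only [occ_sum hθ hN T _ (m1 _), occ_sum hθ hN T _ (m3 _)]
  refine add_le_add (Finset.sum_le_sum fun i hi => Finset.sum_le_sum fun j hj => ?_)
    (add_le_add (Finset.sum_le_sum fun j _ => ?_)
      (Finset.sum_le_sum fun i hi => Finset.sum_le_sum fun i' hi' => ?_))
  · exact occ_played_obs_lt_le hθ hN hO hsep hn0 hn (by positivity) hj
      (Finset.mem_compl.1 hi) (by positivity) T
  · rw [← hTe]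
    exact occ_deviation_le hθ hN (fun i => (hsep.pos i).le) hsep.le_one (by positivity)
      ((div_le_one hx0).2 hx) j T
  · obtain ⟨hne, hi'⟩ := Finset.mem_erase.1 hi'
    refine (occ_two_le hθ hN hO hsep (Finset.mem_compl.1 hi') hne.symm (by positivity) hhalf
      T).trans ?_
    gcongr
    exact occ_good_played_le hθ hN hO hsep hn0 hn hy (Finset.mem_compl.1 hi) hT hx0.le hTx

/-- `occ_played_small_le` with empirical level `μ i - (1 - μ i) / x`, sample level `m + 2 / x`,
reserve `v = 1 / x`, and `n` chosen so that `n` times the remaining divergence is `log T`. -/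
lemma occ_leading_le [IsProbabilityMeasure P] (hθ : 0 < θ) (hN : IsNoise μ P X Z)
    (hμ : ∀ i, μ i ∈ Set.Icc (0 : ℝ) 1) {m : ℝ} {i : Fin K} (hmi : m ≤ μ i)
    {T : ℕ} (hT : 1 ≤ T) {x : ℝ} (hx : 1 ≤ x) (hTx : Real.log T = x ^ 3)
    (hlt : m + 2 * (1 / x) < μ i - (1 - μ i) * (1 / x))
    (hkl : 1 / x < klBer (μ i - (1 - μ i) * (1 / x)) (m + 2 * (1 / x))) :
    ENNReal.ofReal (μ i - m + 4 * (1 / x)) *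
      occ' T (fun s z => ind (Played Q order i s z ∧ z i ≤ m + 2 * (1 / x))) ≤
      ENNReal.ofReal (leadingBound (μ i) m x) := by
  have hx0 : 0 < x := by linarith
  have hη : 0 < 1 / x := by positivity
  have hη1 : 1 / x ≤ 1 := (div_le_one hx0).2 hx
  rw [leadingBound]
  set e := klBer (μ i - (1 - μ i) * (1 / x)) (m + 2 * (1 / x)) with he
  have he0 : 0 < e - 1 / x := by linarith
  rw [ENNReal.ofReal_mul (by linarith)]
  refine mul_le_mul_right ?_ _
  have hx1 : μ i - (1 - μ i) * (1 / x) ≤ 1 := by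
    have := mul_nonneg (sub_nonneg.2 (hμ i).2) hη.le
    linarith [(hμ i).2]
  refine (occ_played_small_le hθ hN (fun i => (hμ i).1) (fun i => (hμ i).2) hlt hx1 hη hkl.le
    (n := x ^ 3 / (e - 1 / x)) (by positivity) hT ?_).trans ?_
  · rw [hTx, ← he, div_mul_cancel₀ _ he0.ne']
  · rw [ENNReal.ofReal_add (p := x ^ 3 / (e - 1 / x) + 1) (by positivity) (by positivity),
      ENNReal.ofReal_add (p := 2 * (1 + 4 / ((1 - μ i) * (1 / x)) ^ 2)) (by positivity)
        (by positivity)]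
    exact add_le_add le_rfl (add_le_add (binomSum_lt_shrink_le (hμ i).1 (hμ i).2 hη hη1) le_rfl)

/-- Rounds are good unless the search is running or has failed. -/
lemma good_of_state (hθ : 0 < θ) (hθ1 : θ ≤ 1) (hQ : θ ≤ Q) (hM : numCovered K θ Q < K)
    {s : State K} (hs : s.Bracket θ Q W) (h1 : ¬ Above θ Q s) (h2 : ¬ Below θ Q s)
    (h3 : ¬ Failed θ Q s) : Good θ Q (numCovered K θ Q) s := by
  refine hs.good hθ hθ1 hQ hM ?_ (not_lt.1 h3)
  by_contra h
  rcases lt_or_ge (s.threshold Q) θ with h' | h'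
  exacts [h2 ⟨h, h'⟩, h1 ⟨h, h'⟩]

/-- For a fixed state the allocation depends only on the served set, which takes finitely many
values, so no measurability of `f` is needed. -/
lemma measurable_alloc_comp {β : Type*} [MeasurableSpace β] (f : (Fin K → ℝ) → β) (s : State K) :
    Measurable fun z => f (s.alloc Q order z) :=
  (Measurable.of_discrete (f := fun A : Finset (Fin K) =>
    f fun j => if j ∈ A then s.threshold Q else 0)).comp (measurable_served s measurable_id)

lemma occ_gap_crude_le [IsProbabilityMeasure P] (hθ : 0 < θ) (hQ : θ ≤ Q)
    (hcard : 2 ≤ (candidates K Q).card) (hμ : ∀ i, μ i ∈ Set.Icc (0 : ℝ) 1) (T : ℕ) :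
    occ' T (fun s z => ENNReal.ofReal (gap μ θ Q (s.alloc Q order z))) ≤
      T * ENNReal.ofReal (maxGap μ θ Q) := by
  refine (Finset.sum_le_card_nsmul _ _ (ENNReal.ofReal (maxGap μ θ Q)) fun t _ => ?_).trans
    (by rw [Finset.card_range, nsmul_eq_mul])
  refine (lintegral_mono fun ω => ENNReal.ofReal_le_ofReal (gap_le_maxGap hμ
    (alloc_mem_feasible (hθ.trans_le hQ) (bracket_state hθ hcard ⟨ω, rfl⟩) _))).trans ?_
  rw [lintegral_const, measure_univ, mul_one]

/-- The expected regret, split into the search and the regret minimization phase. -/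
lemma occ_gap_le [IsProbabilityMeasure P] (hθ : 0 < θ) (hθ1 : θ ≤ 1) (hQ : θ ≤ Q)
    (hN : IsNoise μ P X Z) (hμ : ∀ i, μ i ∈ Set.Icc (0 : ℝ) 1) (hmono : Monotone μ)
    {ε : ℝ} (hε : 0 < ε) (hε1 : ε < 1) (hμε : ∀ i, ε ≤ μ i) (hW : 0 ≤ W) {p : Fin K}
    (hp : (p : ℕ) + 1 + numCovered K θ Q = K) {y δ n : ℝ}
    (hsep : Separated μ (Finset.Iic p) y δ) (hn0 : 0 ≤ n)
    (hn : ENNReal.ofReal (deviation δ n) ≤ 1 / (2 * K)) {T : ℕ} (hT : 1 ≤ T) {x : ℝ}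
    (hx : 1 ≤ x) (hTx : Real.log T = x ^ 3)
    (hhalf : ENNReal.ofReal (deviation δ (x ^ 2)) ≤ 1 / 2) (hy : μ p + 2 * (1 / x) ≤ y)
    (hlt : ∀ i ∉ Finset.Iic p, μ p + 2 * (1 / x) < μ i - (1 - μ i) * (1 / x))
    (hkl : ∀ i ∉ Finset.Iic p, 1 / x < klBer (μ i - (1 - μ i) * (1 / x)) (μ p + 2 * (1 / x))) :
    occ' T (fun s z => ENNReal.ofReal (gap μ θ Q (s.alloc Q order z))) ≤
      ENNReal.ofReal (maxGap μ θ Q * ((W + 1) * Real.logb 2 (candidates K Q).card +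
        ((candidates K Q).card / ε + T * (((candidates K Q).card + 1 : ℕ) *
          ((1 - ε) ^ Q) ^ windowRounds W)))) +
      (∑ i ∈ (Finset.Iic p)ᶜ, ENNReal.ofReal (leadingBound (μ i) (μ p) x) +
        K * exceptionalBound μ (Finset.Iic p) y δ n x) := by
  have hM : numCovered K θ Q < K := by omega
  have hQ0 : 0 < Q := hθ.trans_le hQ
  have hcard := two_le_card_candidates hθ hθ1 hQ hM
  have hlow := candidate_one_lt hθ hθ1 hQ hM
  have hO : K - numCovered K θ Q = (Finset.Iic p).card := by
    rw [Fin.card_Iic]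
    omega
  have hΔ : 0 ≤ maxGap μ θ Q := maxGap_nonneg hμ hQ0.le
  have hε0 : 0 ≤ (1 - ε) ^ Q := Real.rpow_nonneg (by linarith) _
  have ma : ∀ s : State K, Measurable fun _ : Fin K → ℝ => ind (Above θ Q s) :=
    fun s => measurable_const
  have mb : ∀ s : State K, Measurable fun _ : Fin K → ℝ => ind (Below θ Q s) :=
    fun s => measurable_const
  have ml : ∀ i (s : State K), Measurable fun z : Fin K → ℝ =>
      ENNReal.ofReal (μ i - μ p + 4 * (1 / x)) *
        ind (Played Q order i s z ∧ z i ≤ μ p + 2 * (1 / x)) := fun i s =>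
    (measurable_ind ((measurableSet_played s i).inter (measurableSet_sample_le i _))).const_mul _
  have mi : ∀ i (s : State K), Measurable fun z : Fin K → ℝ =>
      ind (Played Q order i s z ∧ z i ≤ μ p + 2 * (1 / x)) := fun i s =>
    measurable_ind ((measurableSet_played s i).inter (measurableSet_sample_le i _))
  have me : ∀ s : State K, Measurable (exceptional μ θ Q order (Finset.Iic p)
      (numCovered K θ Q) y (1 / x) (16 * x ^ 5) s) := fun s => by
    refine (Finset.measurable_sum _ fun i _ => Finset.measurable_sum _ fun j _ => ?_).add
      ((Finset.measurable_sum _ fun j _ => ?_).add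
      (Finset.measurable_sum _ fun i _ => Finset.measurable_sum _ fun i' _ => ?_))
    · exact measurable_ind ((MeasurableSet.const _).inter ((MeasurableSet.const _).inter
        (measurableSet_played s i)))
    · exact measurable_ind ((MeasurableSet.const _).inter
        (measurableSet_lt measurable_const
      (by fun_prop : Measurable fun z : Fin K → ℝ => |z j - μ j|)))
    · exact measurable_ind ((MeasurableSet.const _).inter ((measurableSet_played s i).inter
        ((measurableSet_played s i').inter ((measurableSet_sample_le i y).inter
          (measurableSet_sample_le i' y)))))
  calc _ ≤ occ' T (fun s z => ENNReal.ofReal (maxGap μ θ Q) * (ind (Above θ Q s) +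
          (ind (Below θ Q s) + ind (Failed θ Q s))) +
        (∑ i ∈ (Finset.Iic p)ᶜ, ENNReal.ofReal (μ i - μ p + 4 * (1 / x)) *
          ind (Played Q order i s z ∧ z i ≤ μ p + 2 * (1 / x)) +
        K * exceptional μ θ Q order (Finset.Iic p) (numCovered K θ Q) y (1 / x) (16 * x ^ 5)
          s z)) := by
        refine occ_mono fun t ω => ?_
        have hb := bracket_state (W := W) (order := order) (X := X) (Z := Z) (t := t) hθ hcard
          ⟨ω, rfl⟩
        have hmax := ENNReal.ofReal_le_ofReal (gap_le_maxGap (θ := θ) hμ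
          (alloc_mem_feasible (order := order) hQ0 hb (samples Z t (st ω t) ω)))
        by_cases hA : Above θ Q (st ω t)
        · refine hmax.trans (le_trans ?_ le_self_add)
          rw [ind_of hA]
          exact le_mul_of_one_le_right zero_le le_self_add
        by_cases hB : Below θ Q (st ω t)
        · refine hmax.trans (le_trans ?_ le_self_add)
          rw [ind_of hB]
          exact le_mul_of_one_le_right zero_le (le_self_add.trans le_add_self)
        by_cases hF : Failed θ Q (st ω t)
        · refine hmax.trans (le_trans ?_ le_self_add)
          rw [ind_of hF]
          exact le_mul_of_one_le_right zero_le (le_add_self.trans le_add_self)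
        · exact ((good_of_state hθ hθ1 hQ hM hb hA hB hF).ofReal_gap_le hμ hmono hθ hQ hp _ hy
            (16 * x ^ 5)).trans le_add_self
    _ = ENNReal.ofReal (maxGap μ θ Q) * (occ' T (fun s _ => ind (Above θ Q s)) +
          (occ' T (fun s _ => ind (Below θ Q s)) + occ' T (fun s _ => ind (Failed θ Q s)))) +
        (∑ i ∈ (Finset.Iic p)ᶜ, ENNReal.ofReal (μ i - μ p + 4 * (1 / x)) *
          occ' T (fun s z => ind (Played Q order i s z ∧ z i ≤ μ p + 2 * (1 / x))) +
        K * occ' T (exceptional μ θ Q order (Finset.Iic p) (numCovered K θ Q) y (1 / x)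
          (16 * x ^ 5))) := by
        rw [occ_add hθ hN T fun s => measurable_const,
          occ_add hθ hN T fun s => Finset.measurable_sum _ fun i _ => ml i s,
          occ_const_mul hθ hN T _ fun s => measurable_const, occ_add hθ hN T ma,
          occ_add hθ hN T mb, occ_sum hθ hN T _ ml, occ_const_mul hθ hN T _ me]
        simp only [occ_const_mul hθ hN T _ (mi _)]
    _ ≤ _ := by
        refine add_le_add ?_ (add_le_add (Finset.sum_le_sum fun i hi => ?_)
          (mul_le_mul_right (occ_exceptional_le hθ hN hO hsep hn0 hn
            ((hsep.pos p).trans (hsep.lt_of_mem p (Finset.mem_Iic.2 le_rfl))) hT hx hTx hhalf) _))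
        · have hlog : 0 ≤ Real.logb 2 (candidates K Q).card :=
            Real.logb_nonneg one_lt_two (by exact_mod_cast (by omega :
              1 ≤ (candidates K Q).card))
          rw [ENNReal.ofReal_mul hΔ, ENNReal.ofReal_add (by positivity) (by positivity),
            ENNReal.ofReal_add (by positivity) (by positivity)]
          gcongr
          · refine (occ_above_le hθ hN hcard hlow T).trans ?_
            rw [← ENNReal.ofReal_natCast]
            exact ENNReal.ofReal_le_ofReal (windowRounds_mul_le hW hcard)
          · exact occ_below_le hθ hQ0 hN hcard hε hμε T
          -- Failure has the same probability bound at every time, so the contribution is at most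
          -- `T` times it.
          · refine (Finset.sum_le_card_nsmul _ _ _ fun t _ => ?_).trans
              (le_of_eq (by rw [Finset.card_range, nsmul_eq_mul, ENNReal.ofReal_mul
                (Nat.cast_nonneg T), ENNReal.ofReal_natCast]))
            refine le_trans (le_of_eq ?_)
              (measure_failed_le (order := order) hθ hθ1 hQ hN hcard hμ hε hε1 hμε t)
            exact lintegral_ind (p := fun ω => Failed θ Q (st ω t)) (measurable_st hθ hN t
              (MeasurableSet.of_discrete (s := {s : State K | Failed θ Q s})))
        · have hi' := Finset.mem_compl.1 hi
          exact occ_leading_le hθ hN hμ (le_of_notMem_Iic hmono i hi') hT hx hTx (hlt i hi')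
            (hkl i hi')

end Run

/-! ### The regret bound -/

/-- The window is chosen so that `((1 - ε) ^ Q) ^ W = 1 / (T log₂ |Θ|)`. Rounding up only lowers
this, and `log₂ |Θ| ≥ 1` since there are at least two candidates. -/
lemma window_nonneg_and_pow_le {K : ℕ} {Q ε : ℝ} (hQ : 0 < Q) (hε : 0 < ε) (hε1 : ε < 1)
    (hcard : 2 ≤ (candidates K Q).card) {T : ℕ} (hT : 1 ≤ T) :
    0 ≤ window K Q ε (1 / (T : ℝ)) ∧
      T * ((1 - ε) ^ Q) ^ windowRounds (window K Q ε (1 / (T : ℝ))) ≤ (1 : ℝ) := by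
  have hT0 : (1 : ℝ) ≤ T := by exact_mod_cast hT
  set B := Real.logb 2 ((candidates K Q).card : ℝ) with hB
  have hB1 : 1 ≤ B := by
    rw [hB, Real.le_logb_iff_rpow_le one_lt_two (by positivity), Real.rpow_one]
    exact_mod_cast hcard
  have hBT : (T : ℝ) ≤ B * T := le_mul_of_one_le_left (by linarith) hB1
  have hlog : 0 < Real.log (1 / (1 - ε)) :=
    Real.log_pos (by rw [lt_div_iff₀ (by linarith)]; linarith)
  have hden : 0 < Q * Real.log (1 / (1 - ε)) := by positivity
  have hW : window K Q ε (1 / (T : ℝ)) = Real.log (B * T) / (Q * Real.log (1 / (1 - ε))) := by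
    rw [window, ← hB, one_div, div_inv_eq_mul]
  set W := window K Q ε (1 / (T : ℝ))
  have hW0 : 0 ≤ W := by
    rw [hW]
    exact div_nonneg (Real.log_nonneg (by linarith)) hden.le
  refine ⟨hW0, ?_⟩
  have hr : (1 - ε) ^ Q = Real.exp (-(Q * Real.log (1 / (1 - ε)))) := by
    rw [Real.rpow_def_of_pos (by linarith), one_div, Real.log_inv]
    ring_nf
  have hceil : W ≤ windowRounds W := by
    rw [windowRounds, Nat.cast_max]
    exact (Nat.le_ceil W).trans (le_max_right _ _)
  have h1 : ((1 - ε) ^ Q) ^ windowRounds W ≤ Real.exp (-Real.log (B * T)) := by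
    rw [hr, ← Real.exp_nat_mul]
    refine Real.exp_le_exp.2 ?_
    have : Real.log (B * T) = W * (Q * Real.log (1 / (1 - ε))) := by
      rw [hW, div_mul_cancel₀ _ hden.ne']
    rw [this]
    have := mul_le_mul_of_nonneg_right hceil hden.le
    linarith
  rw [Real.exp_neg, Real.exp_log (by linarith)] at h1
  calc _ ≤ (T : ℝ) * (B * T)⁻¹ := by gcongr
    _ ≤ 1 := by
        rw [← div_eq_mul_inv]
        exact div_le_one_of_le₀ hBT (by linarith)

/-- The constants of the analysis exist. -/
lemma exists_separated {K : ℕ} {μ : Fin K → ℝ} (hμ : ∀ i, μ i ∈ Set.Icc (0 : ℝ) 1)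
    (hmono : Monotone μ) (hpos : ∀ i, 0 < μ i) {p q : Fin K} (hpq : μ p < μ q)
    (hnext : ∀ i ∉ Finset.Iic p, q ≤ i) :
    ∃ y δ, Separated μ (Finset.Iic p) y δ := by
  refine ⟨(μ p + μ q) / 2, (μ q - μ p) / 4, hpos, fun i => (hμ i).2, fun j hj => ?_, ?_, ?_, ?_,
    fun i hi => ?_⟩
  · linarith [mem_Iic_le hmono j hj]
  · linarith [(hμ q).2]
  · linarith
  · linarith [(hμ q).2, (hμ p).1]
  · linarith [hmono (hnext i hi)]

open Filter Topology in
/-- The regret bound for large numbers of rounds. -/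
lemma exists_occ_gap_le_of_large {K : ℕ} {μ : Fin K → ℝ} {θ Q ε : ℝ}
    (hμ : ∀ i, μ i ∈ Set.Icc (0 : ℝ) 1) (hmono : Monotone μ) (hθ : 0 < θ) (hθ1 : θ ≤ 1) (hQ : θ ≤ Q) (hε : 0 < ε)
    (hμε : ∀ i, ε ≤ μ i) {p q : Fin K} (hp : (p : ℕ) + 1 + numCovered K θ Q = K)
    (hq : (q : ℕ) + numCovered K θ Q = K) (hpq : μ p < μ q) (order : Equiv.Perm (Fin K)) :
    ∃ C x₀ : ℝ, ∀ T : ℕ, 1 ≤ T → ∀ x : ℝ, x₀ ≤ x → Real.log T = x ^ 3 →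
      ∀ (Ω : Type*) [MeasurableSpace Ω] (P : Measure Ω) [IsProbabilityMeasure P]
        (X : ℕ → Fin K → Ω → Bool) (Z : ℕ → Fin K → ℕ → ℕ → Ω → ℝ), IsNoise μ P X Z →
        occ θ Q (window K Q ε (1 / (T : ℝ))) order P X Z T
          (fun s z => ENNReal.ofReal (gap μ θ Q (s.alloc Q order z))) ≤
        ENNReal.ofReal (window K Q ε (1 / (T : ℝ)) * Real.logb 2 ((candidates K Q).card : ℝ) *
          maxGap μ θ Q + C * x ^ 2 + ∑ i ∈ Finset.Ioi p, (μ i - μ p) * x ^ 3 /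
            klBer (μ i) (μ p)) := by
  have hM : numCovered K θ Q < K := by omega
  have hQ0 : 0 < Q := hθ.trans_le hQ
  have hcard := two_le_card_candidates hθ hθ1 hQ hM
  have hpos : ∀ i, 0 < μ i := fun i => hε.trans_le (hμε i)
  have hε1 : ε < 1 := (hμε p).trans_lt (hpq.trans_le (hμ q).2)
  have hΔ : 0 ≤ maxGap μ θ Q := maxGap_nonneg hμ hQ0.le
  have hnext : ∀ i ∉ Finset.Iic p, q ≤ i := fun i hi => by
    have : p < i := not_le.1 fun h => hi (Finset.mem_Iic.2 h)
    rw [Fin.lt_def] at this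
    rw [Fin.le_def]
    omega
  have hIoi : (Finset.Iic p)ᶜ = Finset.Ioi p := by
    ext i
    simp
  obtain ⟨y, δ, hsep⟩ := exists_separated hμ hmono hpos hpq hnext
  have hK0 : (0 : ℝ≥0∞) < 1 / (2 * K) := by
    rw [one_div, ENNReal.inv_pos]
    exact ENNReal.mul_ne_top ENNReal.ofNat_ne_top (ENNReal.natCast_ne_top K)
  obtain ⟨n, hn, hn0⟩ := ((eventually_deviation_le hsep.delta_pos hK0).and
    (eventually_ge_atTop 0)).exists
  obtain ⟨E, hE⟩ := growthLE_exceptionalBound hsep n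
  have hpi : ∀ i ∈ Finset.Ioi p, μ p < μ i := fun i hi =>
    hpq.trans_le (hmono (hnext i (by rw [← Finset.mem_compl, hIoi]; exact hi)))
  have hlead : ∀ i, ∃ C, i ∈ Finset.Ioi p → ∀ᶠ x : ℝ in atTop,
      1 / x < klBer (μ i - (1 - μ i) * (1 / x)) (μ p + 2 * (1 / x)) ∧
      leadingBound (μ i) (μ p) x ≤ (μ i - μ p) * x ^ 3 / klBer (μ i) (μ p) + C * x ^ 2 := by
    intro i
    by_cases hi : i ∈ Finset.Ioi p
    · obtain ⟨C, hC⟩ := leadingBound_le (hpos p) (hpi i hi) (hμ i).2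
      exact ⟨C, fun _ => hC⟩
    · exact ⟨0, fun h => absurd h hi⟩
  choose C hC using hlead
  have hC' : ∀ᶠ x : ℝ in atTop, ∀ i ∈ Finset.Ioi p,
      1 / x < klBer (μ i - (1 - μ i) * (1 / x)) (μ p + 2 * (1 / x)) ∧
      leadingBound (μ i) (μ p) x ≤ (μ i - μ p) * x ^ 3 / klBer (μ i) (μ p) + C i * x ^ 2 :=
    (Finset.eventually_all _).2 hC
  have ht : Tendsto (fun x : ℝ => 1 / x) atTop (𝓝 0) := by
    simpa using tendsto_inv_atTop_zero (𝕜 := ℝ)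
  have h3 : ∀ᶠ x : ℝ in atTop, 1 / x < (μ q - μ p) / 4 :=
    ht.eventually_lt_const (by linarith)
  have h4 : ∀ᶠ x : ℝ in atTop, 1 / x < (y - μ p) / 2 :=
    ht.eventually_lt_const (by linarith [hsep.lt_of_mem p (Finset.mem_Iic.2 le_rfl)])
  have h5 : ∀ᶠ x : ℝ in atTop, ENNReal.ofReal (deviation δ (x ^ 2)) ≤ 1 / 2 :=
    (tendsto_pow_atTop two_ne_zero).eventually (eventually_deviation_le hsep.delta_pos (by simp))
  -- All asymptotic requirements on `x` are collected into one `x₀`, fixed before the horizon and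
  -- the probability space.
  obtain ⟨x₀, hx₀⟩ := eventually_atTop.1 ((hE.and hC').and ((h3.and h4).and
    (h5.and (eventually_ge_atTop 1))))
  set N := (candidates K Q).card with hNdef
  -- The search cost beyond the leading term: rounding of the window, `Below` rounds, and `Failed`
  -- rounds, whose probability is at most `(N + 1) / T`.
  set A := maxGap μ θ Q * (Real.logb 2 N + (N / ε + (N + 1))) with hA
  refine ⟨A + (∑ i ∈ Finset.Ioi p, |C i| + K * E), x₀, ?_⟩
  intro T hT x hx hTx Ω _ P _ X Z hN
  obtain ⟨⟨k1, k2⟩, ⟨k3, k4⟩, k5, k6⟩ := hx₀ x hx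
  have hx0 : 0 < x := by linarith
  obtain ⟨hW0, hpow⟩ := window_nonneg_and_pow_le hQ0 hε hε1 hcard hT
  set W := window K Q ε (1 / (T : ℝ))
  have hη : 0 < 1 / x := by positivity
  have main := occ_gap_le (order := order) hθ hθ1 hQ hN hμ hmono hε hε1 hμε hW0 hp hsep hn0 hn hT
    k6 hTx k5 (by linarith) (fun i hi => by
      have h1 := hmono (hnext i hi)
      have h2 : (1 - μ i) * (1 / x) ≤ 1 * (1 / x) :=
        mul_le_mul_of_nonneg_right (by linarith [hpos i]) hη.le
      linarith) (fun i hi => (k2 i (by rw [← hIoi]; exact Finset.mem_compl.2 hi)).1)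
  rw [hIoi] at main
  refine main.trans ?_
  have hlog : 0 ≤ Real.logb 2 N :=
    Real.logb_nonneg one_lt_two (by exact_mod_cast (by omega : 1 ≤ N))
  have hx2 : 1 ≤ x ^ 2 := one_le_pow₀ k6
  have hA0 : 0 ≤ A := by positivity
  have p1 : maxGap μ θ Q * ((W + 1) * Real.logb 2 N + (N / ε + T * ((N + 1 : ℕ) *
      ((1 - ε) ^ Q) ^ windowRounds W))) ≤ W * Real.logb 2 N * maxGap μ θ Q + A * x ^ 2 := by
    have : (T : ℝ) * ((N + 1 : ℕ) * ((1 - ε) ^ Q) ^ windowRounds W) ≤ N + 1 := by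
      push_cast
      nlinarith
    calc _ ≤ maxGap μ θ Q * ((W + 1) * Real.logb 2 N + (N / ε + (N + 1))) := by gcongr
      _ = W * Real.logb 2 N * maxGap μ θ Q + A * 1 := by rw [hA]; ring
      _ ≤ _ := by gcongr
  have hterm : ∀ i ∈ Finset.Ioi p, 0 ≤ (μ i - μ p) * x ^ 3 / klBer (μ i) (μ p) := fun i hi => by
    have h1 := hpi i hi
    have h2 := klBer_pos (hpos i) (hμ i).2 (hpos p) (h1.trans_le (hμ i).2) h1.ne
    have : 0 ≤ μ i - μ p := by linarith
    positivity
  have hsum0 : 0 ≤ ∑ i ∈ Finset.Ioi p, (μ i - μ p) * x ^ 3 / klBer (μ i) (μ p) :=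
    Finset.sum_nonneg hterm
  have p2 : ∑ i ∈ Finset.Ioi p, ENNReal.ofReal (leadingBound (μ i) (μ p) x) ≤
      ENNReal.ofReal (∑ i ∈ Finset.Ioi p, (μ i - μ p) * x ^ 3 / klBer (μ i) (μ p) +
        (∑ i ∈ Finset.Ioi p, |C i|) * x ^ 2) := by
    rw [Finset.sum_mul, ← Finset.sum_add_distrib, ENNReal.ofReal_sum_of_nonneg fun i hi =>
      add_nonneg (hterm i hi) (by positivity)]
    refine Finset.sum_le_sum fun i hi => ENNReal.ofReal_le_ofReal ((k2 i hi).2.trans ?_)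
    gcongr
    exact le_abs_self _
  have p3 : (K : ℝ≥0∞) * exceptionalBound μ (Finset.Iic p) y δ n x ≤
      ENNReal.ofReal (K * E * x ^ 2) := by
    rw [ENNReal.ofReal_mul (by positivity), ENNReal.ofReal_mul (by positivity),
      ENNReal.ofReal_natCast, ENNReal.ofReal_coe_nnreal, mul_assoc]
    gcongr
  have hC0 : 0 ≤ ∑ i ∈ Finset.Ioi p, |C i| := Finset.sum_nonneg fun i _ => abs_nonneg _
  calc _ ≤ ENNReal.ofReal (W * Real.logb 2 N * maxGap μ θ Q + A * x ^ 2) +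
        (ENNReal.ofReal (∑ i ∈ Finset.Ioi p, (μ i - μ p) * x ^ 3 / klBer (μ i) (μ p) +
          (∑ i ∈ Finset.Ioi p, |C i|) * x ^ 2) + ENNReal.ofReal (K * E * x ^ 2)) :=
        add_le_add (ENNReal.ofReal_le_ofReal p1) (add_le_add p2 p3)
    _ = _ := by
        rw [← ENNReal.ofReal_add (by positivity) (by positivity),
          ← ENNReal.ofReal_add (by positivity) (by positivity)]
        congr 1
        ring

/-- The expected regret is a sum over the rounds. -/
lemma integrable_regret_and_integral_le {K : ℕ} {μ : Fin K → ℝ} {θ Q W : ℝ}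
    {order : Equiv.Perm (Fin K)} {Ω : Type*} [MeasurableSpace Ω] {P : Measure Ω}
    [IsProbabilityMeasure P] {X : ℕ → Fin K → Ω → Bool} {Z : ℕ → Fin K → ℕ → ℕ → Ω → ℝ}
    (hN : IsNoise μ P X Z) (hμ : ∀ i, μ i ∈ Set.Icc (0 : ℝ) 1) (hθ : 0 < θ) (hQ : θ ≤ Q)
    (hcard : 2 ≤ (candidates K Q).card) {T : ℕ} {B : ℝ} (hB : 0 ≤ B)
    (h : occ θ Q W order P X Z T (fun s z => ENNReal.ofReal (gap μ θ Q (s.alloc Q order z))) ≤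
      ENNReal.ofReal B) :
    Integrable (regret μ θ Q W order X Z T) P ∧ ∫ ω, regret μ θ Q W order X Z T ω ∂P ≤ B := by
  have hmeas : ∀ t, Measurable fun ω => gap μ θ Q (allocation θ Q W order X Z t ω) := fun t =>
    measurable_apply_countable (measurable_st hθ hN t)
      (g := fun s ω => gap μ θ Q (s.alloc Q order (samples Z t s ω)))
      fun s => (measurable_alloc_comp (gap μ θ Q) s).comp (measurable_samples_of hN t s)
  have hfeas : ∀ t ω, allocation θ Q W order X Z t ω ∈ feasible K Q := fun t ω =>
    alloc_mem_feasible (hθ.trans_le hQ)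
      (bracket_state (W := W) (order := order) (X := X) (Z := Z) (t := t) hθ hcard ⟨ω, rfl⟩) _
  have h0 : ∀ t ω, 0 ≤ gap μ θ Q (allocation θ Q W order X Z t ω) := fun t ω =>
    gap_nonneg hμ (hfeas t ω)
  have hint : ∀ t, Integrable (fun ω => gap μ θ Q (allocation θ Q W order X Z t ω)) P := fun t =>
    Integrable.of_bound (hmeas t).aestronglyMeasurable (maxGap μ θ Q)
      (Filter.Eventually.of_forall fun ω => by
        rw [Real.norm_eq_abs, abs_of_nonneg (h0 t ω)]
        exact gap_le_maxGap hμ (hfeas t ω))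
  refine ⟨integrable_finsetSum _ fun t _ => hint t, ?_⟩
  have hnn : ∀ ω, 0 ≤ regret μ θ Q W order X Z T ω := fun ω => Finset.sum_nonneg fun t _ => h0 t ω
  rw [integral_eq_lintegral_of_nonneg_ae (Filter.Eventually.of_forall hnn)
    (Finset.measurable_sum _ fun t _ => hmeas t).aestronglyMeasurable]
  refine ENNReal.toReal_le_of_le_ofReal hB (le_trans (le_of_eq ?_) h)
  refine Eq.trans (lintegral_congr fun ω => ?_)
    (lintegral_finsetSum _ fun t _ => (hmeas t).ennreal_ofReal)
  rw [regret, ENNReal.ofReal_sum_of_nonneg fun t _ => h0 t ω]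
  rfl

end CSB

end

/-! ### The theorem: joining large and small horizons. -/

theorem mainTheorem1 {K : ℕ} (μ : Fin K → ℝ) (θ Q ε : ℝ)
    (hμ : ∀ i, μ i ∈ Set.Icc (0 : ℝ) 1) (hmono : Monotone μ)
    (hθ : 0 < θ) (hθ1 : θ ≤ 1) (hQ : θ ≤ Q)
    (hε : 0 < ε) (hμε : ∀ i, ε ≤ μ i)
    -- `p` is the arm number `K - M` and `q` is the arm number `K - M + 1` (counted from one)
    (p q : Fin K) (hp : (p : ℕ) + 1 + CSB.numCovered K θ Q = K)
    (hq : (q : ℕ) + CSB.numCovered K θ Q = K) (hpq : μ p < μ q)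
    -- the order in which the learner lists the arms
    (order : Equiv.Perm (Fin K)) :
    ∃ C : ℝ, ∀ T : ℕ, 2 ≤ T →
      ∀ (Ω : Type*) [MeasurableSpace Ω] (P : MeasureTheory.Measure Ω)
        [MeasureTheory.IsProbabilityMeasure P]
        (X : ℕ → Fin K → Ω → Bool) (Z : ℕ → Fin K → ℕ → ℕ → Ω → ℝ),
        CSB.IsNoise μ P X Z →
        MeasureTheory.Integrable
            (CSB.regret μ θ Q (CSB.window K Q ε (1 / (T : ℝ))) order X Z T) P ∧
          ∫ ω, CSB.regret μ θ Q (CSB.window K Q ε (1 / (T : ℝ))) order X Z T ω ∂P ≤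
            CSB.window K Q ε (1 / (T : ℝ)) * Real.logb 2 ((CSB.candidates K Q).card : ℝ)
                * CSB.maxGap μ θ Q
              + C * Real.log (T : ℝ) ^ ((2 : ℝ) / 3)
              + ∑ i ∈ Finset.Ioi p,
                  (μ i - μ p) * Real.log (T : ℝ) / CSB.klBer (μ i) (μ p) := by
  have hM : CSB.numCovered K θ Q < K := by omega
  have hQ0 : 0 < Q := hθ.trans_le hQ
  have hcard := CSB.two_le_card_candidates hθ hθ1 hQ hM
  have hpos : ∀ i, 0 < μ i := fun i => hε.trans_le (hμε i)
  have hε1 : ε < 1 := (hμε p).trans_lt (hpq.trans_le (hμ q).2)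
  have hΔ : 0 ≤ CSB.maxGap μ θ Q := CSB.maxGap_nonneg hμ hQ0.le
  obtain ⟨C, x₀, hC⟩ := CSB.exists_occ_gap_le_of_large hμ hmono hθ hθ1 hQ hε hμε hp hq hpq order
  set c := Real.log 2 ^ ((2 : ℝ) / 3) with hc
  have hlog2 : 0 < Real.log 2 := Real.log_pos one_lt_two
  have hc0 : 0 < c := Real.rpow_pos_of_pos hlog2 _
  -- The second summand serves the small horizons: there `T ≤ exp (x₀ ^ 3)`, and `T ≥ 2` gives `x ^
  -- 2 ≥ c`, so dividing by `c` turns the crude bound into a multiple of `x ^ 2`.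
  refine ⟨|C| + Real.exp (x₀ ^ 3) * CSB.maxGap μ θ Q / c, ?_⟩
  intro T hT Ω _ P _ X Z hN
  obtain ⟨hW0, -⟩ := CSB.window_nonneg_and_pow_le hQ0 hε hε1 hcard (by omega : 1 ≤ T)
  set W := CSB.window K Q ε (1 / (T : ℝ))
  have hT2 : (2 : ℝ) ≤ T := by exact_mod_cast hT
  have hlogT : Real.log 2 ≤ Real.log T := Real.log_le_log (by norm_num) hT2
  have hlog0 : 0 < Real.log T := hlog2.trans_le hlogT
  set x := Real.log T ^ ((1 : ℝ) / 3) with hx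
  have hx3 : Real.log T = x ^ 3 := by
    rw [hx, ← Real.rpow_natCast, ← Real.rpow_mul hlog0.le]
    norm_num
  have hx2 : Real.log T ^ ((2 : ℝ) / 3) = x ^ 2 := by
    rw [hx, ← Real.rpow_natCast, ← Real.rpow_mul hlog0.le]
    norm_num
  have hcx : c ≤ x ^ 2 := by
    rw [← hx2]
    exact Real.rpow_le_rpow hlog2.le hlogT (by norm_num)
  have hlogb : 0 ≤ Real.logb 2 ((CSB.candidates K Q).card : ℝ) :=
    Real.logb_nonneg one_lt_two (by exact_mod_cast (by omega : 1 ≤ (CSB.candidates K Q).card))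
  have hfirst : 0 ≤ W * Real.logb 2 ((CSB.candidates K Q).card : ℝ) * CSB.maxGap μ θ Q := by
    positivity
  have hterm : ∀ i ∈ Finset.Ioi p, 0 ≤ (μ i - μ p) * x ^ 3 / CSB.klBer (μ i) (μ p) :=
    fun i hi => by
    have h1 : μ p < μ i := by
      have hpi := Finset.mem_Ioi.1 hi
      rw [Fin.lt_def] at hpi
      exact hpq.trans_le (hmono (Fin.le_def.2 (by omega)))
    have h2 := CSB.klBer_pos (hpos i) (hμ i).2 (hpos p) (h1.trans_le (hμ i).2) h1.ne
    have : 0 ≤ μ i - μ p := by linarith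
    have : 0 ≤ x ^ 3 := hx3 ▸ hlog0.le
    positivity
  have hsum := Finset.sum_nonneg hterm
  have hexp : 0 ≤ Real.exp (x₀ ^ 3) * CSB.maxGap μ θ Q / c := by positivity
  rw [hx2]
  simp only [hx3]
  refine CSB.integrable_regret_and_integral_le hN hμ hθ hQ hcard (by positivity) ?_
  rcases le_or_gt x₀ x with h | h
  · refine (hC T (by omega) x h hx3 Ω P X Z hN).trans (ENNReal.ofReal_le_ofReal ?_)
    gcongr
    linarith [le_abs_self C]
  -- Below `x₀` no asymptotics apply; every round is charged the maximal gap.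
  · refine (CSB.occ_gap_crude_le hθ hQ hcard hμ T).trans ?_
    rw [← ENNReal.ofReal_natCast, ← ENNReal.ofReal_mul (Nat.cast_nonneg T)]
    refine ENNReal.ofReal_le_ofReal ?_
    have hTe : (T : ℝ) ≤ Real.exp (x₀ ^ 3) := by
      rw [← Real.exp_log (by linarith : (0 : ℝ) < T), hx3]
      refine Real.exp_le_exp.2 ?_
      have : 0 ≤ x := Real.rpow_nonneg hlog0.le _
      gcongr
    calc (T : ℝ) * CSB.maxGap μ θ Q ≤ Real.exp (x₀ ^ 3) * CSB.maxGap μ θ Q := by gcongr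
      _ = Real.exp (x₀ ^ 3) * CSB.maxGap μ θ Q / c * c := (div_mul_cancel₀ _ hc0.ne').symm
      _ ≤ (|C| + Real.exp (x₀ ^ 3) * CSB.maxGap μ θ Q / c) * x ^ 2 := by
        gcongr
        linarith [abs_nonneg C]
      _ ≤ _ := by linarith
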